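/- All graphs are undirected and simple. A graph is locally finite if every vertex has finite degree, and $2$-connected if it has more than two vertices and remains connected after the deletion of at most one vertex. The claw is $K_{1,3}$; a graph is claw-free if it has no induced subgraph isomorphic to the claw. A bull is a graph isomorphic to the one on the five vertices $z,a_1,a_2,b_1,b_2$ with edges $za_1, za_2, a_1a_2, a_1b_1, a_2b_2$; its two vertices of degree $1$ ($b_1$ and $b_2$) are its horns. For a locally finite connected graph $G$, let $|G|$ denote its Freudenthal compactification, that is, the $1$-complex $G$ together with the ends of $G$, in which the sets consisting of the component $C(S,\omega)$ of $G-S$ in which $\omega$ lives, all ends living in $C(S,\omega)$, and all inner points at distance less than $\varepsilon$ from $C(S,\omega)$ on the edges between $S$ and $C(S,\omega)$ (for $S\subseteq V(G)$ finite, $\varepsilon>0$) form a neighbourhood basis of the end $\omega$. A circle in $|G|$ is a subspace of $|G|$ homeomorphic to the unit circle $S^1\subseteq\mathbb{R}^2$, and a Hamilton circle of $G$ is a circle in $|G|$ that contains all vertices of $G$. **Theorem.** Let $G$ be a (finite or infinite) locally finite, $2$-connected, claw-free graph. If for every induced bull $B$ in $G$ the horns of $B$ have a common neighbour in $G-B$,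 then $G$ is Hamiltonian, i.e. $G$ has a Hamilton circle. -/

import Mathlib

namespace SimpleGraph

universe u

variable {V : Type u} (G : SimpleGraph V)

/-- `G` is `k`-connected: it has more than `k` vertices, and deleting fewer than `k` vertices
always leaves a connected graph. -/
def IsVertexConnected (k : ℕ) : Prop :=
  (k : ℕ∞) < ENat.card V ∧ ∀ X : Set V, X.encard < (k : ℕ∞) → (G.induce Xᶜ).Connected

/-- `G` is `H`-free: `G` has no induced subgraph isomorphic to `H`.
(An embedding `H ↪g G` preserves and reflects adjacency.) -/
def IsInducedFree {W : Type*} (H : SimpleGraph W) : Prop :=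
  IsEmpty (H ↪g G)

/-- The claw `K_{1,3}`. -/
abbrev claw : SimpleGraph (Fin 1 ⊕ Fin 3) :=
  completeBipartiteGraph (Fin 1) (Fin 3)

/-- The bull: a triangle `0, 1, 2` together with a pendant vertex `3` attached to `1` and a pendant
vertex `4` attached to `2`. Its horns are the two vertices `3` and `4` of degree one. -/
def bull : SimpleGraph (Fin 5) :=
  fromEdgeSet {s(0, 1), s(0, 2), s(1, 2), s(1, 3), s(2, 4)}

/-- The horns of every induced bull `B` of `G` have a common neighbour in `G - B`. -/
def BullHornsHaveCommonNeighbor : Prop :=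
  ∀ B : bull ↪g G, ∃ w : V, w ∉ Set.range B ∧ G.Adj (B 3) w ∧ G.Adj (B 4) w

open Classical in
/-- The 1-complex of `G` in barycentric coordinates: the union of all vertices (unit vectors of
`V → ℝ`) and of the segments joining adjacent vertices. It carries the subspace topology of the
product `V → ℝ`, which for a locally finite graph is the usual topology of the 1-complex. -/
def realization : Set (V → ℝ) :=
  {x | ∃ u v : V, (u = v ∨ G.Adj u v) ∧
    x ∈ segment ℝ (Pi.single u (1 : ℝ) : V → ℝ) (Pi.single v (1 : ℝ))}

open Classical in
/-- A vertex, as a point of the 1-complex. -/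
noncomputable def realizationVertex (v : V) : G.realization :=
  ⟨Pi.single v 1, v, v, Or.inl rfl, left_mem_segment ℝ _ _⟩

variable {G}

/-- The component `C(S, ω)` of `G - S` in which the end `ω` lives. -/
def endComponent (S : Finset V) (ω : G.end) : G.ComponentCompl (S : Set V) :=
  ω.1 (Opposite.op S)

theorem endComponent_subset {S T : Finset V} (h : S ⊆ T) (ω : G.end) :
    (endComponent T ω : Set V) ⊆ (endComponent S ω : Set V) := by
  have h1 : ComponentCompl.hom (Finset.coe_subset.2 h) (endComponent T ω) = endComponent S ω :=
    ω.2 (CategoryTheory.opHomOfLE h)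
  exact (ComponentCompl.hom_eq_iff_le _ _ _).1 h1

theorem endComponent_eq_of_subset {S T : Finset V} (h : S ⊆ T) {ω ω' : G.end}
    (hT : endComponent T ω' = endComponent T ω) : endComponent S ω' = endComponent S ω := by
  have h1 : ∀ η : G.end,
      ComponentCompl.hom (Finset.coe_subset.2 h) (endComponent T η) = endComponent S η :=
    fun η => η.2 (CategoryTheory.opHomOfLE h)
  rw [← h1 ω', ← h1 ω, hT]

variable (G)

/-- The points of the Freudenthal compactification `|G|`: the points of the 1-complex `G` and the
ends of `G`. -/
inductive Freudenthal : Type u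
  | point (x : G.realization) : Freudenthal
  | ofEnd (ω : G.end) : Freudenthal

variable {G}

namespace Freudenthal

/-- The basic neighbourhood of the end `ω` given by a finite vertex set `S` and `ε > 0`: all
vertices and edges of the component `C = C(S, ω)` of `G - S`, all ends living in `C`, and all inner
points of edges between `S` and `C` at distance less than `ε` from their endpoint in `C`.
(An edge with an endpoint in `C` has its other endpoint in `C` or in `S`; in the latter case the
coordinate at that other endpoint is the distance to the endpoint in `C`.) -/
def endNhd (S : Finset V) (ε : ℝ) (ω : G.end) : Set (Freudenthal G) :=
  {p | match p with
    | point x => (∃ v ∈ endComponent S ω, 0 < x.1 v) ∧ ∑ v ∈ S, x.1 v < ε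
    | ofEnd ω' => endComponent S ω' = endComponent S ω}

theorem realization_nonneg (x : G.realization) (v : V) : 0 ≤ x.1 v := by
  classical
  obtain ⟨x, a, b, -, s, t, hs, ht, -, rfl⟩ := x
  simp only [Pi.add_apply, Pi.smul_apply, smul_eq_mul, Pi.single_apply]
  split_ifs <;> simp <;> linarith

theorem endNhd_subset {S T : Finset V} {δ ε : ℝ} (h : S ⊆ T) (hδ : δ ≤ ε) (ω : G.end) :
    endNhd T δ ω ⊆ endNhd S ε ω := by
  rintro (x | ω') hp
  · obtain ⟨⟨v, hv, hxv⟩, hs⟩ := hp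
    refine ⟨⟨v, endComponent_subset h ω hv, hxv⟩, ?_⟩
    exact (Finset.sum_le_sum_of_subset_of_nonneg h
      fun i _ _ => realization_nonneg x i).trans_lt (hs.trans_le hδ)
  · exact endComponent_eq_of_subset h hp

/-- The topology of `|G|`: a set is open if it meets the 1-complex in an open set and contains, with
every end `ω`, some basic neighbourhood of `ω`. -/
instance : TopologicalSpace (Freudenthal G) where
  IsOpen U := IsOpen {x : G.realization | point x ∈ U} ∧
    ∀ ω : G.end, ofEnd ω ∈ U → ∃ S : Finset V, ∃ ε : ℝ, 0 < ε ∧ endNhd S ε ω ⊆ U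
  isOpen_univ := ⟨by simp, fun _ _ => ⟨∅, 1, one_pos, Set.subset_univ _⟩⟩
  isOpen_inter U W hU hW := by
    classical
    refine ⟨hU.1.inter hW.1, fun ω hω => ?_⟩
    obtain ⟨S, ε, hε, hS⟩ := hU.2 ω hω.1
    obtain ⟨T, δ, hδ, hT⟩ := hW.2 ω hω.2
    exact ⟨S ∪ T, min ε δ, lt_min hε hδ, Set.subset_inter
      ((endNhd_subset Finset.subset_union_left (min_le_left _ _) ω).trans hS)
      ((endNhd_subset Finset.subset_union_right (min_le_right _ _) ω).trans hT)⟩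
  isOpen_sUnion 𝒰 h𝒰 := by
    refine ⟨?_, ?_⟩
    · have : {x : G.realization | point x ∈ ⋃₀ 𝒰} =
          ⋃ U ∈ 𝒰, {x : G.realization | point x ∈ U} := by
        ext x; simp
      rw [this]
      exact isOpen_biUnion fun U hU => (h𝒰 U hU).1
    · rintro ω ⟨U, hU, hω⟩
      obtain ⟨S, ε, hε, hS⟩ := (h𝒰 U hU).2 ω hω
      exact ⟨S, ε, hε, hS.trans (Set.subset_sUnion_of_mem hU)⟩

/-- A vertex, as a point of `|G|`. -/
noncomputable def vertex (v : V) : Freudenthal G :=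
  point (G.realizationVertex v)

end Freudenthal

/-- A circle in `|G|`: a homeomorphic image of the unit circle. -/
def IsCircle (C : Set (Freudenthal G)) : Prop :=
  ∃ f : Circle → Freudenthal G, Topology.IsEmbedding f ∧ Set.range f = C

/-- A Hamilton circle of `G`: a circle in `|G|` that contains all vertices of `G`. -/
def IsHamiltonCircle (C : Set (Freudenthal G)) : Prop :=
  IsCircle C ∧ ∀ v : V, Freudenthal.vertex v ∈ C

end SimpleGraph

/-! The finite case is Ryjáček's theorem; the infinite case is reduced to it by cutting off what
lies far out. Both use levels, that is, distances to a fixed set. Horns three levels apart have no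
common neighbour, so adjacent vertices of one level, from level two on, have the same children
(`IsLevel.child_of_adj`). From level three on, adjacent vertices of one level also have the same
parents if they have a child (`IsLevel.parent_of_adj`). Where all vertices have children, the graph
is thus made of chains of cliques, consecutive ones completely joined.

Finite case: suppose that a longest cycle misses a vertex, let H be a component of the rest, and
measure levels from H. The vertices of level one, the attachments, lie on the cycle, and
2-connectedness gives at least two of them. A path that avoids H and joins two attachments closes up
through H, so it has fewer vertices than the cycle (`card_lt_of_path`). Rerouting the cycle then
shows that children of different attachments are neither equal nor adjacent (`eq_of_common_child`,
`not_adj_of_ne`). Hence each vertex with a child lies in a branch with a single attachment and a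
narrow exit (`exists_branch`). Take a piece of the cycle that joins two attachments and contains all
of them. A vertex outside H missed by it can be inserted where the piece passes the exit of a
branch. In the end the piece covers everything outside H, a contradiction (`false_of_separated`).

Infinite case: levels are measured from one vertex and are finite. From some level `n` on, every
vertex has a child (`exists_forall_child`). Keep the levels up to `n` and one representative of each
clique on level `n + 1`. This finite core inherits the hypotheses and has a Hamilton cycle
(`exists_core_cycle`). The chain above level `n` containing a representative, its tail, has at least
two vertices on every level, since a single one would be a cut vertex. So the tail splits into two
rays converging to one end (`exists_tailRays`). Replacing each representative on the cycle by these
two rays and their end gives a circle: different tails have different ends (`end_unique`), so the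
inserted arcs meet only where they should. -/

namespace SimpleGraph

/-! ### Walks recorded by their vertex multisets -/

/-- A walk along the relation `R` from the first to the second argument, whose vertices, counted
with multiplicity, form the given multiset. -/
inductive SpanPath {V : Type*} (R : V → V → Prop) : V → V → Multiset V → Prop
  | single (a : V) : SpanPath R a a {a}
  | cons {a b c : V} {M : Multiset V} : R a b → SpanPath R b c M → SpanPath R a c (a ::ₘ M)

namespace SpanPath

variable {V : Type*} {R R' : V → V → Prop} {a b c d y : V} {M N : Multiset V}

theorem left_mem (h : SpanPath R a b M) : a ∈ M := by
  cases h <;> simp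

theorem right_mem (h : SpanPath R a b M) : b ∈ M := by
  induction h with
  | single => simp
  | cons _ _ ih => exact Multiset.mem_cons_of_mem ih

theorem mono (hR : ∀ x y, R x y → R' x y) (h : SpanPath R a b M) : SpanPath R' a b M := by
  induction h with
  | single => exact .single _
  | cons h _ ih => exact .cons (hR _ _ h) ih

theorem append (h : SpanPath R a b M) (hbc : R b c) (h' : SpanPath R c d N) :
    SpanPath R a d (M + N) := by
  induction h with
  | single => simpa using SpanPath.cons hbc h'
  | cons h _ ih => simpa using SpanPath.cons h (ih hbc)

theorem concat (h : SpanPath R a b M) (hbc : R b c) : SpanPath R a c (c ::ₘ M) := by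
  have := h.append hbc (.single c)
  rwa [add_comm, Multiset.singleton_add] at this

theorem reverse (hR : ∀ x y, R x y → R y x) (h : SpanPath R a b M) : SpanPath R b a M := by
  induction h with
  | single => exact .single _
  | cons h _ ih => exact ih.concat (hR _ _ h)

theorem symm {G : SimpleGraph V} (h : SpanPath G.Adj a b M) : SpanPath G.Adj b a M :=
  h.reverse fun _ _ h => h.symm

theorem uncons (h : SpanPath R a b M) :
    (a = b ∧ M = {a}) ∨ ∃ c M', R a c ∧ SpanPath R c b M' ∧ M = a ::ₘ M' := by
  cases h with
  | single => exact .inl ⟨rfl, rfl⟩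
  | cons h h' => exact .inr ⟨_, _, h, h', rfl⟩

theorem split (h : SpanPath R a b M) (hy : y ∈ M) :
    (y = a ∧ SpanPath R y b M) ∨ ∃ p M₁ M₂, SpanPath R a p M₁ ∧ R p y ∧ SpanPath R y b M₂ ∧
      M = M₁ + M₂ := by
  induction h with
  | single a => obtain rfl := Multiset.mem_singleton.1 hy; exact .inl ⟨rfl, .single _⟩
  | @cons a b c M h h' ih =>
    rcases Multiset.mem_cons.1 hy with rfl | hy
    · exact .inl ⟨rfl, .cons h h'⟩
    · right
      rcases ih hy with ⟨rfl, h''⟩ | ⟨p, M₁, M₂, h₁, hp, h₂, rfl⟩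
      · exact ⟨a, {a}, M, .single _, h, h'', by simp⟩
      · exact ⟨p, a ::ₘ M₁, M₂, .cons h h₁, hp, h₂, by simp⟩

/-- An interior vertex of a path has a predecessor and a successor. -/
theorem split_interior (h : SpanPath R a b M) (hy : y ∈ M) (ha : y ≠ a) (hb : y ≠ b) :
    ∃ p q M₁ M₂, SpanPath R a p M₁ ∧ R p y ∧ R y q ∧ SpanPath R q b M₂ ∧
      M = M₁ + ({y} + M₂) := by
  rcases h.split hy with ⟨rfl, -⟩ | ⟨p, M₁, M₂, h₁, hp, h₂, rfl⟩
  · exact absurd rfl ha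
  · rcases h₂.uncons with ⟨rfl, -⟩ | ⟨q, M₃, hq, h₃, rfl⟩
    · exact absurd rfl hb
    · exact ⟨p, q, M₁, M₃, h₁, hp, hq, h₃, by simp⟩

/-- Either all steps of a path satisfy `R'`, or the path can be cut at a step that does not. -/
theorem forall_or_split (R' : V → V → Prop) (h : SpanPath R a b M) :
    SpanPath (fun x y => R x y ∧ R' x y) a b M ∨
      ∃ p q M₁ M₂, SpanPath R a p M₁ ∧ R p q ∧ ¬ R' p q ∧ SpanPath R q b M₂ ∧ M = M₁ + M₂ := by
  induction h with
  | single a => exact .inl (.single a)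
  | @cons a b c M h h' ih =>
    by_cases hab : R' a b
    · rcases ih with ih | ⟨p, q, M₁, M₂, h₁, hp, hn, h₂, rfl⟩
      · exact .inl (.cons ⟨h, hab⟩ ih)
      · exact .inr ⟨p, q, a ::ₘ M₁, M₂, .cons h h₁, hp, hn, h₂, by simp⟩
    · exact .inr ⟨a, b, {a}, M, .single _, h, hab, h', by simp⟩

theorem all_of_invariant {P : V → Prop} (hP : ∀ x y, R x y → (P x ↔ P y))
    (h : SpanPath R a b M) : ∀ x ∈ M, (P x ↔ P a) := by
  induction h with
  | single a => intro x hx; rw [Multiset.mem_singleton.1 hx]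
  | cons h _ ih =>
    intro x hx
    rcases Multiset.mem_cons.1 hx with rfl | hx
    · rfl
    · rw [ih x hx, hP _ _ h]

/-- A path with vertices inside and outside of `P` has a step crossing the boundary of `P`. -/
theorem exists_crossing {P : V → Prop} (h : SpanPath R a b M) {x z : V} (hx : x ∈ M) (hz : z ∈ M)
    (hPx : P x) (hPz : ¬ P z) :
    ∃ p q M₁ M₂, SpanPath R a p M₁ ∧ R p q ∧ ¬ (P p ↔ P q) ∧ SpanPath R q b M₂ ∧
      M = M₁ + M₂ := by
  rcases h.forall_or_split (fun x y => (P x ↔ P y)) with h' | h'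
  · have := h'.all_of_invariant (P := P) fun _ _ h => h.2
    exact absurd ((this z hz).2 ((this x hx).1 hPx)) hPz
  · exact h'

theorem exists_last {P : V → Prop} (h : SpanPath R a b M) (ha : P a) :
    ∃ u M₁ M₂, SpanPath R a u M₁ ∧ P u ∧ M = M₁ + M₂ ∧ ∀ x ∈ M₂, ¬ P x := by
  classical
  induction h with
  | single a => exact ⟨a, {a}, 0, .single a, ha, by simp, by simp⟩
  | @cons a b c M h h' ih =>
    by_cases hM : ∃ x ∈ M, P x
    · obtain ⟨x, hx, hPx⟩ := hM
      by_cases hb : P b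
      · obtain ⟨u, M₁, M₂, h₁, hu, rfl, h₂⟩ := ih hb
        exact ⟨u, a ::ₘ M₁, M₂, .cons h h₁, hu, by simp, h₂⟩
      · clear ih
        -- The induction hypothesis needs `P` at the first vertex, which fails here; the auxiliary
        -- claim only needs `P` somewhere on the path.
        have key : ∀ {b c : V} {M : Multiset V}, SpanPath R b c M → (∃ x ∈ M, P x) →
            ∃ u M₁ M₂, SpanPath R b u M₁ ∧ P u ∧ M = M₁ + M₂ ∧ ∀ x ∈ M₂, ¬ P x := by
          intro b c M h
          induction h with
          | single a =>
            rintro ⟨x, hx, hPx⟩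
            rw [Multiset.mem_singleton.1 hx] at hPx
            exact ⟨a, {a}, 0, .single a, hPx, by simp, by simp⟩
          | @cons a b c M h h' ih =>
            rintro ⟨x, hx, hPx⟩
            by_cases hM : ∃ x ∈ M, P x
            · obtain ⟨u, M₁, M₂, h₁, hu, rfl, h₂⟩ := ih hM
              exact ⟨u, a ::ₘ M₁, M₂, .cons h h₁, hu, by simp, h₂⟩
            · rcases Multiset.mem_cons.1 hx with rfl | hx
              · exact ⟨x, {x}, M, .single _, hPx, by simp, fun y hy hPy => hM ⟨y, hy, hPy⟩⟩
              · exact absurd ⟨x, hx, hPx⟩ hM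
        obtain ⟨u, M₁, M₂, h₁, hu, rfl, h₂⟩ := key h' ⟨x, hx, hPx⟩
        exact ⟨u, a ::ₘ M₁, M₂, .cons h h₁, hu, by simp, h₂⟩
    · exact ⟨a, {a}, M, .single a, ha, by simp, fun y hy hPy => hM ⟨y, hy, hPy⟩⟩

theorem exists_nodup (h : SpanPath R a b M) :
    ∃ N, SpanPath R a b N ∧ N.Nodup ∧ ∀ x ∈ N, x ∈ M := by
  induction h with
  | single a => exact ⟨{a}, .single a, by simp, by simp⟩
  | @cons a b c M h h' ih =>
    obtain ⟨N, hN, hnd, hsub⟩ := ih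
    by_cases ha : a ∈ N
    · rcases hN.split ha with ⟨rfl, h₁⟩ | ⟨p, M₁, M₂, -, -, h₂, rfl⟩
      · exact ⟨N, hN, hnd, fun x hx => by simp [hsub x hx]⟩
      · exact ⟨M₂, h₂, (Multiset.nodup_add.1 hnd).2.1,
          fun x hx => Multiset.mem_cons_of_mem (hsub x (by simp [hx]))⟩
    · exact ⟨a ::ₘ N, .cons h hN, by simp [ha, hnd], fun x hx => by
        rcases Multiset.mem_cons.1 hx with rfl | hx
        · simp
        · simp [hsub x hx]⟩

theorem trans (h : SpanPath R a b M) (h' : SpanPath R b c N) :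
    ∃ L, SpanPath R a c L ∧ ∀ x ∈ L, x ∈ M ∨ x ∈ N := by
  induction h with
  | single a => exact ⟨N, h', fun x hx => .inr hx⟩
  | cons h _ ih =>
    obtain ⟨L, hL, hs⟩ := ih h'
    refine ⟨_, .cons h hL, fun x hx => ?_⟩
    rcases Multiset.mem_cons.1 hx with rfl | hx
    · simp
    · rcases hs x hx with h | h <;> simp [h]

end SpanPath

theorem Walk.spanPath {V : Type*} {G : SimpleGraph V} {a b : V} (p : G.Walk a b) :
    SpanPath G.Adj a b (p.support : Multiset V) := by
  induction p with
  | nil => exact .single _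
  | cons h _ ih => simpa using SpanPath.cons h ih

theorem SpanPath.map {V W : Type*} {R : V → V → Prop} {R' : W → W → Prop} {f : V → W}
    (hf : ∀ x y, R x y → R' (f x) (f y)) {a b : V} {M : Multiset V} (h : SpanPath R a b M) :
    SpanPath R' (f a) (f b) (M.map f) := by
  induction h with
  | single => exact .single _
  | cons h _ ih => simpa using SpanPath.cons (hf _ _ h) ih

end SimpleGraph

/-! ### Claws, bulls and distance levels -/

namespace SimpleGraph

variable {V : Type*} {G : SimpleGraph V}

theorem claw_free_adj (hclaw : G.IsInducedFree claw) {c x y z : V} (hx : G.Adj c x)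
    (hy : G.Adj c y) (hz : G.Adj c z) (hxy : x ≠ y) (hxz : x ≠ z) (hyz : y ≠ z) :
    G.Adj x y ∨ G.Adj x z ∨ G.Adj y z := by
  by_contra! hcon
  obtain ⟨h1, h2, h3⟩ := hcon
  have h1' : ¬ G.Adj y x := fun h => h1 h.symm
  have h2' : ¬ G.Adj z x := fun h => h2 h.symm
  have h3' : ¬ G.Adj z y := fun h => h3 h.symm
  have hx0 := hx.ne
  have hy0 := hy.ne
  have hz0 := hz.ne
  have hinj : Function.Injective (Sum.elim (fun _ : Fin 1 => c) ![x, y, z]) := by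
    rintro (i | i) (j | j) hij
    · simp [Subsingleton.elim i j]
    · fin_cases j <;> simp_all
    · fin_cases i <;> simp_all
    · fin_cases i <;> fin_cases j <;> simp_all
  have hadj : ∀ i j, G.Adj (Sum.elim (fun _ : Fin 1 => c) ![x, y, z] i)
      (Sum.elim (fun _ : Fin 1 => c) ![x, y, z] j) ↔ claw.Adj i j := by
    rintro (i | i) (j | j)
    · simp [claw]
    · fin_cases j <;> simp_all [claw]
    · fin_cases i <;> simp_all [claw, G.adj_comm]
    · fin_cases i <;> fin_cases j <;> simp_all [claw]
  exact hclaw.false ⟨⟨_, hinj⟩, hadj _ _⟩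

/-- The adjacencies and non-adjacencies already force the five vertices to be distinct, so no
inequalities are assumed. -/
theorem bull_common_neighbor (hbull : G.BullHornsHaveCommonNeighbor) {z a₁ a₂ b₁ b₂ : V}
    (h1 : G.Adj z a₁) (h2 : G.Adj z a₂) (h3 : G.Adj a₁ a₂) (h4 : G.Adj a₁ b₁) (h5 : G.Adj a₂ b₂)
    (n1 : ¬ G.Adj z b₁) (n2 : ¬ G.Adj z b₂) (n3 : ¬ G.Adj a₁ b₂) (n4 : ¬ G.Adj a₂ b₁)
    (n5 : ¬ G.Adj b₁ b₂) :
    ∃ w, G.Adj b₁ w ∧ G.Adj b₂ w := by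
  have e1 := h1.ne
  have e2 := h2.ne
  have e3 := h3.ne
  have e4 := h4.ne
  have e5 := h5.ne
  have e6 : z ≠ b₁ := by rintro rfl; exact n4 h2.symm
  have e7 : z ≠ b₂ := by rintro rfl; exact n3 h1.symm
  have e8 : a₁ ≠ b₂ := by rintro rfl; exact n2 h1
  have e9 : a₂ ≠ b₁ := by rintro rfl; exact n1 h2
  have e10 : b₁ ≠ b₂ := by rintro rfl; exact n3 h4
  have s1 := h1.symm
  have s2 := h2.symm
  have s3 := h3.symm
  have s4 := h4.symm
  have s5 := h5.symm
  have m1 : ¬ G.Adj b₁ z := fun h => n1 h.symm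
  have m2 : ¬ G.Adj b₂ z := fun h => n2 h.symm
  have m3 : ¬ G.Adj b₂ a₁ := fun h => n3 h.symm
  have m4 : ¬ G.Adj b₁ a₂ := fun h => n4 h.symm
  have m5 : ¬ G.Adj b₂ b₁ := fun h => n5 h.symm
  have hinj : Function.Injective ![z, a₁, a₂, b₁, b₂] := by
    intro i j hij
    fin_cases i <;> fin_cases j <;> simp_all
  have hadj : ∀ i j, G.Adj (![z, a₁, a₂, b₁, b₂] i) (![z, a₁, a₂, b₁, b₂] j) ↔
      bull.Adj i j := by
    intro i j
    fin_cases i <;> fin_cases j <;> simp_all [bull]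
  obtain ⟨w, -, hw⟩ := hbull ⟨⟨_, hinj⟩, hadj _ _⟩
  exact ⟨w, hw⟩

/-- `d` behaves like the distance to the set of its zeros. -/
structure IsLevel (G : SimpleGraph V) (d : V → ℕ) : Prop where
  lip : ∀ {x y}, G.Adj x y → d x ≤ d y + 1
  parent : ∀ {x k}, d x = k + 1 → ∃ p, G.Adj x p ∧ d p = k

namespace IsLevel

variable {d : V → ℕ} (hd : G.IsLevel d) (hclaw : G.IsInducedFree claw)
  (hbull : G.BullHornsHaveCommonNeighbor)

include hd

theorem not_adj {x y : V} (h : d x + 2 ≤ d y) : ¬ G.Adj x y := fun ha => by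
  have := hd.lip ha.symm; omega

include hclaw

/-- A parent of `x` is two levels below both children, so together they would form a claw at `x`. -/
theorem children_adj {x y y' : V} (hx : 1 ≤ d x) (h : G.Adj x y) (h' : G.Adj x y')
    (hy : d y = d x + 1) (hy' : d y' = d x + 1) (hne : y ≠ y') : G.Adj y y' := by
  obtain ⟨p, hp, hdp⟩ := hd.parent (x := x) (k := d x - 1) (by omega)
  rcases claw_free_adj hclaw hp h h' (by rintro rfl; omega) (by rintro rfl; omega) hne with
    h1 | h1 | h1
  · exact absurd h1 (hd.not_adj (by omega))
  · exact absurd h1 (hd.not_adj (by omega))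
  · exact h1

/-- The child `c` serves as third leaf of a claw at `y`; hence it must exist. -/
theorem parents_adj {c y p p' : V} (hc : G.Adj y c) (hdc : d c = d y + 1) (hp : G.Adj y p)
    (hdp : d y = d p + 1) (hp' : G.Adj y p') (hdp' : d y = d p' + 1) (hne : p ≠ p') :
    G.Adj p p' := by
  rcases claw_free_adj hclaw hp hp' hc hne (by rintro rfl; omega) (by rintro rfl; omega) with
    h1 | h1 | h1
  · exact h1
  · exact absurd h1 (hd.not_adj (by omega))
  · exact absurd h1 (hd.not_adj (by omega))

include hbull

/-- Adjacent vertices on the same level have the same children. -/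
theorem child_of_adj {x y c : V} (hxy : G.Adj x y) (hdxy : d y = d x) (h2 : 2 ≤ d x)
    (hc : G.Adj x c) (hdc : d c = d x + 1) : G.Adj y c := by
  by_contra hyc
  obtain ⟨p, hp, hdp⟩ := hd.parent (x := x) (k := d x - 1) (by omega)
  by_cases hpy : G.Adj p y
  · obtain ⟨q, hq, hdq⟩ := hd.parent (x := p) (k := d x - 2) (by omega)
    -- The horns `c` and `q` are three levels apart, so `w` cannot exist. The existence of `q` uses
    -- level at least two.
    obtain ⟨w, hw, hw'⟩ := bull_common_neighbor hbull (z := y) (a₁ := x) (a₂ := p) (b₁ := c)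
      (b₂ := q) hxy.symm hpy.symm hp hc hq hyc (fun h => hd.not_adj (by omega) h.symm)
      (fun h => hd.not_adj (by omega) h.symm) (hd.not_adj (by omega))
      (fun h => hd.not_adj (by omega) h.symm)
    have := hd.lip hw
    have := hd.lip hw'.symm
    omega
  · rcases claw_free_adj hclaw hp hxy hc (by rintro rfl; omega) (by rintro rfl; omega)
      (by rintro rfl; omega) with h1 | h1 | h1
    · exact hpy h1
    · exact hd.not_adj (by omega) h1
    · exact hyc h1

/-- Otherwise `c` is the apex of a bull on `y`, `y'` with horns `p`, `p'`. A common neighbour of the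
horns is on their level or on one next to it; each position makes `p` adjacent to `p'` or to `y'`.
-/
theorem parent_of_adj {y y' c p p' : V} (hyy : G.Adj y y') (hdy : d y' = d y) (h3 : 3 ≤ d y)
    (hc : G.Adj y c) (hdc : d c = d y + 1) (hp : G.Adj y p) (hdp : d y = d p + 1)
    (hp' : G.Adj y' p') (hdp' : d y' = d p' + 1) : G.Adj p y' := by
  have hc' := hd.child_of_adj hclaw hbull hyy hdy (by omega) hc hdc
  by_contra hpy
  have hne : p ≠ p' := by rintro rfl; exact hpy hp'.symm
  have hpp : ¬ G.Adj p p' := fun h => hpy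
    (hd.child_of_adj hclaw hbull h.symm (by omega) (by omega) hp'.symm (by omega))
  have hpy' : ¬ G.Adj p' y := fun h => hpp
    (hd.parents_adj hclaw hc hdc hp hdp h.symm (by omega) hne)
  obtain ⟨w, hw, hw'⟩ := bull_common_neighbor hbull (z := c) (a₁ := y) (a₂ := y') (b₁ := p)
      (b₂ := p') hc.symm hc'.symm hyy hp hp' (fun h => hd.not_adj (by omega) h.symm)
      (fun h => hd.not_adj (by omega) h.symm) (fun h => hpy' h.symm) (fun h => hpy h.symm) hpp
  have l1 := hd.lip hw
  have l2 := hd.lip hw.symm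
  obtain h | h | h : d w + 1 = d p ∨ d w = d p ∨ d w = d y := by omega
  · exact hpp (hd.children_adj hclaw (by omega) hw.symm hw'.symm (by omega) (by omega) hne)
  · have hwy := hd.child_of_adj hclaw hbull hw (by omega) (by omega) hp.symm hdp
    have hwy' := hd.child_of_adj hclaw hbull hw' (by omega) (by omega) hp'.symm hdp'
    exact hpy (hd.child_of_adj hclaw hbull hw.symm (by omega) (by omega) hwy' (by omega))
  · have hwy : w ≠ y := by rintro rfl; exact hpy' hw'
    have hwy := hd.children_adj hclaw (by omega) hw hp.symm (by omega) (by omega) hwy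
    have hwc := hd.child_of_adj hclaw hbull hwy.symm (by omega) (by omega) hc (by omega)
    exact hpp (hd.parents_adj hclaw hwc (by omega) hw.symm (by omega) hw'.symm (by omega) hne)

/-- By `parent_of_adj`, a parent of the middle vertex is a parent of all three, and children of one
vertex are adjacent. -/
theorem adj_trans {y y' y'' c : V} (h3 : 3 ≤ d y') (hc : G.Adj y' c) (hdc : d c = d y' + 1)
    (h : G.Adj y' y) (hdy : d y = d y') (h' : G.Adj y' y'') (hdy' : d y'' = d y')
    (hne : y ≠ y'') : G.Adj y y'' := by
  obtain ⟨p, hp, hdp⟩ := hd.parent (x := y') (k := d y' - 1) (by omega)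
  obtain ⟨q, hq, hdq⟩ := hd.parent (x := y) (k := d y' - 1) (by omega)
  obtain ⟨r, hr, hdr⟩ := hd.parent (x := y'') (k := d y' - 1) (by omega)
  have h1 := hd.parent_of_adj hclaw hbull h hdy h3 hc hdc hp (by omega) hq (by omega)
  have h2 := hd.parent_of_adj hclaw hbull h' hdy' h3 hc hdc hp (by omega) hr (by omega)
  exact hd.children_adj hclaw (by omega) h1 h2 (by omega) (by omega) hne

end IsLevel

theorem exists_isLevel (hG : G.Preconnected) {H : Set V} (hH : H.Nonempty) :
    ∃ d : V → ℕ, G.IsLevel d ∧ ∀ x, d x = 0 ↔ x ∈ H := by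
  classical
  have hmem : ∀ x, sInf (G.dist x '' H) ∈ G.dist x '' H := fun x => Nat.sInf_mem (hH.image _)
  refine ⟨fun x => sInf (G.dist x '' H), ⟨?_, ?_⟩, fun x => ⟨fun h => ?_, fun h => ?_⟩⟩
  · intro x y hxy
    obtain ⟨h, hh, he⟩ := hmem y
    have h1 : sInf (G.dist x '' H) ≤ G.dist x h := Nat.sInf_le ⟨h, hh, rfl⟩
    have h2 : G.dist x h ≤ G.dist x y + G.dist y h :=
      (Connected.mk (nonempty := ⟨x⟩) hG).dist_triangle
    rw [dist_eq_one_iff_adj.2 hxy] at h2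
    omega
  · intro x k hk
    replace hk : sInf (G.dist x '' H) = k + 1 := hk
    obtain ⟨h, hh, he⟩ := hmem x
    obtain ⟨w, hw⟩ := (hG x h).exists_walk_length_eq_dist
    cases w with
    | nil => rw [dist_self] at he; omega
    | @cons _ p _ hxp w =>
      refine ⟨p, hxp, ?_⟩
      have h1 : sInf (G.dist p '' H) ≤ G.dist p h := Nat.sInf_le ⟨h, hh, rfl⟩
      have h2 := dist_le w
      rw [Walk.length_cons] at hw
      obtain ⟨h', hh', he'⟩ := hmem p
      have h3 : sInf (G.dist x '' H) ≤ G.dist x h' := Nat.sInf_le ⟨h', hh', rfl⟩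
      have h4 : G.dist x h' ≤ G.dist x p + G.dist p h' :=
        (Connected.mk (nonempty := ⟨x⟩) hG).dist_triangle
      rw [dist_eq_one_iff_adj.2 hxp] at h4
      omega
  · obtain ⟨y, hy, he⟩ := hmem x
    rw [show sInf (G.dist x '' H) = 0 from h] at he
    rwa [(hG x y).dist_eq_zero_iff.1 he]
  · exact Nat.le_zero.1 (Nat.sInf_le ⟨x, h, by simp⟩)

end SimpleGraph

/-! ### Finite case: rerouting a longest cycle near its attachments -/

namespace SimpleGraph

variable {V : Type*} {G : SimpleGraph V} {M : Multiset V} {d : V → ℕ}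

/-- `M` is the vertex multiset of a longest cycle of `G`, and `d` is the distance to a component of
the graph without this cycle. -/
structure LongestCycleLevel (G : SimpleGraph V) (M : Multiset V) (d : V → ℕ) : Prop where
  level : G.IsLevel d
  off : ∀ x ∈ M, d x ≠ 0
  on : ∀ x, d x = 1 → x ∈ M
  nodup : M.Nodup
  three_le : 3 ≤ M.card
  cycle : ∃ a b, SpanPath G.Adj a b M ∧ G.Adj b a
  maximal : ∀ a b N, SpanPath G.Adj a b N → G.Adj b a → N.Nodup → 3 ≤ N.card → N.card ≤ M.card
  conn : ∀ x y, d x = 0 → d y = 0 → ∃ N, SpanPath G.Adj x y N ∧ N.Nodup ∧ ∀ z ∈ N, d z = 0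

namespace LongestCycleLevel

/-- Moves the opening of a cycle: a cycle opened at the edge `ea` is traversed from `b` back to `a`,
over to `e`, and back to `c`. -/
theorem lift_edge {a b c e : V} {N₁ N₂ : Multiset V} (h₁ : SpanPath G.Adj a b N₁)
    (h₂ : SpanPath G.Adj c e N₂) (h : G.Adj e a) : SpanPath G.Adj b c (N₁ + N₂) :=
  h₁.symm.append h.symm h₂.symm

variable (hO : LongestCycleLevel G M d)

include hO

/-- A path avoiding the component and joining two of its neighbours closes to a cycle. -/
theorem card_lt_of_path {v w : V} {N : Multiset V} (hv : d v = 1) (hw : d w = 1) (hvw : v ≠ w)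
    (h : SpanPath G.Adj v w N) (hN : N.Nodup) (hoff : ∀ x ∈ N, d x ≠ 0) : N.card < M.card := by
  obtain ⟨p, hp, hdp⟩ := hO.level.parent hv
  obtain ⟨q, hq, hdq⟩ := hO.level.parent hw
  obtain ⟨L, hL, hLn, hL0⟩ := hO.conn q p hdq hdp
  have h2 : 2 ≤ N.card := by
    rw [← not_lt]
    intro hlt
    obtain ⟨x, rfl⟩ := Multiset.card_eq_one.1
      (le_antisymm (by omega) (Multiset.card_pos_iff_exists_mem.2 ⟨v, h.left_mem⟩))
    exact hvw ((Multiset.mem_singleton.1 h.left_mem).trans (Multiset.mem_singleton.1 h.right_mem).symm)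
  have h1 : 1 ≤ L.card := Multiset.card_pos_iff_exists_mem.2 ⟨q, hL.left_mem⟩
  have := hO.maximal v p (N + L) (h.append hq hL) hp.symm
    (Multiset.nodup_add.2 ⟨hN, hLn, Multiset.disjoint_left.2 fun {a} ha ha' =>
      hoff a ha (hL0 a ha')⟩) (by rw [Multiset.card_add]; omega)
  rw [Multiset.card_add] at this
  omega

/-- The contradiction behind the reroutings: such a path closes through the component to a longer
cycle. -/
theorem not_spanPath {v w : V} (hv : d v = 1) (hw : d w = 1) (hvw : v ≠ w) :
    ¬ SpanPath G.Adj v w M := fun h =>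
  lt_irrefl _ (hO.card_lt_of_path hv hw hvw h hO.nodup hO.off)

theorem level_eq_two {v p : V} (hv : d v = 1) (hvp : G.Adj v p) (h : SpanPath G.Adj v p M) :
    d p = 2 := by
  have h0 := hO.off p h.right_mem
  have h1 : d p ≠ 1 := fun h1 => hO.not_spanPath hv h1 hvp.ne h
  have := hO.level.lip hvp.symm
  omega

/-- The usual target of a rerouting: `v`, then the path from `s` to `t`, then `u` would exhaust `M`.
-/
theorem not_spanPath_compl {v u s t : V} {N : Multiset V} (hv : d v = 1) (hu : d u = 1)
    (hvu : v ≠ u) (hvs : G.Adj v s) (hut : G.Adj u t) (hM : M = {u} + ({v} + N)) :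
    ¬ SpanPath G.Adj s t N := fun h => by
  refine hO.not_spanPath hv hu hvu ?_
  have := SpanPath.cons hvs (h.concat hut.symm)
  rw [hM]
  convert this using 1
  simp only [← Multiset.singleton_add]
  abel

theorem exists_rotation {u : V} (hu : u ∈ M) : ∃ z, SpanPath G.Adj u z M ∧ G.Adj z u := by
  obtain ⟨a, b, h, hba⟩ := hO.cycle
  rcases h.split hu with ⟨rfl, h⟩ | ⟨p, M₁, M₂, h₁, hp, h₂, hM⟩
  · exact ⟨b, h, hba⟩
  · exact ⟨p, by rw [hM, add_comm]; exact h₂.append hba h₁, hp⟩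

theorem exists_opening {u : V} (hu : d u = 1) : ∃ s t N, M = u ::ₘ N ∧ SpanPath G.Adj s t N ∧
    G.Adj u s ∧ d s = 2 ∧ G.Adj u t ∧ d t = 2 := by
  obtain ⟨z, h, hzu⟩ := hO.exists_rotation (hO.on u hu)
  rcases h.uncons with ⟨rfl, -⟩ | ⟨c, N, huc, hN, hM⟩
  · exact absurd hzu (G.irrefl)
  · refine ⟨c, z, N, hM, hN, huc, hO.level_eq_two hu huc ?_, hzu.symm,
      hO.level_eq_two hu hzu.symm h⟩
    rw [hM]
    exact (hN.concat hzu).symm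

variable (hclaw : G.IsInducedFree claw)

include hclaw

theorem adj_of_level_two {v x y : V} (hv : d v = 1) (hx : G.Adj v x) (hdx : d x = 2)
    (hy : G.Adj v y) (hdy : d y = 2) (hne : x ≠ y) : G.Adj x y :=
  hO.level.children_adj hclaw (by omega) hx hy (by omega) (by omega) hne

/-- A missed `y` is adjacent to the cycle neighbour `s` of `u`, both being children of `u`, and
could be inserted between `u` and `s`. -/
theorem mem_of_level_two {u y : V} (hu : d u = 1) (hy : G.Adj u y) (hdy : d y = 2) : y ∈ M := by
  by_contra hyM
  obtain ⟨s, t, N, hM, hN, hus, hds, hut, hdt⟩ := hO.exists_opening hu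
  have hys : y ≠ s := by rintro rfl; exact hyM (by simp [hM, hN.left_mem])
  have h := SpanPath.cons (hO.adj_of_level_two hclaw hu hy hdy hus hds hys) (hN.concat hut.symm)
  rw [← hM] at h
  have := hO.maximal _ _ _ h hy (Multiset.nodup_cons.2 ⟨hyM, hO.nodup⟩)
    (by rw [Multiset.card_cons]; have := hO.three_le; omega)
  rw [Multiset.card_cons] at this
  omega

/-- The edge `pq` bypasses `v`, which can then be attached elsewhere. Neither cycle neighbour of `v`
is an attachment, by `level_eq_two`. -/
theorem exists_passage {u v s t : V} {N : Multiset V} (hv : d v = 1) (hvu : v ≠ u)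
    (hM : M = u ::ₘ N) (h : SpanPath G.Adj s t N) (hus : G.Adj u s) (hds : d s = 2)
    (hut : G.Adj u t) (hdt : d t = 2) :
    ∃ p q N₁ N₂, SpanPath G.Adj s p N₁ ∧ SpanPath G.Adj q t N₂ ∧ N = N₁ + ({v} + N₂) ∧
      G.Adj v p ∧ d p = 2 ∧ G.Adj v q ∧ d q = 2 ∧ G.Adj p q := by
  have hvN : v ∈ N := by
    have := hO.on v hv
    rw [hM, Multiset.mem_cons] at this
    exact this.resolve_left hvu
  obtain ⟨p, q, N₁, N₂, h₁, hpv, hvq, h₂, rfl⟩ :=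
    h.split_interior hvN (by rintro rfl; omega) (by rintro rfl; omega)
  have hp : d p = 2 := by
    refine hO.level_eq_two hv hpv.symm ?_
    have := lift_edge (SpanPath.cons hus h₁) (SpanPath.cons hvq h₂) hut.symm
    rw [hM]
    convert this.symm using 1
    simp only [← Multiset.singleton_add]; abel
  have hq : d q = 2 := by
    refine hO.level_eq_two hv hvq ?_
    have := lift_edge (SpanPath.cons hus (h₁.concat hpv)) h₂ hut.symm
    rw [hM]
    convert this using 1
    simp only [← Multiset.singleton_add]; abel
  refine ⟨p, q, N₁, N₂, h₁, h₂, rfl, hpv.symm, hp, hvq, hq,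
    hO.adj_of_level_two hclaw hv hpv.symm hp hvq hq ?_⟩
  rintro rfl
  have hnd := hO.nodup
  rw [hM, Multiset.nodup_cons, Multiset.nodup_add] at hnd
  exact Multiset.disjoint_left.1 hnd.2.2.2 h₁.right_mem (by simp [h₂.left_mem])

/-- If `p` were an attachment, then `u y … t s … p` would run through all of `M`, using the chord
`uy` and the edge `ts` between children of `u`. -/
theorem level_ne_one_of_opening {u s t p y : V} {N₁ N₂ : Multiset V} (hu : d u = 1)
    (hM : M = u ::ₘ (N₁ + N₂)) (h₁ : SpanPath G.Adj s p N₁) (h₂ : SpanPath G.Adj y t N₂)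
    (hpy : G.Adj p y) (hus : G.Adj u s) (hds : d s = 2)
    (hut : G.Adj u t) (hdt : d t = 2) (huy : G.Adj u y) : d p ≠ 1 := by
  intro hp
  have hnd := hO.nodup
  rw [hM, Multiset.nodup_cons, Multiset.nodup_add] at hnd
  have hup : u ≠ p := by
    rintro rfl; exact hnd.1 (by simp [h₁.right_mem])
  rcases h₁.symm.uncons with ⟨rfl, -⟩ | ⟨p', N₃, hpp', h₃, rfl⟩
  · omega
  · have hst : s ≠ t := by
      rintro rfl
      exact Multiset.disjoint_left.1 hnd.2.2.2 h₁.left_mem h₂.right_mem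
    have hts := hO.adj_of_level_two hclaw hu hut hdt hus hds hst.symm
    refine hO.not_spanPath_compl hu hp hup huy hpp' ?_ (h₂.append hts h₃.symm)
    rw [hM]
    simp only [← Multiset.singleton_add]; abel

/-- The cycle can be rerouted so that a given level two neighbour `y` of `u` comes next to `u`. -/
theorem exists_opening_at {u y : V} (hu : d u = 1) (huy : G.Adj u y) (hdy : d y = 2) :
    ∃ t N, M = u ::ₘ N ∧ SpanPath G.Adj y t N ∧ G.Adj u t ∧ d t = 2 := by
  obtain ⟨s, t, N, hM, hN, hus, hds, hut, hdt⟩ := hO.exists_opening hu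
  have hyM := hO.mem_of_level_two hclaw hu huy hdy
  have hyN : y ∈ N := by
    rw [hM, Multiset.mem_cons] at hyM
    exact hyM.resolve_left huy.ne'
  by_cases hys : y = s
  · subst hys; exact ⟨t, N, hM, hN, hut, hdt⟩
  by_cases hyt : y = t
  · subst hyt; exact ⟨s, N, hM, hN.symm, hus, hds⟩
  obtain ⟨p, q, N₁, N₂, h₁, hpy, hyq, h₂, rfl⟩ := hN.split_interior hyN hys hyt
  have hnd := hO.nodup
  rw [hM, Multiset.nodup_cons, Multiset.nodup_add] at hnd
  have hst : s ≠ t := by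
    rintro rfl
    exact Multiset.disjoint_left.1 hnd.2.2.2 h₁.left_mem (by simp [h₂.right_mem])
  have hpq : p ≠ q := by
    rintro rfl
    exact Multiset.disjoint_left.1 hnd.2.2.2 h₁.right_mem (by simp [h₂.left_mem])
  have hst' := hO.adj_of_level_two hclaw hu hus hds hut hdt hst
  have hp1 : d p ≠ 1 := hO.level_ne_one_of_opening hclaw hu hM h₁ (SpanPath.cons hyq h₂) hpy
    hus hds hut hdt huy
  have hq1 : d q ≠ 1 := by
    refine hO.level_ne_one_of_opening hclaw hu (N₁ := N₂) (N₂ := y ::ₘ N₁) ?_ h₂.symm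
      (h₁.concat hpy).symm hyq.symm hut hdt hus hds huy
    rw [hM]
    simp only [← Multiset.singleton_add]; abel
  have hpM : p ∈ M := by simp [hM, h₁.right_mem]
  have hqM : q ∈ M := by simp [hM, h₂.left_mem]
  by_cases hp : G.Adj u p
  · have := hO.level.lip hp.symm
    have := hO.off p hpM
    refine ⟨p, _, hM, ?_, hp, by omega⟩
    convert (SpanPath.cons hyq h₂).append hst'.symm h₁ using 1
    simp only [← Multiset.singleton_add]; abel
  by_cases hq : G.Adj u q
  · have := hO.level.lip hq.symm
    have := hO.off q hqM
    refine ⟨q, _, hM, ?_, hq, by omega⟩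
    convert (SpanPath.cons hpy.symm h₁.symm).append hst' h₂.symm using 1
    simp only [← Multiset.singleton_add]; abel
  · have hup : u ≠ p := by
      rintro rfl; exact hnd.1 (by simp [h₁.right_mem])
    have huq : u ≠ q := by
      rintro rfl; exact hnd.1 (by simp [h₂.left_mem])
    -- The only surviving case is the edge `pq`: close the gap at `y` with it and reinsert `y`
    -- between `u` and `s`.
    rcases claw_free_adj hclaw huy.symm hpy.symm hyq hup huq hpq with h | h | h
    · exact absurd h hp
    · exact absurd h hq
    · refine ⟨t, _, hM, ?_, hut, hdt⟩
      convert SpanPath.cons (hO.adj_of_level_two hclaw hu huy hdy hus hds hys)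
        (h₁.append h h₂) using 1
      simp only [← Multiset.singleton_add]; abel

/-- Put `y` next to `u` on the cycle and bypass `v`. Then `v y … t u` spans `M` and joins two
attachments. -/
theorem eq_of_common_child {v u y : V} (hv : d v = 1) (hu : d u = 1) (hvy : G.Adj v y)
    (huy : G.Adj u y) (hdy : d y = 2) : v = u := by
  by_contra hvu
  obtain ⟨t, N, hM, hN, hut, hdt⟩ := hO.exists_opening_at hclaw hu huy hdy
  obtain ⟨p, q, N₁, N₂, h₁, h₂, rfl, -, -, -, -, hpq⟩ :=
    hO.exists_passage hclaw hv hvu hM hN huy hdy hut hdt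
  refine hO.not_spanPath_compl hv hu hvu hvy hut ?_ (h₁.append hpq h₂)
  rw [hM]
  simp only [← Multiset.singleton_add]; abel

/-- Bypass both `v` and `w` on the path from `g` to `y` and put them at its ends: `w g … y v` spans
`M`. The two cases are the two orders of `v` and `w`. -/
theorem not_cycle_edge {v w g y : V} (hv : d v = 1) (hw : d w = 1) (hvw : v ≠ w)
    (hvy : G.Adj v y) (hdy : d y = 2) (hwg : G.Adj w g) (hdg : d g = 2) (hgy : G.Adj g y) :
    ¬ SpanPath G.Adj g y M := by
  intro h
  obtain ⟨a, z, N₁, N₂, h₁, hav, hvz, h₂, hM⟩ :=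
    h.split_interior (hO.on v hv) (by rintro rfl; omega) (by rintro rfl; omega)
  have hnd := hO.nodup
  rw [hM, Multiset.nodup_add, Multiset.nodup_add] at hnd
  have ha : d a = 2 := by
    refine hO.level_eq_two hv hav.symm ?_
    have := lift_edge h₁ (SpanPath.cons hvz h₂) hgy.symm
    rw [hM]
    convert this.symm using 1
    simp only [← Multiset.singleton_add]
  have hz : d z = 2 := by
    refine hO.level_eq_two hv hvz ?_
    have := lift_edge (h₁.concat hav) h₂ hgy.symm
    rw [hM]
    convert this using 1
    simp only [← Multiset.singleton_add]; abel
  have haz : G.Adj a z := by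
    refine hO.adj_of_level_two hclaw hv hav.symm ha hvz hz ?_
    rintro rfl
    exact Multiset.disjoint_left.1 hnd.2.2 h₁.right_mem (by simp [h₂.left_mem])
  have hwM : w ∈ N₁ ∨ w ∈ N₂ := by
    have := hO.on w hw
    rw [hM] at this
    simpa [hvw.symm] using this
  rcases hwM with hwN | hwN
  · obtain ⟨p, q, L₁, L₂, k₁, hpw, hwq, k₂, rfl⟩ :=
      h₁.split_interior hwN (by rintro rfl; omega) (by rintro rfl; omega)
    have hp : d p = 2 := by
      refine hO.level_eq_two hw hpw.symm ?_
      have := lift_edge k₁ ((SpanPath.cons hwq k₂).append hav (SpanPath.cons hvz h₂)) hgy.symm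
      rw [hM]
      convert this.symm using 1
      simp only [← Multiset.singleton_add]; abel
    have hq : d q = 2 := by
      refine hO.level_eq_two hw hwq ?_
      have := lift_edge (k₁.concat hpw) (k₂.append hav (SpanPath.cons hvz h₂)) hgy.symm
      rw [hM]
      convert this using 1
      simp only [← Multiset.singleton_add]; abel
    have hpq : G.Adj p q := by
      refine hO.adj_of_level_two hclaw hw hpw.symm hp hwq hq ?_
      rintro rfl
      exact Multiset.disjoint_left.1 (Multiset.nodup_add.1 hnd.1).2.2 k₁.right_mem
        (by simp [k₂.left_mem])
    refine hO.not_spanPath_compl hw hv hvw.symm hwg hvy ?_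
      ((k₁.append hpq k₂).append haz h₂)
    rw [hM]
    abel
  · obtain ⟨p, q, L₁, L₂, k₁, hpw, hwq, k₂, rfl⟩ :=
      h₂.split_interior hwN (by rintro rfl; omega) (by rintro rfl; omega)
    have hp : d p = 2 := by
      refine hO.level_eq_two hw hpw.symm ?_
      have := lift_edge (h₁.append hav (SpanPath.cons hvz k₁)) (SpanPath.cons hwq k₂) hgy.symm
      rw [hM]
      convert this.symm using 1
      simp only [← Multiset.singleton_add]; abel
    have hq : d q = 2 := by
      refine hO.level_eq_two hw hwq ?_
      have := lift_edge (h₁.append hav (SpanPath.cons hvz (k₁.concat hpw))) k₂ hgy.symm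
      rw [hM]
      convert this using 1
      simp only [← Multiset.singleton_add]; abel
    have hpq : G.Adj p q := by
      refine hO.adj_of_level_two hclaw hw hpw.symm hp hwq hq ?_
      rintro rfl
      exact Multiset.disjoint_left.1 (Multiset.nodup_add.1 hnd.2.1.2.1).2.2 k₁.right_mem
        (by simp [k₂.left_mem])
    refine hO.not_spanPath_compl hw hv hvw.symm hwg hvy ?_
      (h₁.append haz (k₁.append hpq k₂))
    rw [hM]
    abel

theorem not_adj_of_cycle_edge {v g y : V} (hv : d v = 1) (hvy : G.Adj v y) (hdy : d y = 2)
    (hgy : G.Adj g y) (h : SpanPath G.Adj g y M) (hgv : g ≠ v)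
    (hg : ¬ (G.Adj v g ∧ d g = 2)) : ¬ G.Adj v g ∧ d g ≠ 1 := by
  have h1 : d g ≠ 1 := fun h1 =>
    hgv (hO.eq_of_common_child hclaw h1 hv hgy hvy hdy)
  refine ⟨fun hvg => hg ⟨hvg, ?_⟩, h1⟩
  have := hO.off g h.left_mem
  have := hO.level.lip hvg.symm
  omega

variable (hbull : G.BullHornsHaveCommonNeighbor)

include hbull

/-- Otherwise the triangle `r v y` is part of a bull whose horns are `g` and a neighbour of `v` in
the component. A common neighbour of the horns would be a second attachment adjacent to `g`, against
`not_cycle_edge`. -/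
theorem adj_of_cycle_edge {v g y r : V} (hv : d v = 1) (hvy : G.Adj v y) (hdy : d y = 2)
    (hgy : G.Adj g y) (h : SpanPath G.Adj g y M) (hgv : g ≠ v)
    (hg : ¬ (G.Adj v g ∧ d g = 2)) (hvr : G.Adj v r) (hdr : d r = 2) (hry : r ≠ y) :
    G.Adj r g := by
  by_contra hrg
  obtain ⟨hvg, hg1⟩ := hO.not_adj_of_cycle_edge hclaw hv hvy hdy hgy h hgv hg
  have hg0 := hO.off g h.left_mem
  obtain ⟨x, hvx, hdx⟩ := hO.level.parent hv
  obtain ⟨w, hxw, hgw⟩ := bull_common_neighbor hbull (z := r) (a₁ := v) (a₂ := y) (b₁ := x)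
    (b₂ := g) hvr.symm (hO.adj_of_level_two hclaw hv hvr hdr hvy hdy hry) hvy hvx hgy.symm
    (fun h => hO.level.not_adj (by omega) h.symm) hrg hvg
    (fun h => hO.level.not_adj (by omega) h.symm) (hO.level.not_adj (by omega))
  have l1 := hO.level.lip hxw.symm
  have l2 := hO.level.lip hgw
  have hw : d w = 1 := by omega
  have hg2 : d g = 2 := by omega
  refine hO.not_cycle_edge hclaw hv hw ?_ hvy hdy hgw.symm hg2 hgy h
  rintro rfl
  exact hvg hgw.symm

/-- If `g` is a child of `v`, then `v g … y₂ y₁ r … t u` spans `M`. If not, `adj_of_cycle_edge`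
gives the edge `rg`, and `v y₁ y₂ … g r … t u` does. -/
theorem false_of_reverse_order {v u y₁ y₂ g r t : V} {X Y : Multiset V} (hv : d v = 1)
    (hu : d u = 1) (hvu : v ≠ u) (hvy : G.Adj v y₁) (hdy : d y₁ = 2) (hyy : G.Adj y₁ y₂)
    (h₁ : SpanPath G.Adj y₂ g X) (hgy : G.Adj g y₁) (h₂ : SpanPath G.Adj r t Y)
    (hvr : G.Adj v r) (hdr : d r = 2) (hut : G.Adj u t)
    (hM : M = {u} + ({v} + (X + ({y₁} + Y)))) (hgM : SpanPath G.Adj g y₁ M) : False := by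
  have hnd := hO.nodup
  simp only [hM, Multiset.nodup_add, Multiset.disjoint_left, Multiset.mem_singleton,
    Multiset.mem_add] at hnd
  have hry : r ≠ y₁ := by
    rintro rfl
    exact hnd.2.1.2.1.2.1.2.2 rfl h₂.left_mem
  have hgv : g ≠ v := by
    rintro rfl
    exact hnd.2.1.2.2 rfl (.inl h₁.right_mem)
  by_cases hg : G.Adj v g ∧ d g = 2
  · refine hO.not_spanPath_compl hv hu hvu hg.1 hut ?_ ((h₁.symm.append hyy.symm
      (SpanPath.cons (hO.adj_of_level_two hclaw hv hvy hdy hvr hdr hry.symm) h₂)))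
    rw [hM, Multiset.singleton_add y₁]
  · have hrg := hO.adj_of_cycle_edge hclaw hbull hv hvy hdy hgy hgM hgv hg hvr hdr hry
    refine hO.not_spanPath_compl hv hu hvu hvy hut ?_
      (SpanPath.cons hyy (h₁.append hrg.symm h₂))
    rw [hM]
    simp only [← Multiset.singleton_add]; abel

/-- With `y₂` next to `u`, the cycle reads `u y₂ … a v z … t`. The cases are the place of `y₁`
before or after `v`, and which cycle neighbours of `y₁` are children of `v`; each yields a spanning
path from `v` to `u`. -/
theorem not_adj_of_ne {v u y₁ y₂ : V} (hv : d v = 1) (hu : d u = 1) (hvu : v ≠ u)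
    (hvy : G.Adj v y₁) (hdy : d y₁ = 2) (huy : G.Adj u y₂) (hdy₂ : d y₂ = 2) :
    ¬ G.Adj y₁ y₂ := by
  intro hyy
  obtain ⟨t, N, hM, hN, hut, hdt⟩ := hO.exists_opening_at hclaw hu huy hdy₂
  obtain ⟨a, z, N₁, N₂, h₁, h₂, rfl, hva, hda, hvz, hdz, haz⟩ :=
    hO.exists_passage hclaw hv hvu hM hN huy hdy₂ hut hdt
  have hnd := hO.nodup
  simp only [hM, ← Multiset.singleton_add, Multiset.nodup_add, Multiset.disjoint_left,
    Multiset.mem_singleton, Multiset.mem_add] at hnd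
  have hvN₁ : v ∉ N₁ := fun h => hnd.2.1.2.2 h (.inl rfl)
  have hvN₂ : v ∉ N₂ := fun h => hnd.2.1.2.1.2.2 rfl h
  have hyt : y₁ ≠ t := by
    rintro rfl; exact hvu (hO.eq_of_common_child hclaw hv hu hvy hut hdy)
  have hyM : y₁ ∈ N₁ ∨ y₁ ∈ N₂ := by
    have := hO.mem_of_level_two hclaw hv hvy hdy
    rw [hM] at this
    have hyu : y₁ ≠ u := by rintro rfl; omega
    simpa [hvy.ne', hyu] using this
  -- The spanning path is `v r … y₂ y₁ … t u`.
  have form1 : ∀ r X Y, SpanPath G.Adj y₂ r X → SpanPath G.Adj y₁ t Y → G.Adj v r →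
      N₁ + N₂ = X + Y → False := by
    intro r X Y hX hY hvr he
    refine hO.not_spanPath_compl hv hu hvu hvr hut ?_ (hX.symm.append hyy.symm hY)
    rw [hM, ← he]
    simp only [← Multiset.singleton_add]; abel
  rcases hyM with hyN | hyN
  · by_cases hya : y₁ = a
    · subst hya
      rcases h₁.symm.uncons with ⟨rfl, -⟩ | ⟨g, X, hyg, hX, rfl⟩
      · exact hyy.ne rfl
      · refine hO.false_of_reverse_order hclaw hbull hv hu hvu hvy hdy hyy hX.symm hyg.symm h₂
          hvz hdz hut ?_ ?_
        · rw [hM]; simp only [← Multiset.singleton_add]; abel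
        · rw [hM]
          convert lift_edge (SpanPath.cons huy hX.symm)
            (SpanPath.cons hvy.symm (SpanPath.cons hvz h₂)) hut.symm using 1
          simp only [← Multiset.singleton_add]; abel
    · obtain ⟨g, g', X, Y, hX, hgy, hyg', hY, rfl⟩ := h₁.split_interior hyN hyy.ne hya
      have hgg : g ≠ g' := by
        rintro rfl
        exact Multiset.disjoint_left.1 (Multiset.nodup_add.1 hnd.2.1.1).2.2 hX.right_mem
          (by simp [hY.left_mem])
      have hgM : SpanPath G.Adj g y₁ M := by
        rw [hM]
        convert lift_edge (SpanPath.cons huy hX)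
          (SpanPath.cons hyg' (hY.append hva.symm (SpanPath.cons hvz h₂))) hut.symm using 1
        simp only [← Multiset.singleton_add]; abel
      have hg'M : SpanPath G.Adj g' y₁ M := by
        rw [hM]
        convert (lift_edge (SpanPath.cons huy (hX.concat hgy))
          (hY.append hva.symm (SpanPath.cons hvz h₂)) hut.symm).symm using 1
        simp only [← Multiset.singleton_add]; abel
      have hgv : g ≠ v := by rintro rfl; exact hvN₁ (by simp [hX.right_mem])
      have hg'v : g' ≠ v := by rintro rfl; exact hvN₁ (by simp [hY.left_mem])
      by_cases hg : G.Adj v g ∧ d g = 2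
      · refine form1 g X _ hX (SpanPath.cons hyg' (hY.append haz h₂)) hg.1 ?_
        simp only [← Multiset.singleton_add]; abel
      by_cases hg' : G.Adj v g' ∧ d g' = 2
      · refine hO.false_of_reverse_order hclaw hbull hv hu hvu hvy hdy hyy hX hgy
          (hY.append haz h₂) hg'.1 hg'.2 hut ?_ hgM
        rw [hM]; simp only [← Multiset.singleton_add]; abel
      have e1 := (hO.not_adj_of_cycle_edge hclaw hv hvy hdy hgy hgM hgv hg).1
      have e2 := (hO.not_adj_of_cycle_edge hclaw hv hvy hdy hyg'.symm hg'M hg'v hg').1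
      -- Since `v` sees neither `g` nor `g'`, the claw at `y₁` is avoided only by `gg'`; so `y₁` can
      -- be taken out and placed before `z`.
      have e3 : G.Adj g g' := by
        rcases claw_free_adj hclaw hvy.symm hgy.symm hyg' hgv.symm hg'v.symm hgg with h | h | h
        · exact absurd h e1
        · exact absurd h e2
        · exact h
      have hyz : y₁ ≠ z := by
        rintro rfl
        exact hnd.2.1.2.2 hyN (.inr h₂.left_mem)
      refine form1 a _ _ (hX.append e3 hY) (SpanPath.cons
        (hO.adj_of_level_two hclaw hv hvy hdy hvz hdz hyz) h₂) hva ?_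
      simp only [← Multiset.singleton_add]; abel
  · by_cases hyz : y₁ = z
    · subst hyz
      exact form1 a _ _ h₁ h₂ hva rfl
    · obtain ⟨g, g', X, Y, hX, hgy, hyg', hY, rfl⟩ := h₂.split_interior hyN hyz hyt
      have hgg : g ≠ g' := by
        rintro rfl
        exact Multiset.disjoint_left.1 (Multiset.nodup_add.1 hnd.2.1.2.1.2.1).2.2 hX.right_mem
          (by simp [hY.left_mem])
      have hgM : SpanPath G.Adj g y₁ M := by
        rw [hM]
        convert lift_edge (SpanPath.cons huy (h₁.append hva.symm (SpanPath.cons hvz hX)))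
          (SpanPath.cons hyg' hY) hut.symm using 1
        simp only [← Multiset.singleton_add]; abel
      have hg'M : SpanPath G.Adj g' y₁ M := by
        rw [hM]
        convert (lift_edge (SpanPath.cons huy (h₁.append hva.symm
          (SpanPath.cons hvz (hX.concat hgy)))) hY hut.symm).symm using 1
        simp only [← Multiset.singleton_add]; abel
      have hgv : g ≠ v := by rintro rfl; exact hvN₂ (by simp [hX.right_mem])
      have hg'v : g' ≠ v := by rintro rfl; exact hvN₂ (by simp [hY.left_mem])
      by_cases hg : G.Adj v g ∧ d g = 2
      · refine form1 g _ _ (h₁.append haz hX) (SpanPath.cons hyg' hY) hg.1 ?_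
        simp only [← Multiset.singleton_add]; abel
      by_cases hg' : G.Adj v g' ∧ d g' = 2
      · refine hO.false_of_reverse_order hclaw hbull hv hu hvu hvy hdy hyy (h₁.append haz hX) hgy
          hY hg'.1 hg'.2 hut ?_ hgM
        rw [hM]; simp only [← Multiset.singleton_add]; abel
      have e1 := (hO.not_adj_of_cycle_edge hclaw hv hvy hdy hgy hgM hgv hg).1
      have e2 := (hO.not_adj_of_cycle_edge hclaw hv hvy hdy hyg'.symm hg'M hg'v hg').1
      have e3 : G.Adj g g' := by
        rcases claw_free_adj hclaw hvy.symm hgy.symm hyg' hgv.symm hg'v.symm hgg with h | h | h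
        · exact absurd h e1
        · exact absurd h e2
        · exact h
      refine form1 a _ _ h₁ (SpanPath.cons
        (hO.adj_of_level_two hclaw hv hvy hdy hvz hdz hyz) (hX.append e3 hY)) hva ?_
      simp only [← Multiset.singleton_add]; abel

end LongestCycleLevel

end SimpleGraph

/-! ### Finite case: branches, insertion of missed vertices, and Ryjáček's theorem -/

namespace SimpleGraph

variable {V : Type*} {G : SimpleGraph V} {M : Multiset V} {d : V → ℕ}

/-- If the children of different level one vertices neither coincide nor are adjacent, then every
vertex `p` with a child lies in a set `Z` which meets level one in one vertex and can essentially
only be left towards the children of `p`. -/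
theorem IsLevel.exists_branch (hd : G.IsLevel d) (hclaw : G.IsInducedFree claw)
    (hbull : G.BullHornsHaveCommonNeighbor)
    (hsep : ∀ v u y z, d v = 1 → d u = 1 → d y = 2 → d z = 2 → G.Adj v y → G.Adj u z →
      (y = z ∨ G.Adj y z) → v = u) (j : ℕ) :
    ∀ p c, d p = j + 1 → G.Adj p c → d c = d p + 1 → ∃ (Z : Set V) (w : V), d w = 1 ∧ w ∈ Z ∧
      p ∈ Z ∧ (∀ x ∈ Z, d x = 1 → x = w) ∧ ∀ s ∈ Z, ∀ t, t ∉ Z → G.Adj s t → d t ≠ 0 →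
        ¬ (d s = 1 ∧ d t = 1) → d t = d p + 1 ∧ G.Adj p t ∧ d s = d p ∧ (s = p ∨ G.Adj s p) := by
  induction j with
  | zero =>
    intro p c hp hc hdc
    refine ⟨{p}, p, by omega, rfl, rfl, fun x hx _ => hx, ?_⟩
    rintro s rfl t - hst ht0 ht1
    have := hd.lip hst.symm
    exact ⟨by omega, hst, rfl, .inl rfl⟩
  | succ j ih =>
    intro p c hp hc hdc
    obtain ⟨q, hq, hdq⟩ := hd.parent hp
    obtain ⟨Z, w, hw, hwZ, hqZ, hZ1, hZ⟩ := ih q p hdq hq.symm (by omega)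
    -- The branch of a parent `q` grows by `p` and its neighbours on the level of `p`; the old exit
    -- led only to children of `q`, which are pairwise adjacent and hence absorbed.
    refine ⟨Z ∪ {x | d x = d p ∧ (x = p ∨ G.Adj x p)}, w, hw, .inl hwZ, .inr ⟨rfl, .inl rfl⟩,
      ?_, ?_⟩
    · rintro x (hx | ⟨hx, -⟩) hx1
      · exact hZ1 x hx hx1
      · omega
    · rintro s hs t ht hst ht0 ht1
      have htZ : t ∉ Z := fun h => ht (.inl h)
      have htp : d t = d p → t ≠ p ∧ ¬ G.Adj t p := fun h =>
        ⟨fun h' => ht (.inr ⟨h, .inl h'⟩), fun h' => ht (.inr ⟨h, .inr h'⟩)⟩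
      rcases hs with hs | ⟨hds, hs⟩
      · obtain ⟨h1, h2, -⟩ := hZ s hs t htZ hst ht0 ht1
        have h3 := htp (by omega)
        exact absurd (hd.children_adj hclaw (by omega) h2 hq.symm (by omega) (by omega) h3.1) h3.2
      · have hsc : G.Adj s c := by
          rcases hs with rfl | hs
          · exact hc
          · exact hd.child_of_adj hclaw hbull hs.symm hds (by omega) hc hdc
        have l1 := hd.lip hst
        have l2 := hd.lip hst.symm
        obtain h | h | h : d t = d p + 1 ∨ d t = d p ∨ d t + 1 = d p := by omega
        · refine ⟨h, ?_, hds, hs⟩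
          rcases hs with rfl | hs
          · exact hst
          · exact hd.child_of_adj hclaw hbull hs hds.symm (by omega) hst (by omega)
        · exfalso
          obtain ⟨h1, h2⟩ := htp h
          rcases hs with rfl | hs
          · exact h2 hst.symm
          -- On level two `adj_trans` is not available; there `hsep` identifies the parents of `p`,
          -- `s` and `t`.
          · by_cases h3 : 3 ≤ d p
            · exact h2 (hd.adj_trans hclaw hbull (by omega) hsc (by omega) hst (by omega) hs
                (by omega) h1)
            · obtain ⟨r, hr, hdr⟩ := hd.parent (x := s) (k := 1) (by omega)
              obtain ⟨r', hr', hdr'⟩ := hd.parent (x := t) (k := 1) (by omega)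
              have e1 := hsep q r p s (by omega) hdr (by omega) (by omega) hq.symm hr.symm
                (.inr hs.symm)
              have e2 := hsep r r' s t hdr hdr' (by omega) (by omega) hr.symm hr'.symm (.inr hst)
              subst e2 e1
              exact h2 (hd.children_adj hclaw (by omega) hr'.symm hq.symm (by omega) (by omega) h1)
        · exfalso
          by_cases h3 : 3 ≤ d p
          · have hqs : G.Adj q s := by
              rcases hs with rfl | hs
              · exact hq.symm
              · exact hd.parent_of_adj hclaw hbull hs.symm hds h3 hc hdc hq (by omega) hst
                  (by omega)
            have hne : q ≠ t := fun h => htZ (h ▸ hqZ)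
            have hqt := hd.parents_adj hclaw hsc (by omega) hqs.symm (by omega) hst (by omega) hne
            have := hZ q hqZ t htZ hqt ht0 (by omega)
            omega
          · have := hsep q t p s (by omega) (by omega) (by omega) (by omega) hq.symm hst.symm
              (hs.elim (fun h => .inl h.symm) fun h => .inr h.symm)
            exact htZ (this ▸ hqZ)

namespace LongestCycleLevel

/-- Let `y` be missed and `p` a parent of `y`. The path contains the one attachment in the branch of
`p` and another outside it, so some step `st` crosses the exit. Then `y` is adjacent to both `s` and
`t` and can be inserted. The number `k` bounds how many vertices are still missed; a path missing
nothing outside the component is at least as long as `M`, against `card_lt_of_path`. -/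
theorem false_of_separated [Finite V] (hO : LongestCycleLevel G M d) (hclaw : G.IsInducedFree claw)
    (hbull : G.BullHornsHaveCommonNeighbor)
    (hsep : ∀ v u y z, d v = 1 → d u = 1 → d y = 2 → d z = 2 → G.Adj v y → G.Adj u z →
      (y = z ∨ G.Adj y z) → v = u) {v u : V} (hv : d v = 1) (hu : d u = 1) (hvu : v ≠ u) (k : ℕ) :
    ∀ N, SpanPath (fun x y => G.Adj x y ∧ ¬ (d x = 1 ∧ d y = 1)) v u N → N.Nodup →
      (∀ x, d x = 1 → x ∈ N) → (∀ x ∈ N, d x ≠ 0) → Nat.card V ≤ k + N.card → False := by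
  have hsymm : ∀ x y, G.Adj x y ∧ ¬ (d x = 1 ∧ d y = 1) → G.Adj y x ∧ ¬ (d y = 1 ∧ d x = 1) :=
    fun x y h => ⟨h.1.symm, fun h' => h.2 h'.symm⟩
  have := Fintype.ofFinite V
  have hdone : ∀ N, SpanPath (fun x y => G.Adj x y ∧ ¬ (d x = 1 ∧ d y = 1)) v u N → N.Nodup →
      (∀ x ∈ N, d x ≠ 0) → (∀ y, d y ≠ 0 → y ∈ N) → False := by
    intro N hN hnd hN0 hall
    refine absurd (hO.card_lt_of_path hv hu hvu (hN.mono fun _ _ h => h.1) hnd hN0) (not_lt.2 ?_)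
    exact Multiset.card_le_card ((Multiset.le_iff_subset hO.nodup).2 fun x hx =>
      hall x (hO.off x hx))
  induction k with
  | zero =>
    intro N hN hnd hN1 hN0 hcard
    refine hdone N hN hnd hN0 fun y _ => ?_
    classical
    have h1 : N.toFinset = Finset.univ := by
      rw [← Finset.card_eq_iff_eq_univ, Multiset.toFinset_card_of_nodup hnd]
      refine le_antisymm ?_ (by simpa using hcard)
      rw [← Multiset.toFinset_card_of_nodup hnd]
      exact Finset.card_le_univ _
    rw [← Multiset.mem_toFinset, h1]
    exact Finset.mem_univ y
  | succ k ih =>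
    intro N hN hnd hN1 hN0 hcard
    refine hdone N hN hnd hN0 fun y hy0 => ?_
    by_contra hyN
    have hy1 : d y ≠ 1 := fun h => hyN (hN1 y h)
    obtain ⟨p, hyp, hdp⟩ := hO.level.parent (x := y) (k := d y - 2 + 1) (by omega)
    obtain ⟨Z, w, hw, hwZ, hpZ, hZ1, hZ⟩ := hO.level.exists_branch hclaw hbull hsep (d y - 2) p y
      hdp hyp.symm (by omega)
    obtain ⟨e, heN, heZ⟩ : ∃ e ∈ N, e ∉ Z := by
      by_cases hvZ : v ∈ Z
      · exact ⟨u, hN.right_mem, fun huZ => hvu ((hZ1 v hvZ hv).trans (hZ1 u huZ hu).symm)⟩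
      · exact ⟨v, hN.left_mem, hvZ⟩
    obtain ⟨s, t, N₁, N₂, h₁, hst, hcross, h₂, rfl⟩ :=
      hN.exists_crossing (P := (· ∈ Z)) (hN1 w hw) heN hwZ heZ
    have key : ∀ s t, s ∈ Z → t ∉ Z → t ∈ N₁ + N₂ → G.Adj s t → ¬ (d s = 1 ∧ d t = 1) →
        G.Adj y s ∧ G.Adj y t := by
      intro s t hs ht htN hst hst1
      obtain ⟨h1, h2, h3, h4⟩ := hZ s hs t ht hst (hN0 t htN) hst1
      refine ⟨?_, hO.level.children_adj hclaw (by omega) hyp.symm h2 (by omega) (by omega) ?_⟩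
      · rcases h4 with rfl | h4
        · exact hyp
        · by_cases hp2 : 2 ≤ d p
          · exact (hO.level.child_of_adj hclaw hbull h4.symm h3 hp2 hyp.symm (by omega)).symm
          · have e1 := hZ1 s hs (by omega)
            have e2 := hZ1 p hpZ (by omega)
            exact absurd (e1.trans e2.symm) h4.ne
      · rintro rfl; exact hyN htN
    have hys : G.Adj y s ∧ G.Adj y t := by
      by_cases hs : s ∈ Z
      · exact key s t hs (fun ht => hcross (by simp [hs, ht])) (by simp [h₂.left_mem]) hst.1 hst.2
      · have ht : t ∈ Z := by
          by_contra ht; exact hcross (by simp [hs, ht])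
        exact (key t s ht hs (by simp [h₁.right_mem]) hst.1.symm (hsymm _ _ hst).2).symm
    refine ih (N₁ + (y ::ₘ N₂)) (h₁.append ⟨hys.1.symm, fun h => hy1 h.2⟩
      (.cons ⟨hys.2, fun h => hy1 h.1⟩ h₂)) ?_ ?_ ?_ ?_
    · rw [Multiset.add_cons, Multiset.nodup_cons]
      exact ⟨hyN, hnd⟩
    · intro x hx
      have := hN1 x hx
      rw [Multiset.add_cons]
      exact Multiset.mem_cons_of_mem this
    · intro x hx
      rw [Multiset.add_cons, Multiset.mem_cons] at hx
      rcases hx with rfl | hx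
      · exact hy0
      · exact hN0 x hx
    · rw [Multiset.add_cons, Multiset.card_cons]
      omega

/-- Opening the cycle at an edge between attachments contradicts `not_spanPath`. Without such an
edge, open the cycle at `v` and cut it after its last attachment; this gives the initial path for
`false_of_separated`. -/
theorem absurd_of_two [Finite V] (hO : LongestCycleLevel G M d) (hclaw : G.IsInducedFree claw)
    (hbull : G.BullHornsHaveCommonNeighbor) {v v' : V} (hv : d v = 1) (hv' : d v' = 1)
    (hvv : v ≠ v') : False := by
  have hsep : ∀ v u y z, d v = 1 → d u = 1 → d y = 2 → d z = 2 → G.Adj v y → G.Adj u z →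
      (y = z ∨ G.Adj y z) → v = u := by
    intro v u y z hv hu hy hz hvy huz hyz
    by_contra hvu
    rcases hyz with rfl | hyz
    · exact hvu (hO.eq_of_common_child hclaw hv hu hvy huz hy)
    · exact hO.not_adj_of_ne hclaw hbull hv hu hvu hvy hy huz hz hyz
  obtain ⟨z, hz, hzv⟩ := hO.exists_rotation (hO.on v hv)
  rcases hz.forall_or_split (fun x y => ¬ (d x = 1 ∧ d y = 1)) with h |
    ⟨p, q, M₁, M₂, h₁, hpq, hn, h₂, hM⟩
  · obtain ⟨u, M₁, M₂, h₁, hu, hM, h₂⟩ := h.exists_last (P := fun x => d x = 1) hv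
    have h1 : ∀ x, d x = 1 → x ∈ M₁ := fun x hx => by
      have := hO.on x hx
      rw [hM, Multiset.mem_add] at this
      exact this.resolve_right fun h => h₂ x h hx
    have hnd := hO.nodup
    rw [hM, Multiset.nodup_add] at hnd
    have hvu : v ≠ u := by
      rintro rfl
      rcases h₁.uncons with ⟨-, rfl⟩ | ⟨c, M', -, h', rfl⟩
      · exact hvv (Multiset.mem_singleton.1 (h1 v' hv')).symm
      · exact (Multiset.nodup_cons.1 hnd.1).1 h'.right_mem
    exact hO.false_of_separated hclaw hbull hsep hv hu hvu (Nat.card V) M₁ h₁ hnd.1 h1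
      (fun x hx => hO.off x (by simp [hM, hx])) (Nat.le_add_right _ _)
  · rw [not_not] at hn
    refine hO.not_spanPath hn.1 hn.2 hpq.ne ?_
    rw [hM]
    exact lift_edge h₁ h₂ hzv

end LongestCycleLevel

theorem IsVertexConnected.preconnected (h : G.IsVertexConnected 2) : G.Preconnected := by
  intro x y
  have h1 := (h.2 ∅ (by simp)).preconnected ⟨x, by simp⟩ ⟨y, by simp⟩
  exact h1.map (Embedding.induce _).toHom

theorem IsVertexConnected.exists_spanPath (h : G.IsVertexConnected 2) {X : Set V}
    (hX : X.Subsingleton) {x y : V} (hx : x ∉ X) (hy : y ∉ X) :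
    ∃ N, SpanPath G.Adj x y N ∧ N.Nodup ∧ ∀ z ∈ N, z ∉ X := by
  have hX' : X.encard < ((2 : ℕ) : ℕ∞) :=
    (Set.encard_le_one_iff_subsingleton.2 hX).trans_lt (by norm_num)
  obtain ⟨p⟩ := (h.2 X hX').preconnected ⟨x, hx⟩ ⟨y, hy⟩
  have h1 := (Walk.spanPath p).map (f := Subtype.val) (R' := G.Adj) fun _ _ h => h
  obtain ⟨N, hN, hnd, hsub⟩ := h1.exists_nodup
  refine ⟨N, hN, hnd, fun z hz => ?_⟩
  obtain ⟨a, -, rfl⟩ := Multiset.mem_map.1 (hsub z hz)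
  exact a.2

theorem IsVertexConnected.exists_ne_ne (h : G.IsVertexConnected 2) (a b : V) :
    ∃ c, c ≠ a ∧ c ≠ b := by
  by_contra! hcon
  have h1 : (Set.univ : Set V) ⊆ {a, b} := fun x _ => by
    by_cases hx : x = a
    · exact .inl hx
    · exact .inr (hcon x hx)
  have h2 := (Set.encard_le_encard h1).trans (Set.encard_insert_le {b} a)
  rw [Set.encard_univ, Set.encard_singleton] at h2
  exact absurd h.1 (not_lt.2 (h2.trans (by norm_num)))

/-- The vertex multiset of a cycle. -/
def IsCycleMultiset (G : SimpleGraph V) (M : Multiset V) : Prop :=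
  (∃ a b, SpanPath G.Adj a b M ∧ G.Adj b a) ∧ M.Nodup ∧ 3 ≤ M.card

theorem IsVertexConnected.exists_cycle (h : G.IsVertexConnected 2) :
    ∃ M, G.IsCycleMultiset M := by
  obtain ⟨v⟩ : Nonempty V := by
    by_contra hV
    rw [not_nonempty_iff] at hV
    have := h.1
    rw [(ENat.card_eq_zero_iff_empty V).2 hV] at this
    simp at this
  have nbr : ∀ X : Set V, X.Subsingleton → v ∉ X → ∃ a, a ∉ X ∧ G.Adj v a := by
    intro X hX hv
    obtain ⟨x, hxv, hxX⟩ : ∃ x, x ≠ v ∧ x ∉ X := by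
      rcases hX.eq_empty_or_singleton with rfl | ⟨y, rfl⟩
      · obtain ⟨x, hx, -⟩ := h.exists_ne_ne v v; exact ⟨x, hx, by simp⟩
      · obtain ⟨x, hx, hx'⟩ := h.exists_ne_ne v y; exact ⟨x, hx, hx'⟩
    obtain ⟨N, hN, -, hNX⟩ := h.exists_spanPath hX hv hxX
    rcases hN.uncons with ⟨rfl, -⟩ | ⟨c, M, hc, hM, rfl⟩
    · exact absurd rfl hxv
    · exact ⟨c, hNX c (by simp [hM.left_mem]), hc⟩
  obtain ⟨a, -, ha⟩ := nbr ∅ Set.subsingleton_empty (by simp)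
  obtain ⟨b, hba, hb⟩ := nbr {a} Set.subsingleton_singleton (by simpa using ha.ne)
  obtain ⟨N, hN, hnd, hNv⟩ := h.exists_spanPath (X := {v}) Set.subsingleton_singleton
    (x := a) (y := b) (by simpa using ha.ne') (by simpa using hb.ne')
  refine ⟨v ::ₘ N, ⟨v, b, .cons ha hN, hb.symm⟩, ?_, ?_⟩
  · rw [Multiset.nodup_cons]
    exact ⟨fun h => hNv v h rfl, hnd⟩
  · rw [Multiset.card_cons]
    rcases hN.uncons with ⟨rfl, -⟩ | ⟨c, M, -, hM, rfl⟩
    · exact absurd rfl hba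
    · have : 1 ≤ M.card := Multiset.card_pos_iff_exists_mem.2 ⟨c, hM.left_mem⟩
      rw [Multiset.card_cons]; omega

/-- Ryjáček's theorem: a finite 2-connected claw-free graph in which the horns of every induced bull
have a common neighbour outside of the bull has a Hamilton cycle. -/
theorem exists_hamilton_cycle_of_finite [Finite V] (hconn : G.IsVertexConnected 2)
    (hclaw : G.IsInducedFree claw) (hbull : G.BullHornsHaveCommonNeighbor) :
    ∃ M, G.IsCycleMultiset M ∧ ∀ x, x ∈ M := by
  classical
  have := Fintype.ofFinite V
  have hcard : ∀ M : Multiset V, M.Nodup → M.card ≤ Fintype.card V := fun M hM => by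
    rw [← Multiset.toFinset_card_of_nodup hM]; exact Finset.card_le_univ _
  obtain ⟨M, hM, hmax⟩ : ∃ M, G.IsCycleMultiset M ∧
      ∀ N, G.IsCycleMultiset N → N.card ≤ M.card := by
    obtain ⟨M₀, h₀⟩ := hconn.exists_cycle
    have hs := Nat.sSup_mem (s := {n | ∃ M, G.IsCycleMultiset M ∧ M.card = n})
      ⟨_, M₀, h₀, rfl⟩ ⟨Fintype.card V, by rintro _ ⟨M, hM, rfl⟩; exact hcard M hM.2.1⟩
    obtain ⟨M, hM, he⟩ := hs
    refine ⟨M, hM, fun N hN => ?_⟩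
    rw [he]
    exact le_csSup ⟨Fintype.card V, by rintro _ ⟨M, hM, rfl⟩; exact hcard M hM.2.1⟩ ⟨N, hN, rfl⟩
  refine ⟨M, hM, fun x₀ => ?_⟩
  by_contra hx₀
  have hG := hconn.preconnected
  set H : Set V := {y | ∃ N, SpanPath G.Adj x₀ y N ∧ ∀ z ∈ N, z ∉ M} with hH
  obtain ⟨d, hd, hd0⟩ := exists_isLevel hG (H := H) ⟨x₀, {x₀}, .single _, by simpa using hx₀⟩
  have hO : LongestCycleLevel G M d := by
    refine ⟨hd, ?_, ?_, hM.2.1, hM.2.2, hM.1, fun a b N h1 h2 h3 h4 =>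
      hmax N ⟨⟨a, b, h1, h2⟩, h3, h4⟩, ?_⟩
    · intro x hx h0
      obtain ⟨N, hN, hNM⟩ := (hd0 x).1 h0
      exact hNM x hN.right_mem hx
    · intro x hx
      by_contra hxM
      obtain ⟨y, hxy, hy⟩ := hd.parent hx
      obtain ⟨N, hN, hNM⟩ := (hd0 y).1 hy
      have : d x = 0 := (hd0 x).2 ⟨_, hN.concat hxy.symm, fun z hz => by
        rcases Multiset.mem_cons.1 hz with rfl | hz
        · exact hxM
        · exact hNM z hz⟩
      omega
    · intro x y hx hy
      have hpre : ∀ {y N}, SpanPath G.Adj x₀ y N → (∀ z ∈ N, z ∉ M) → ∀ z ∈ N, d z = 0 := by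
        intro y N hN hNM z hz
        rcases hN.split hz with ⟨rfl, -⟩ | ⟨p, M₁, M₂, h₁, hp, -, rfl⟩
        · exact (hd0 z).2 ⟨{z}, .single z, by simpa using hx₀⟩
        · refine (hd0 z).2 ⟨_, h₁.concat hp, fun a ha => ?_⟩
          rcases Multiset.mem_cons.1 ha with rfl | ha
          · exact hNM a hz
          · exact hNM a (by simp [ha])
      obtain ⟨N₁, h₁, k₁⟩ := (hd0 x).1 hx
      obtain ⟨N₂, h₂, k₂⟩ := (hd0 y).1 hy
      obtain ⟨L, hL, hLs⟩ := h₁.symm.trans h₂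
      obtain ⟨L', hL', hnd, hs⟩ := hL.exists_nodup
      exact ⟨L', hL', hnd, fun z hz => (hLs z (hs z hz)).elim (hpre h₁ k₁ z) (hpre h₂ k₂ z)⟩
  -- A path leaving the component passes through level one, so a single attachment would separate
  -- `x₀` from the other vertices of the cycle.
  have htwo : ¬ ({x | d x = 1} : Set V).Subsingleton := by
    intro hsub
    obtain ⟨c, hcM, hc1⟩ : ∃ c ∈ M, d c ≠ 1 := by
      by_contra! hcon
      have h2 := hM.2.2
      have h3 : M ≤ {Classical.choose (Multiset.card_pos_iff_exists_mem.1 (by omega : 0 < M.card))} :=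
        (Multiset.le_iff_subset hM.2.1).2 fun x hx => Multiset.mem_singleton.2 (hsub (hcon x hx)
          (hcon _ (Classical.choose_spec (Multiset.card_pos_iff_exists_mem.1
            (by omega : 0 < M.card)))))
      have := Multiset.card_le_card h3
      rw [Multiset.card_singleton] at this
      omega
    have h0 : d x₀ = 0 := (hd0 x₀).2 ⟨{x₀}, .single _, by simpa using hx₀⟩
    obtain ⟨N, hN, -, hN1⟩ := hconn.exists_spanPath hsub (x := x₀) (y := c)
      (by simp [h0]) hc1
    obtain ⟨p, q, N₁, N₂, h₁, hpq, hcr, h₂, rfl⟩ := hN.exists_crossing (P := fun x => d x = 0)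
      hN.left_mem hN.right_mem h0 (hO.off c hcM)
    have l1 := hd.lip hpq
    have l2 := hd.lip hpq.symm
    have n1 : d p ≠ 1 := hN1 p (by simp [h₁.right_mem])
    have n2 : d q ≠ 1 := hN1 q (by simp [h₂.left_mem])
    omega
  rw [Set.not_subsingleton_iff] at htwo
  obtain ⟨v, hv, v', hv', hne⟩ := htwo
  exact hO.absurd_of_two hclaw hbull hv hv' hne

end SimpleGraph

/-! ### Descendants and the chains of cliques far out -/

namespace SimpleGraph

variable {V : Type*} {G : SimpleGraph V} {d : V → ℕ} {n : ℕ}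

/-- `y` is a neighbour of `x` on the next level. -/
def IsChild (G : SimpleGraph V) (d : V → ℕ) (x y : V) : Prop :=
  G.Adj x y ∧ d y = d x + 1

/-- `z` can be reached from `x` by going up from level to level. -/
def IsDescendant (G : SimpleGraph V) (d : V → ℕ) : V → V → Prop :=
  Relation.ReflTransGen (G.IsChild d)

namespace IsDescendant

theorem level_le {x z : V} (h : G.IsDescendant d x z) : d x ≤ d z := by
  induction h with
  | refl => exact le_rfl
  | tail _ h ih => rw [h.2]; omega

theorem eq_of_level {x z : V} (h : G.IsDescendant d x z) (hd : d z = d x) : z = x := by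
  rcases Relation.ReflTransGen.cases_tail h with h' | ⟨p, hp, hpz⟩
  · exact h'
  · have := level_le hp
    have := hpz.2
    omega

theorem exists_parent {x z : V} (h : G.IsDescendant d x z) (hd : d x < d z) :
    ∃ p, G.IsDescendant d x p ∧ G.IsChild d p z := by
  rcases Relation.ReflTransGen.cases_tail h with rfl | h'
  · exact absurd hd (lt_irrefl _)
  · exact h'

theorem exists_between {x z : V} (h : G.IsDescendant d x z) {k : ℕ} (hk : d x ≤ k) (hz : k < d z) :
    ∃ p c, G.IsDescendant d x p ∧ d p = k ∧ G.IsChild d p c := by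
  induction h with
  | refl => omega
  | @tail p z hp hpz ih =>
    by_cases h : k < d p
    · exact ih h
    · exact ⟨p, z, hp, by have := hpz.2; omega, hpz⟩

end IsDescendant

namespace IsLevel

variable (hd : G.IsLevel d)

include hd

theorem exists_ancestor {k : ℕ} {z : V} (hz : k ≤ d z) : ∃ x, d x = k ∧ G.IsDescendant d x z := by
  obtain ⟨m, hm⟩ := Nat.exists_eq_add_of_le hz
  induction m generalizing z with
  | zero => exact ⟨z, hm, .refl⟩
  | succ m ih =>
    obtain ⟨p, hp, hdp⟩ := hd.parent (x := z) (k := k + m) (by omega)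
    obtain ⟨x, hx, hxp⟩ := ih (by omega) hdp
    exact ⟨x, hx, hxp.tail ⟨hp.symm, by omega⟩⟩

theorem finite_level [G.LocallyFinite] (h0 : {x | d x = 0}.Finite) (k : ℕ) :
    {x | d x = k}.Finite := by
  induction k with
  | zero => exact h0
  | succ k ih =>
    refine (ih.biUnion fun p _ => (G.neighborSet p).toFinite).subset fun x hx => ?_
    obtain ⟨p, hp, hdp⟩ := hd.parent hx
    exact Set.mem_biUnion hdp hp.symm

variable (hclaw : G.IsInducedFree claw) (hbull : G.BullHornsHaveCommonNeighbor)

include hclaw hbull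

/-- Descendants of a vertex that lie on the same level form a clique. -/
theorem descendants_adj {x z z' : V} (hx : 2 ≤ d x) (h : G.IsDescendant d x z)
    (h' : G.IsDescendant d x z') (hdz : d z = d z') : z = z' ∨ G.Adj z z' := by
  induction h generalizing z' with
  | refl => exact .inl (h'.eq_of_level hdz.symm).symm
  | @tail p z hp hpz ih =>
    have h1 := IsDescendant.level_le hp
    obtain ⟨hpz, hdpz⟩ := hpz
    obtain ⟨p', hp', hpz', hdpz'⟩ := h'.exists_parent (by omega)
    by_cases hzz : z = z'
    · exact .inl hzz
    right
    have hpz'' : G.Adj p z' := by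
      rcases ih hp' (by omega) with rfl | h
      · exact hpz'
      · exact hd.child_of_adj hclaw hbull h.symm (by omega) (by omega) hpz' hdpz'
    exact hd.children_adj hclaw (by omega) hpz hpz'' (by omega) (by omega) hzz

theorem descendants_adj_succ {x z z' : V} (hx : 2 ≤ d x) (h : G.IsDescendant d x z)
    (h' : G.IsDescendant d x z') (hdz : d z' = d z + 1) : G.Adj z z' := by
  have := h.level_le
  obtain ⟨p, hp, hpz, hdpz⟩ := h'.exists_parent (by omega)
  rcases hd.descendants_adj hclaw hbull hx hp h (by omega) with rfl | h
  · exact hpz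
  · exact hd.child_of_adj hclaw hbull h (by omega) (by omega) hpz hdpz

/-- Beyond some level, every vertex has a child. -/
theorem exists_forall_child (hfin : ∀ k, {x | d x = k}.Finite) :
    ∃ n, 3 ≤ n ∧ ∀ y, n ≤ d y → ∃ c, G.IsChild d y c := by
  classical
  -- If the descendants of `x` have unbounded level, the condition is vacuous and the bound is set
  -- to 0.
  have h1 : ∀ x : V, ∃ k, (∃ k, ∀ z, G.IsDescendant d x z → d z < k) →
      ∀ z, G.IsDescendant d x z → d z < k := by
    intro x
    by_cases h : ∃ k, ∀ z, G.IsDescendant d x z → d z < k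
    · exact ⟨h.choose, fun _ => h.choose_spec⟩
    · exact ⟨0, fun h' => absurd h' h⟩
  choose f hf using h1
  refine ⟨max 3 ((hfin 2).toFinset.sup f), le_max_left _ _, fun y hy => ?_⟩
  obtain ⟨x, hx, hxy⟩ := hd.exists_ancestor (k := 2) (z := y)
    (by have := le_max_left 3 ((hfin 2).toFinset.sup f); omega)
  have hfx : f x ≤ d y :=
    (Finset.le_sup (f := f) (by simpa using hx)).trans ((le_max_right _ _).trans hy)
  have halive : ¬ ∃ k, ∀ z, G.IsDescendant d x z → d z < k := fun h =>
    absurd (hf x h y hxy) (by omega)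
  push Not at halive
  obtain ⟨z, hxz, hz⟩ := halive (d y + 1)
  obtain ⟨p, c, hp, hdp, hpc, hdc⟩ := hxz.exists_between (k := d y) hxy.level_le (by omega)
  -- The ancestor `x` of `y` on level two has descendants above the level of `y`; `p` is on the way
  -- to one of them, and adjacency passes its child on to `y`.
  rcases hd.descendants_adj hclaw hbull hx.ge hp hxy hdp with rfl | h
  · exact ⟨c, hpc, hdc⟩
  · exact ⟨c, hd.child_of_adj hclaw hbull h hdp.symm
      (by have := le_max_left 3 ((hfin 2).toFinset.sup f); omega) hpc hdc, by omega⟩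

end IsLevel

/-- An injective numbering compatible with the levels. -/
theorem exists_key {V : Type*} {d : V → ℕ} (hfin : ∀ k, {x | d x = k}.Finite) :
    ∃ key : V → ℕ, Function.Injective key ∧ ∀ x y, d x < d y → key x < key y := by
  classical
  have e : ∀ k, ∃ f : V → ℕ, (∀ x y, d x = k → d y = k → f x = f y → x = y) ∧
      ∀ x, d x = k → f x < (hfin k).toFinset.card := by
    intro k
    refine ⟨fun x => if h : x ∈ (hfin k).toFinset then ((hfin k).toFinset.equivFin ⟨x, h⟩ : ℕ)
      else 0, fun x y hx hy hxy => ?_, fun x hx => ?_⟩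
    · have hx' : x ∈ (hfin k).toFinset := by simpa using hx
      have hy' : y ∈ (hfin k).toFinset := by simpa using hy
      simp only [hx', hy', dif_pos] at hxy
      have := (hfin k).toFinset.equivFin.injective (Fin.ext hxy)
      exact congrArg Subtype.val this
    · have hx' : x ∈ (hfin k).toFinset := by simpa using hx
      simp only [hx', dif_pos]
      exact Fin.is_lt _
  choose f hf hf' using e
  have hlt : ∀ x y, d x < d y →
      (∑ k ∈ Finset.range (d x), (hfin k).toFinset.card) + f (d x) x <
      (∑ k ∈ Finset.range (d y), (hfin k).toFinset.card) + f (d y) y := by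
    intro x y hxy
    have h1 := hf' (d x) x rfl
    have h2 : ∑ k ∈ Finset.range (d x + 1), (hfin k).toFinset.card ≤
        ∑ k ∈ Finset.range (d y), (hfin k).toFinset.card :=
      Finset.sum_le_sum_of_subset (Finset.range_subset_range.2 hxy)
    rw [Finset.sum_range_succ] at h2
    omega
  refine ⟨fun x => (∑ k ∈ Finset.range (d x), (hfin k).toFinset.card) + f (d x) x, ?_, hlt⟩
  intro x y hxy
  simp only at hxy
  rcases lt_trichotomy (d x) (d y) with h | h | h
  · exact absurd hxy (hlt x y h).ne
  · rw [h] at hxy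
    exact hf (d y) x y h rfl (Nat.add_left_cancel hxy)
  · exact absurd hxy.symm (hlt y x h).ne

/-- All vertices from level `n ≥ 3` on have children, in a claw-free graph with the bull property:
far out, the graph is a disjoint union of chains of cliques. -/
structure IsLayered (G : SimpleGraph V) (d : V → ℕ) (n : ℕ) : Prop where
  level : G.IsLevel d
  three_le : 3 ≤ n
  child : ∀ y, n ≤ d y → ∃ c, G.IsChild d y c
  claw_free : G.IsInducedFree claw
  bull : G.BullHornsHaveCommonNeighbor

namespace IsLayered

variable (hL : G.IsLayered d n)

include hL

theorem adj_trans {x y z : V} (hy : n ≤ d y) (hxy : G.Adj x y) (hdx : d x = d y) (hyz : G.Adj y z)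
    (hdz : d z = d y) (hne : x ≠ z) : G.Adj x z := by
  obtain ⟨c, hc, hdc⟩ := hL.child y hy
  have := hL.three_le
  exact hL.level.adj_trans hL.claw_free hL.bull (by omega) hc hdc hxy.symm hdx hyz hdz hne

theorem parents_adj {y p p' : V} (hy : n ≤ d y) (hp : G.IsChild d p y) (hp' : G.IsChild d p' y)
    (hne : p ≠ p') : G.Adj p p' := by
  obtain ⟨c, hc, hdc⟩ := hL.child y hy
  exact hL.level.parents_adj hL.claw_free hc hdc hp.1.symm hp.2 hp'.1.symm hp'.2 hne

theorem child_of_adj {x y c : V} (hxy : G.Adj x y) (hdxy : d y = d x) (hx : n ≤ d x)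
    (hc : G.IsChild d x c) : G.IsChild d y c := by
  have := hL.three_le
  exact ⟨hL.level.child_of_adj hL.claw_free hL.bull hxy hdxy (by omega) hc.1 hc.2,
    by rw [hc.2, hdxy]⟩

theorem parent_of_adj {y y' p : V} (hyy : G.Adj y y') (hdy : d y' = d y) (hy : n ≤ d y)
    (hp : G.IsChild d p y) : G.IsChild d p y' := by
  have := hL.three_le
  obtain ⟨c, hc, hdc⟩ := hL.child y hy
  obtain ⟨p', hp', hdp'⟩ := hL.level.parent (x := y') (k := d p) (by rw [hdy, hp.2])
  exact ⟨hL.level.parent_of_adj hL.claw_free hL.bull hyy hdy (by omega) hc hdc hp.1.symm hp.2 hp'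
    (by rw [hdy, hdp', hp.2]), by rw [hdy, hp.2]⟩

theorem descendants_adj {x z z' : V} (hx : n ≤ d x) (h : G.IsDescendant d x z)
    (h' : G.IsDescendant d x z') (hdz : d z = d z') : z = z' ∨ G.Adj z z' := by
  have := hL.three_le
  exact hL.level.descendants_adj hL.claw_free hL.bull (by omega) h h' hdz

theorem descendants_adj_succ {x z z' : V} (hx : n ≤ d x) (h : G.IsDescendant d x z)
    (h' : G.IsDescendant d x z') (hdz : d z' = d z + 1) : G.Adj z z' := by
  have := hL.three_le
  exact hL.level.descendants_adj_succ hL.claw_free hL.bull (by omega) h h' hdz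

theorem descendant_of_adj_same {q p p' : V} (hq : n ≤ d q) (h : G.IsDescendant d q p)
    (hlt : d q < d p) (hpp : G.Adj p p') (hd : d p' = d p) : G.IsDescendant d q p' := by
  obtain ⟨r, hr, hrp⟩ := h.exists_parent hlt
  exact hr.tail (hL.parent_of_adj hpp hd (by omega) hrp)

/-- The proper descendants of `q` are closed under adjacency above the level of `q`. -/
theorem descendant_of_adj {q z z' : V} (hq : n ≤ d q) (h : G.IsDescendant d q z)
    (hlt : d q < d z) (hzz : G.Adj z z') (hlt' : d q < d z') : G.IsDescendant d q z' := by
  have l1 := hL.level.lip hzz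
  have l2 := hL.level.lip hzz.symm
  obtain h1 | h1 | h1 : d z' = d z + 1 ∨ d z' = d z ∨ d z = d z' + 1 := by omega
  · exact h.tail ⟨hzz, h1⟩
  · exact hL.descendant_of_adj_same hq h hlt hzz h1
  · obtain ⟨p, hp, hpz⟩ := h.exists_parent hlt
    by_cases hne : p = z'
    · exact hne ▸ hp
    · exact hL.descendant_of_adj_same hq hp (by have := hpz.2; omega)
        (hL.parents_adj (by omega) hpz ⟨hzz.symm, h1⟩ hne) (by have := hpz.2; omega)

/-- Two parents of one vertex are equal or adjacent, and above `q` adjacency on a level preserves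
descent from `q`. So the two lines of descent can be compared downwards until they reach the level
of `q`. -/
theorem ancestors_adj {q q' z : V} (hq : n ≤ d q) (hdq : d q = d q') (h : G.IsDescendant d q z)
    (h' : G.IsDescendant d q' z) : q = q' ∨ G.Adj q q' := by
  induction h' with
  | refl => exact .inl (h.eq_of_level hdq.symm).symm
  | @tail p' z hp' hpz ih =>
    have hle := IsDescendant.level_le hp'
    obtain ⟨p, hp, hpz'⟩ := h.exists_parent (by have := hpz.2; omega)
    by_cases hne : p = p'
    · exact ih (hne ▸ hp)
    have hadj := hL.parents_adj (by have := hpz.2; omega) hpz' hpz hne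
    have e1 := hpz.2
    have e2 := hpz'.2
    by_cases hlt : d q < d p
    · exact ih (hL.descendant_of_adj_same hq hp hlt hadj (by omega))
    · have := hp.level_le
      rw [hp.eq_of_level (by omega), IsDescendant.eq_of_level hp' (by omega)] at hadj
      exact .inr hadj

theorem descendant_of_adj_left {q q' z : V} (hq : n ≤ d q) (hqq : G.Adj q q') (hdq : d q' = d q)
    (h : G.IsDescendant d q z) (hlt : d q < d z) : G.IsDescendant d q' z := by
  rcases Relation.ReflTransGen.cases_head h with rfl | ⟨c, hc, hcz⟩
  · exact absurd hlt (lt_irrefl _)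
  · exact Relation.ReflTransGen.head (hL.child_of_adj hqq hdq hq hc) hcz

theorem exists_descendant {q : V} (hq : n ≤ d q) {k : ℕ} (hk : d q ≤ k) :
    ∃ z, G.IsDescendant d q z ∧ d z = k := by
  obtain ⟨m, rfl⟩ := Nat.exists_eq_add_of_le hk
  induction m with
  | zero => exact ⟨q, .refl, rfl⟩
  | succ m ih =>
    obtain ⟨z, hz, hdz⟩ := ih (by omega)
    obtain ⟨c, hc⟩ := hL.child z (by omega)
    exact ⟨c, hz.tail hc, by have := hc.2; omega⟩

variable (hconn : G.IsVertexConnected 2)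

include hconn

/-- No vertex far out is the only one in its layer. -/
theorem exists_adj_same {y v₀ : V} (h0 : d v₀ = 0) (hy : n ≤ d y) :
    ∃ y', G.Adj y y' ∧ d y' = d y := by
  by_contra! hcon
  obtain ⟨c, hc⟩ := hL.child y hy
  have := hL.three_le
  obtain ⟨N, hN, -, hNy⟩ := hconn.exists_spanPath (X := {y}) Set.subsingleton_singleton
    (x := c) (y := v₀) (by simpa using hc.1.ne') (by rintro rfl; omega)
  -- A `y` alone in its layer would separate its proper descendants from `v₀`: every step out of
  -- them ends in `y` or in a neighbour of `y` on its level.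
  obtain ⟨s, t, N₁, N₂, h₁, hst, hcr, h₂, rfl⟩ :=
    hN.exists_crossing (P := fun z => G.IsDescendant d y z ∧ d y < d z) hN.left_mem hN.right_mem
      ⟨.single hc, by have := hc.2; omega⟩ (fun h => by omega)
  have key : ∀ s t, G.Adj s t → t ≠ y → (G.IsDescendant d y s ∧ d y < d s) →
      ¬ (G.IsDescendant d y t ∧ d y < d t) → False := by
    intro s t hst hty hs ht
    by_cases hlt : d y < d t
    · exact ht ⟨hL.descendant_of_adj hy hs.1 hs.2 hst hlt, hlt⟩
    · have := hL.level.lip hst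
      obtain ⟨p, hp, hps⟩ := hs.1.exists_parent hs.2
      have hpy : p = y := hp.eq_of_level (by have := hp.level_le; have := hps.2; omega)
      subst hpy
      exact hcon t (hL.parents_adj (by omega) hps ⟨hst.symm, by omega⟩ (Ne.symm hty))
        (by have := hps.2; omega)
  have hsy : s ≠ y := fun h => hNy s (by simp [h₁.right_mem]) h
  have hty : t ≠ y := fun h => hNy t (by simp [h₂.left_mem]) h
  by_cases hs : G.IsDescendant d y s ∧ d y < d s
  · exact key s t hst hty hs fun ht => hcr (by simp only [hs, ht])
  · exact key t s hst.symm hsy (by by_contra ht; exact hcr (by simp only [hs, ht])) hs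

end IsLayered

end SimpleGraph

/-! ### The finite core and its Hamilton cycle -/

namespace SimpleGraph

variable {V : Type*} {G : SimpleGraph V} {d key : V → ℕ} {n : ℕ}

/-- `τ` is the chosen representative of its clique on level `n + 1`. -/
def IsRep (G : SimpleGraph V) (d key : V → ℕ) (n : ℕ) (τ : V) : Prop :=
  d τ = n + 1 ∧ ∀ y, d y = n + 1 → G.Adj y τ → key τ < key y

/-- The levels up to `n`, together with one vertex of each clique on level `n + 1`. -/
def core (G : SimpleGraph V) (d key : V → ℕ) (n : ℕ) : Set V :=
  {x | d x ≤ n ∨ G.IsRep d key n x}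

theorem IsRep.not_adj {τ τ' : V} (h : G.IsRep d key n τ) (h' : G.IsRep d key n τ') :
    ¬ G.Adj τ τ' := fun hadj =>
  lt_asymm (h.2 τ' h'.1 hadj.symm) (h'.2 τ h.1 hadj)

namespace IsLayered

variable (hL : G.IsLayered d n)

include hL

theorem exists_rep (hkey : Function.Injective key) {y : V} (hy : d y = n + 1) :
    ∃ τ, G.IsRep d key n τ ∧ (τ = y ∨ G.Adj τ y) := by
  classical
  have hne : ∃ k z, key z = k ∧ d z = n + 1 ∧ (z = y ∨ G.Adj z y) := ⟨key y, y, rfl, hy, .inl rfl⟩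
  obtain ⟨τ, hk, hτ, hτy⟩ := Nat.find_spec hne
  refine ⟨τ, ⟨hτ, fun z hz hzτ => ?_⟩, hτy⟩
  have h1 : z = y ∨ G.Adj z y := by
    by_cases hzy : z = y
    · exact .inl hzy
    rcases hτy with rfl | hτy
    · exact .inr hzτ
    · exact .inr (hL.adj_trans (by omega) hzτ (by omega) hτy (by omega) hzy)
  have h2 := Nat.find_min' hne ⟨z, rfl, hz, h1⟩
  rw [hk]
  refine lt_of_le_of_ne h2 fun h => hzτ.ne (hkey (by rw [← h, hk]))

theorem rep_unique {τ τ' q : V} (hτ : G.IsRep d key n τ) (hτ' : G.IsRep d key n τ')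
    (hq : n ≤ d q) (hqτ : G.IsDescendant d q τ) (hqτ' : G.IsDescendant d q τ') : τ = τ' :=
  (hL.descendants_adj hq hqτ hqτ' (by rw [hτ.1, hτ'.1])).resolve_right (hτ.not_adj hτ')

/-- A common neighbour outside the core lies above level `n`. Each horn is then a parent of it or
the representative of its clique, and any two such vertices are equal or adjacent, unlike the horns.
-/
theorem bull_core : (G.induce (core G d key n)).BullHornsHaveCommonNeighbor := by
  intro B
  obtain ⟨w, hw, h3, h4⟩ := hL.bull (B.trans (Embedding.induce _))
  have hnr : ¬ SimpleGraph.bull.Adj 3 4 := by simp [SimpleGraph.bull]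
  have hnadj : ¬ G.Adj (B 3 : V) (B 4 : V) := fun h => hnr (B.map_adj_iff.1 h)
  have hne : (B 3 : V) ≠ (B 4 : V) := fun h => by
    have := B.injective (Subtype.ext h)
    simp at this
  by_cases hwc : w ∈ core G d key n
  · refine ⟨⟨w, hwc⟩, ?_, h3, h4⟩
    rintro ⟨i, hi⟩
    exact hw ⟨i, congrArg Subtype.val hi⟩
  exfalso
  have h3' : G.Adj (B 3 : V) w := h3
  have h4' : G.Adj (B 4 : V) w := h4
  generalize hx : (B 3 : V) = x at *
  generalize hy : (B 4 : V) = y at *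
  have hxc : x ∈ core G d key n := hx ▸ (B 3).2
  have hyc : y ∈ core G d key n := hy ▸ (B 4).2
  clear h3 h4 hx hy hw
  have hwn : n < d w := by
    by_contra h; exact hwc (.inl (not_lt.1 h))
  have hwr : ¬ G.IsRep d key n w := fun h => hwc (.inr h)
  have key1 : ∀ x, x ∈ core G d key n → G.Adj x w →
      G.IsChild d x w ∨ (G.IsRep d key n x ∧ d w = n + 1) := by
    intro x hx hxw
    have l1 := hL.level.lip hxw
    have l2 := hL.level.lip hxw.symm
    rcases hx with hx | hx
    · exact .inl ⟨hxw, by omega⟩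
    · have := hx.1
      by_cases h : d w = n + 1
      · exact .inr ⟨hx, h⟩
      · exact .inl ⟨hxw, by omega⟩
  rcases key1 x hxc h3' with h1 | ⟨h1, e1⟩ <;> rcases key1 y hyc h4' with h2 | ⟨h2, e2⟩
  · exact hnadj (hL.parents_adj (by omega) h1 h2 hne)
  · exact hnadj (hL.parent_of_adj h4'.symm (by rw [h2.1, e2]) (by omega) h1).1
  · exact hnadj (hL.parent_of_adj h3'.symm (by rw [h1.1, e1]) (by omega) h2).1.symm
  · exact hnadj (hL.adj_trans (by omega) h3' (by rw [h1.1, e1]) h4'.symm (by rw [h2.1, e2]) hne)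

theorem claw_free_core : (G.induce (core G d key n)).IsInducedFree claw :=
  ⟨fun f => hL.claw_free.false (f.trans (Embedding.induce _))⟩

omit hL in
/-- `g` is `z` or, for `z` above level `n`, an ancestor of `z` on level `n`. -/
def IsShadow (G : SimpleGraph V) (d : V → ℕ) (n : ℕ) (z g : V) : Prop :=
  (d z ≤ n ∧ g = z) ∨ (n < d z ∧ d g = n ∧ G.IsDescendant d g z)

/-- Shadows turn a path of the whole graph into one within the levels up to `n`, possibly with
repetitions. -/
theorem shadow_adj {z z' g g' : V} (hz : z = z' ∨ G.Adj z z') (hg : IsShadow G d n z g)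
    (hg' : IsShadow G d n z' g') : g = g' ∨ G.Adj g g' := by
  have key1 : ∀ z z' g g', G.Adj z z' → d z ≤ n → g = z → n < d z' → d g' = n →
      G.IsDescendant d g' z' → g = g' ∨ G.Adj g g' := by
    rintro z z' g g' hz h1 rfl h2 h3 h4
    have := hL.level.lip hz.symm
    exact hL.ancestors_adj (by omega) (by omega) (.single ⟨hz, by omega⟩) h4
  rcases hg with ⟨h1, e1⟩ | ⟨h1, h2, h3⟩ <;> rcases hg' with ⟨h1', e1'⟩ | ⟨h1', h2', h3'⟩
  · subst e1 e1'; exact hz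
  · rcases hz with rfl | hz
    · omega
    · exact key1 z z' g g' hz h1 e1 h1' h2' h3'
  · rcases hz with rfl | hz
    · omega
    · exact (key1 z' z g' g hz.symm h1' e1' h1 h2 h3).imp Eq.symm fun h => h.symm
  · refine hL.ancestors_adj (z := z') (by omega) (by omega) ?_ h3'
    rcases hz with rfl | hz
    · exact h3
    · exact hL.descendant_of_adj (by omega) h3 (by omega) hz (by omega)

variable (hconn : G.IsVertexConnected 2)

include hconn

/-- An ancestor on level `n` has a neighbour on its own level with the same proper descendants; at
most one of the two is deleted. -/
theorem exists_shadow {v₀ : V} (h0 : d v₀ = 0) {X : Set V} (hX : X.Subsingleton) {z : V}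
    (hz : z ∉ X) : ∃ g, IsShadow G d n z g ∧ g ∉ X ∧ d g ≤ n := by
  by_cases hzn : d z ≤ n
  · exact ⟨z, .inl ⟨hzn, rfl⟩, hz, hzn⟩
  · obtain ⟨q, hq, hqz⟩ := hL.level.exists_ancestor (k := n) (z := z) (by omega)
    by_cases hqX : q ∈ X
    · obtain ⟨q', hqq, hdq⟩ := hL.exists_adj_same hconn (y := q) h0 hq.ge
      exact ⟨q', .inr ⟨by omega, by omega, hL.descendant_of_adj_left hq.ge hqq hdq hqz (by omega)⟩,
        fun h => hqq.ne (hX hqX h), by omega⟩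
    · exact ⟨q, .inr ⟨by omega, hq, hqz⟩, hqX, by omega⟩

theorem two_lt_card_core : ((2 : ℕ) : ℕ∞) < ENat.card (core G d key n) := by
  by_cases hW : core G d key n = Set.univ
  · rw [hW]
    have := hconn.1
    rwa [← Set.encard_univ] at this
  · obtain ⟨y, hy⟩ := (Set.ne_univ_iff_exists_notMem _).1 hW
    have hyn : n < d y := by
      by_contra h; exact hy (.inl (not_lt.1 h))
    have := hL.three_le
    obtain ⟨a, ha, -⟩ := hL.level.exists_ancestor (k := 0) (z := y) (by omega)
    obtain ⟨b, hb, -⟩ := hL.level.exists_ancestor (k := 1) (z := y) (by omega)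
    obtain ⟨c, hc, -⟩ := hL.level.exists_ancestor (k := 2) (z := y) (by omega)
    have hsub : ({a, b, c} : Set V) ⊆ core G d key n := by
      rintro x (rfl | rfl | rfl) <;> exact .inl (by omega)
    have h3 : ({a, b, c} : Set V).encard = 3 :=
      Set.encard_eq_three.2 ⟨a, b, c, by rintro rfl; omega, by rintro rfl; omega,
        by rintro rfl; omega, rfl⟩
    have := Set.encard_le_encard hsub
    rw [h3] at this
    exact lt_of_lt_of_le (by norm_num) this

/-- Paths of the graph without `X` are projected by shadows avoiding `X`. A representative is linked
to its shadow by an edge, as it is only one level higher. -/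
theorem isVertexConnected_core {v₀ : V} (h0 : d v₀ = 0) :
    (G.induce (core G d key n)).IsVertexConnected 2 := by
  refine ⟨hL.two_lt_card_core hconn, fun X hX => ?_⟩
  have hXs : X.Subsingleton := by
    rw [← Set.encard_le_one_iff_subsingleton]
    exact Order.le_of_lt_add_one (by simpa [one_add_one_eq_two] using hX)
  set X' : Set V := Subtype.val '' X
  have hX' : X'.Subsingleton := hXs.image _
  have hmem : ∀ {x : V} (hx : x ∈ core G d key n), x ∉ X' → (⟨x, hx⟩ : core G d key n) ∈ Xᶜ :=
    fun hx hxX h => hxX ⟨_, h, rfl⟩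
  have hstep : ∀ {z z' : V} {N}, SpanPath G.Adj z z' N → (∀ x ∈ N, x ∉ X') →
      ∀ g g' (hg : d g ≤ n) (hg' : d g' ≤ n) (hgX : g ∉ X') (hgX' : g' ∉ X'),
      IsShadow G d n z g → IsShadow G d n z' g' →
      ((G.induce (core G d key n)).induce Xᶜ).Reachable ⟨⟨g, .inl hg⟩, hmem _ hgX⟩
        ⟨⟨g', .inl hg'⟩, hmem _ hgX'⟩ := by
    intro z z' N h
    have hlink : ∀ g g' (hg : d g ≤ n) (hg' : d g' ≤ n) (hgX : g ∉ X') (hgX' : g' ∉ X'),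
        g = g' ∨ G.Adj g g' →
        ((G.induce (core G d key n)).induce Xᶜ).Reachable ⟨⟨g, .inl hg⟩, hmem _ hgX⟩
        ⟨⟨g', .inl hg'⟩, hmem _ hgX'⟩ := by
      rintro g g' hg hg' hgX hgX' (rfl | h)
      · exact Reachable.refl _
      · exact Adj.reachable (G := (G.induce (core G d key n)).induce Xᶜ) h
    induction h with
    | single z =>
      intro _ g g' hg hg' hgX hgX' hs hs'
      exact hlink g g' hg hg' hgX hgX' (hL.shadow_adj (.inl rfl) hs hs')
    | @cons a b c M hab h ih =>
      intro hN g g' hg hg' hgX hgX' hs hs'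
      obtain ⟨g₁, hs₁, hgX₁, hg₁⟩ := hL.exists_shadow hconn h0 hX' (z := b)
        (hN b (by simp [h.left_mem]))
      exact (hlink g g₁ hg hg₁ hgX hgX₁ (hL.shadow_adj (.inr hab) hs hs₁)).trans
        (ih (fun x hx => hN x (by simp [hx])) g₁ g' hg₁ hg' hgX₁ hgX' hs₁ hs')
  have hself : ∀ a : (Xᶜ : Set (core G d key n)), ∃ g, ∃ (hg : d g ≤ n) (hgX : g ∉ X'),
      IsShadow G d n a.1.1 g ∧ ((G.induce (core G d key n)).induce Xᶜ).Reachable a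
        ⟨⟨g, .inl hg⟩, hmem _ hgX⟩ := by
    rintro ⟨⟨a, ha⟩, haX⟩
    have haX' : a ∉ X' := by
      rintro ⟨x, hx, rfl⟩; exact haX hx
    obtain ⟨g, hs, hgX, hg⟩ := hL.exists_shadow hconn h0 hX' haX'
    refine ⟨g, hg, hgX, hs, ?_⟩
    rcases hs with ⟨-, rfl⟩ | ⟨h1, h2, h3⟩
    · exact Reachable.refl _
    · have ha' : G.IsRep d key n a := ha.resolve_left (by omega)
      obtain ⟨p, hp, hpa⟩ := h3.exists_parent (by omega)
      have hpg := hp.eq_of_level (by have := hpa.2; have := ha'.1; omega)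
      subst hpg
      exact Adj.reachable (G := (G.induce (core G d key n)).induce Xᶜ) hpa.1.symm
  have hpre : ((G.induce (core G d key n)).induce Xᶜ).Preconnected := by
    intro a b
    obtain ⟨g, hg, hgX, hs, hr⟩ := hself a
    obtain ⟨g', hg', hgX', hs', hr'⟩ := hself b
    have haX : a.1.1 ∉ X' := by rintro ⟨x, hx, hxa⟩; exact a.2 (Subtype.ext hxa ▸ hx)
    have hbX : b.1.1 ∉ X' := by rintro ⟨x, hx, hxa⟩; exact b.2 (Subtype.ext hxa ▸ hx)
    obtain ⟨N, hN, -, hNX⟩ := hconn.exists_spanPath hX' haX hbX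
    exact hr.trans ((hstep hN hNX g g' hg hg' hgX hgX' hs hs').trans hr'.symm)
  refine @Connected.mk _ _ hpre ?_
  obtain ⟨z, hz⟩ : ∃ z, z ∉ X' := by
    rcases hX'.eq_empty_or_singleton with h | ⟨y, h⟩
    · exact ⟨v₀, by simp [h]⟩
    · obtain ⟨c, hc, -⟩ := hconn.exists_ne_ne y y
      exact ⟨c, by simp [h, hc]⟩
  obtain ⟨g, -, hgX, hg⟩ := hL.exists_shadow hconn h0 hX' hz
  exact ⟨⟨⟨g, .inl hg⟩, hmem _ hgX⟩⟩

/-- The core has a Hamilton cycle. -/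
theorem exists_core_cycle (hfin : ∀ k, {x | d x = k}.Finite) {v₀ : V} (h0 : d v₀ = 0) :
    ∃ M : Multiset V, G.IsCycleMultiset M ∧ ∀ x, x ∈ M ↔ x ∈ core G d key n := by
  have hcf : (core G d key n).Finite := by
    refine ((Set.finite_Iic (n + 1)).biUnion fun k _ => hfin k).subset fun x hx => ?_
    refine Set.mem_biUnion (x := d x) ?_ rfl
    rcases hx with hx | hx
    · exact Set.mem_Iic.2 (by omega)
    · exact Set.mem_Iic.2 hx.1.le
  have := hcf.to_subtype
  obtain ⟨M, ⟨⟨a, b, hab, hba⟩, hnd, h3⟩, hM⟩ := exists_hamilton_cycle_of_finite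
    (hL.isVertexConnected_core (key := key) hconn h0) hL.claw_free_core hL.bull_core
  refine ⟨M.map Subtype.val, ⟨⟨a, b, hab.map (f := Subtype.val) fun _ _ h => h, hba⟩,
    hnd.map Subtype.val_injective, by simpa using h3⟩, fun x => ?_⟩
  simp [hM]

end IsLayered

end SimpleGraph

/-! ### Tails, their two rays, and their ends -/

namespace SimpleGraph

open Filter

theorem eventually_notMem_of_injective {V : Type*} {a : ℕ → V} (ha : Function.Injective a)
    {F : Set V} (hF : F.Finite) : ∀ᶠ i in atTop, a i ∉ F := by
  have := ha.tendsto_cofinite.eventually hF.eventually_cofinite_notMem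
  rwa [Nat.cofinite_eq_atTop] at this

/-- A ray converges to an end. -/
theorem exists_end {V : Type*} {G : SimpleGraph V} {a : ℕ → V} (ha : Function.Injective a)
    (hadj : ∀ i, G.Adj (a i) (a (i + 1))) :
    ∃ ω : G.end, ∀ S : Finset V, ∀ᶠ i in atTop, a i ∈ endComponent S ω := by
  have h1 : ∀ S : Finset V, ∃ N, ∀ i ≥ N, a i ∉ (S : Set V) := fun S =>
    eventually_atTop.1 (eventually_notMem_of_injective ha S.finite_toSet)
  choose f hf using h1
  have h2 : ∀ S : Finset V, ∀ i ≥ f S, a i ∈ G.componentComplMk (hf S (f S) le_rfl) := by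
    intro S i hi
    induction i, hi using Nat.le_induction with
    | base => exact componentComplMk_mem _ _
    | succ i hi ih => exact ComponentCompl.mem_of_adj _ _ ih (hf S _ (by omega)) (hadj i)
  refine ⟨⟨fun S => G.componentComplMk (hf S.unop (f S.unop) le_rfl), ?_⟩, fun S =>
    eventually_atTop.2 ⟨f S, h2 S⟩⟩
  intro S T hST
  have hsub : (T.unop : Set V) ⊆ S.unop := Finset.coe_subset.2 (CategoryTheory.le_of_op_hom hST)
  have h3 : ComponentCompl.hom hsub (G.componentComplMk (hf S.unop (f S.unop) le_rfl)) =
      G.componentComplMk (hf T.unop (f T.unop) le_rfl) := by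
    rw [ComponentCompl.hom_eq_iff_not_disjoint, Set.not_disjoint_iff]
    exact ⟨a (max (f S.unop) (f T.unop)), h2 _ _ (le_max_left _ _), h2 _ _ (le_max_right _ _)⟩
  exact h3

/-- A set of vertices consisting of cliques on consecutive levels which are completely joined to each
other is the vertex set of a ray. -/
theorem exists_ray {V : Type*} {G : SimpleGraph V} {d key : V → ℕ} (hkey : Function.Injective key)
    (hmono : ∀ x y, d x < d y → key x < key y) {S : Set V} {m : ℕ} (hm : ∀ x ∈ S, m ≤ d x)
    (hS : ∀ k, m ≤ k → ∃ x ∈ S, d x = k)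
    (h1 : ∀ x ∈ S, ∀ y ∈ S, d x = d y → x ≠ y → G.Adj x y)
    (h2 : ∀ x ∈ S, ∀ y ∈ S, d y = d x + 1 → G.Adj x y) :
    ∃ a : ℕ → V, Function.Injective a ∧ Set.range a = S ∧ (∀ i, G.Adj (a i) (a (i + 1))) ∧
      d (a 0) = m := by
  classical
  have hinf : S.Infinite := by
    intro hfin
    have hb := (hfin.image d).bddAbove
    obtain ⟨B, hB⟩ := hb
    obtain ⟨x, hx, hdx⟩ := hS (max m (B + 1)) (le_max_left _ _)
    have := hB ⟨x, hx, rfl⟩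
    have := le_max_right m (B + 1)
    omega
  have hKinf : Infinite (key '' S) := (hinf.image hkey.injOn).to_subtype
  -- Listed by increasing key, `S` is exhausted level by level, so consecutive vertices lie on the
  -- same or on consecutive levels.
  let e : ℕ ≃o (key '' S) := Nat.Subtype.orderIsoOfNat (key '' S)
  have hsel : ∀ i, ∃ x ∈ S, key x = e i := fun i => (e i).2
  choose a haS hak using hsel
  have hlt : ∀ {i j}, key (a i) < key (a j) ↔ i < j := by
    intro i j
    rw [hak, hak, Subtype.coe_lt_coe, e.lt_iff_lt]
  have hsurj : ∀ x ∈ S, ∃ i, a i = x := by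
    intro x hx
    obtain ⟨i, hi⟩ := e.surjective ⟨key x, x, hx, rfl⟩
    refine ⟨i, hkey ?_⟩
    rw [hak, hi]
  have hdmono : ∀ {i j}, i ≤ j → d (a i) ≤ d (a j) := by
    intro i j hij
    by_contra h
    have := hlt.1 (hmono _ _ (not_le.1 h))
    omega
  have hinj : Function.Injective a := by
    intro i j hij
    by_contra hne
    rcases lt_or_gt_of_ne hne with h | h
    · exact absurd (hlt.2 h) (by rw [hij]; exact lt_irrefl _)
    · exact absurd (hlt.2 h) (by rw [hij]; exact lt_irrefl _)
  refine ⟨a, hinj, Set.Subset.antisymm (Set.range_subset_iff.2 haS) hsurj, fun i => ?_, ?_⟩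
  · have hle := hdmono (Nat.le_succ i)
    have hle2 : d (a (i + 1)) ≤ d (a i) + 1 := by
      by_contra hcon
      obtain ⟨x, hx, hdx⟩ := hS (d (a i) + 1) (by have := hm _ (haS i); omega)
      obtain ⟨j, rfl⟩ := hsurj x hx
      have l1 := hlt.1 (hmono (a i) (a j) (by omega))
      have l2 := hlt.1 (hmono (a j) (a (i + 1)) (by omega))
      omega
    by_cases h : d (a (i + 1)) = d (a i)
    · exact h1 _ (haS _) _ (haS _) h.symm (hinj.ne (by omega))
    · exact h2 _ (haS _) _ (haS _) (by simp only [Nat.succ_eq_add_one] at hle; omega)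
  · obtain ⟨x, hx, hdx⟩ := hS m le_rfl
    obtain ⟨j, rfl⟩ := hsurj x hx
    have := hdmono (Nat.zero_le j)
    have := hm _ (haS 0)
    omega

variable {V : Type*} {G : SimpleGraph V} {d key : V → ℕ} {n : ℕ}

/-- The vertices above level `n` with a common ancestor with `τ` on level `n`. -/
def tail (G : SimpleGraph V) (d : V → ℕ) (n : ℕ) (τ : V) : Set V :=
  {z | n < d z ∧ ∃ q, d q = n ∧ G.IsDescendant d q τ ∧ G.IsDescendant d q z}

/-- `α` and `β` are disjoint rays in the end `ω` which cover the tail of `τ`. -/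
structure TailRays (G : SimpleGraph V) (d : V → ℕ) (n : ℕ) (τ : V) (ω : G.end) (α β : ℕ → V) :
    Prop where
  inj_left : Function.Injective α
  inj_right : Function.Injective β
  adj_left : ∀ i, G.Adj (α i) (α (i + 1))
  adj_right : ∀ i, G.Adj (β i) (β (i + 1))
  disj : ∀ i j, α i ≠ β j
  start_left : ∀ p, d p = n → G.Adj p τ → G.Adj p (α 0)
  start_right : ∀ p, d p = n → G.Adj p τ → G.Adj p (β 0)
  mem_tail : ∀ z, z ∈ G.tail d n τ ↔ (∃ i, α i = z) ∨ ∃ i, β i = z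
  end_left : ∀ S : Finset V, ∀ᶠ i in atTop, α i ∈ endComponent S ω
  end_right : ∀ S : Finset V, ∀ᶠ i in atTop, β i ∈ endComponent S ω

namespace IsLayered

variable (hL : G.IsLayered d n)

include hL

/-- All ancestors of `τ` on level `n` are pairwise adjacent and share their proper descendants, so
any one of them determines the tail. -/
theorem mem_tail_iff {τ q z : V} (hq : d q = n) (hqτ : G.IsDescendant d q τ) :
    z ∈ G.tail d n τ ↔ n < d z ∧ G.IsDescendant d q z := by
  refine ⟨fun ⟨h, q', hq', h1, h2⟩ => ⟨h, ?_⟩, fun ⟨h, h1⟩ => ⟨h, q, hq, hqτ, h1⟩⟩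
  rcases hL.ancestors_adj hq.ge (by omega) hqτ h1 with rfl | hadj
  · exact h2
  · exact hL.descendant_of_adj_left hq'.ge hadj.symm (by omega) h2 (by omega)

theorem tail_unique {τ τ' z : V} (hτ : G.IsRep d key n τ) (hτ' : G.IsRep d key n τ')
    (hz : z ∈ G.tail d n τ) (hz' : z ∈ G.tail d n τ') : τ = τ' := by
  obtain ⟨hzn, q, hq, hqτ, hqz⟩ := hz
  obtain ⟨-, q', hq', hqτ', hqz'⟩ := hz'
  refine hL.rep_unique hτ hτ' hq.ge hqτ ?_
  rcases hL.ancestors_adj hq.ge (by omega) hqz hqz' with rfl | hadj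
  · exact hqτ'
  · exact hL.descendant_of_adj_left hq'.ge hadj.symm (by omega) hqτ' (by have := hτ'.1; omega)

theorem exists_tail (hkey : Function.Injective key) {z : V} (hz : n < d z) :
    ∃ τ, G.IsRep d key n τ ∧ z ∈ G.tail d n τ := by
  obtain ⟨q, hq, hqz⟩ := hL.level.exists_ancestor hz.le
  obtain ⟨y, hqy, hy⟩ := hL.exists_descendant hq.ge (k := n + 1) (by omega)
  obtain ⟨τ, hτ, hτy⟩ := hL.exists_rep hkey hy
  refine ⟨τ, hτ, hz, q, hq, ?_, hqz⟩
  rcases hτy with rfl | hadj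
  · exact hqy
  · exact hL.descendant_of_adj hq.ge hqy (by omega) hadj.symm (by have := hτ.1; omega)

/-- The ray `α` takes the vertex of least key on each level of the tail and `β` takes the rest,
which is nonempty by `exists_adj_same`. Each vertex of `β` is adjacent to a vertex of `α` on its
level, so both rays converge to the same end. -/
theorem exists_tailRays (hconn : G.IsVertexConnected 2) {v₀ : V} (h0 : d v₀ = 0)
    (hfin : ∀ k, {x | d x = k}.Finite)
    (hkey : Function.Injective key) (hmono : ∀ x y, d x < d y → key x < key y) {τ : V}
    (hτ : G.IsRep d key n τ) : ∃ ω α β, G.TailRays d n τ ω α β := by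
  classical
  have hτn := hτ.1
  obtain ⟨q, hq, hqτ⟩ := hL.level.exists_ancestor (k := n) (z := τ) (by omega)
  have htail : ∀ z, z ∈ G.tail d n τ ↔ n < d z ∧ G.IsDescendant d q z := fun z =>
    hL.mem_tail_iff hq hqτ
  have hadj1 : ∀ x ∈ G.tail d n τ, ∀ y ∈ G.tail d n τ, d x = d y → x ≠ y → G.Adj x y :=
    fun x hx y hy hxy hne => (hL.descendants_adj hq.ge ((htail x).1 hx).2 ((htail y).1 hy).2
      hxy).resolve_left hne
  have hadj2 : ∀ x ∈ G.tail d n τ, ∀ y ∈ G.tail d n τ, d y = d x + 1 → G.Adj x y :=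
    fun x hx y hy hxy => hL.descendants_adj_succ hq.ge ((htail x).1 hx).2 ((htail y).1 hy).2 hxy
  have hlev : ∀ k, n + 1 ≤ k → ∃ x ∈ G.tail d n τ, d x = k := by
    intro k hk
    obtain ⟨z, hz, hdz⟩ := hL.exists_descendant hq.ge (k := k) (by omega)
    exact ⟨z, (htail z).2 ⟨by omega, hz⟩, hdz⟩
  set A : Set V := {z ∈ G.tail d n τ | ∀ z' ∈ G.tail d n τ, d z' = d z → key z ≤ key z'} with hA
  have hAlev : ∀ k, n + 1 ≤ k → ∃ x ∈ A, d x = k := by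
    intro k hk
    have hne : ∃ j z, key z = j ∧ z ∈ G.tail d n τ ∧ d z = k := by
      obtain ⟨z, hz, hdz⟩ := hlev k hk
      exact ⟨key z, z, rfl, hz, hdz⟩
    obtain ⟨z, hzj, hz, hdz⟩ := Nat.find_spec hne
    refine ⟨z, ⟨hz, fun z' hz' hdz' => ?_⟩, hdz⟩
    rw [hzj]
    exact Nat.find_min' hne ⟨z', rfl, hz', hdz'.trans hdz⟩
  have hBlev : ∀ k, n + 1 ≤ k → ∃ x ∈ G.tail d n τ \ A, d x = k := by
    intro k hk
    obtain ⟨y, hy, hdy⟩ := hlev k hk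
    obtain ⟨y', hyy, hdy'⟩ := hL.exists_adj_same hconn (y := y) h0 (by omega)
    have hy' : y' ∈ G.tail d n τ := (htail y').2 ⟨by omega,
      hL.descendant_of_adj hq.ge ((htail y).1 hy).2 (by omega) hyy (by omega)⟩
    by_cases hyA : y ∈ A
    · refine ⟨y', ⟨hy', fun hyA' => hyy.ne (hkey ?_)⟩, by omega⟩
      exact le_antisymm (hyA.2 y' hy' hdy') (hyA'.2 y hy hdy'.symm)
    · exact ⟨y, ⟨hy, hyA⟩, hdy⟩
  obtain ⟨α, hα, hαr, hαadj, hα0⟩ := exists_ray (G := G) hkey hmono (S := A) (m := n + 1)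
    (fun x hx => hx.1.1) hAlev (fun x hx y hy => hadj1 x hx.1 y hy.1)
    (fun x hx y hy => hadj2 x hx.1 y hy.1)
  obtain ⟨β, hβ, hβr, hβadj, hβ0⟩ := exists_ray (G := G) hkey hmono (S := G.tail d n τ \ A)
    (m := n + 1) (fun x hx => hx.1.1) hBlev (fun x hx y hy => hadj1 x hx.1 y hy.1)
    (fun x hx y hy => hadj2 x hx.1 y hy.1)
  have hαA : ∀ i, α i ∈ A := fun i => hαr ▸ Set.mem_range_self i
  have hβB : ∀ i, β i ∈ G.tail d n τ \ A := fun i => hβr ▸ Set.mem_range_self i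
  have hstart : ∀ x ∈ G.tail d n τ, d x = n + 1 → ∀ p, d p = n → G.Adj p τ → G.Adj p x := by
    intro x hx hdx p hp hpτ
    have h1 := (hL.mem_tail_iff hp (.single ⟨hpτ, by omega⟩)).1 hx
    exact hL.descendants_adj_succ hp.ge .refl h1.2 (by omega)
  obtain ⟨ω, hω⟩ := exists_end hα hαadj
  refine ⟨ω, α, β, hα, hβ, hαadj, hβadj, fun i j h => (hβB j).2 (h ▸ hαA i),
    hstart _ (hαA 0).1 hα0, hstart _ (hβB 0).1 hβ0, fun z => ?_, hω, fun S => ?_⟩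
  · constructor
    · intro hz
      by_cases hzA : z ∈ A
      · rw [← hαr] at hzA; exact .inl hzA
      · have : z ∈ Set.range β := by rw [hβr]; exact ⟨hz, hzA⟩
        exact .inr this
    · rintro (⟨i, rfl⟩ | ⟨i, rfl⟩)
      · exact (hαA i).1
      · exact (hβB i).1
  · obtain ⟨i₀, hi₀⟩ := eventually_atTop.1 (hω S)
    -- From level `K` on, `α` has entered the component of the end and no vertex of `S` is left.
    set K := max ((Finset.range i₀).sup fun i => d (α i) + 1) (S.sup fun v => d v + 1) with hK
    have hlow : {x | d x < K}.Finite :=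
      ((Set.finite_Iio K).biUnion fun k _ => hfin k).subset fun x hx =>
        Set.mem_biUnion (x := d x) (Set.mem_Iio.2 hx) rfl
    filter_upwards [eventually_notMem_of_injective hβ hlow] with j hj
    have hjK : K ≤ d (β j) := not_lt.1 hj
    obtain ⟨x, hx, hdx⟩ := hAlev (d (β j)) (hβB j).1.1
    rw [← hαr] at hx
    obtain ⟨i, rfl⟩ := hx
    have hi : i₀ ≤ i := by
      by_contra h
      have h1 := Finset.le_sup (f := fun i => d (α i) + 1) (Finset.mem_range.2 (not_le.1 h))
      have h2 := h1.trans (le_max_left _ (S.sup fun v => d v + 1))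
      omega
    refine ComponentCompl.mem_of_adj (α i) (β j) (hi₀ i hi) (fun hS => ?_)
      (hadj1 _ (hαA i).1 _ (hβB j).1 hdx fun h => (hβB j).2 (h ▸ hαA i))
    have h1 := Finset.le_sup (f := fun v => d v + 1) (Finset.mem_coe.1 hS)
    have h2 := h1.trans (le_max_right ((Finset.range i₀).sup fun i => d (α i) + 1) _)
    omega

/-- Deleting the finitely many vertices up to level `n` separates the tails: a walk above level `n`
stays among the descendants of one vertex of level `n`. -/
theorem end_unique (hfin : ∀ k, {x | d x = k}.Finite) {τ τ' : V} {ω : G.end} {α β α' β' : ℕ → V}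
    (hτ : G.IsRep d key n τ) (hτ' : G.IsRep d key n τ')
    (h : G.TailRays d n τ ω α β) (h' : G.TailRays d n τ' ω α' β') : τ = τ' := by
  have hlow : {x | d x ≤ n}.Finite :=
    ((Set.finite_Iic n).biUnion fun k _ => hfin k).subset fun x hx =>
      Set.mem_biUnion (x := d x) (Set.mem_Iic.2 hx) rfl
  obtain ⟨i, hi, hi'⟩ := ((h.end_left hlow.toFinset).and (h'.end_left hlow.toFinset)).exists
  have hα : α i ∈ G.tail d n τ := (h.mem_tail _).2 (.inl ⟨i, rfl⟩)
  have hα' : α' i ∈ G.tail d n τ' := (h'.mem_tail _).2 (.inl ⟨i, rfl⟩)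
  refine hL.tail_unique hτ hτ' (z := α' i) ?_ hα'
  obtain ⟨h1, e1⟩ := hi
  obtain ⟨h2, e2⟩ := hi'
  obtain ⟨p⟩ := ConnectedComponent.exact (e1.trans e2.symm)
  obtain ⟨-, q, hq, hqτ, hqα⟩ := hα
  have hm := (Walk.spanPath p).all_of_invariant
    (P := fun x => G.IsDescendant d q x.1) (fun x y hxy => ?_) ⟨α' i, h2⟩
      (Walk.spanPath p).right_mem
  · exact ⟨hα'.1, q, hq, hqτ, hm.2 hqα⟩
  · have hx : n < d x.1 := by
      by_contra hx; exact x.2 (by simpa using not_lt.1 hx)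
    have hy : n < d y.1 := by
      by_contra hy; exact y.2 (by simpa using not_lt.1 hy)
    exact ⟨fun hqx => hL.descendant_of_adj hq.ge hqx (by omega) hxy (by omega),
      fun hqy => hL.descendant_of_adj hq.ge hqy (by omega) (show G.Adj x.1 y.1 from hxy).symm (by omega)⟩

end IsLayered

end SimpleGraph

/-! ### Topology of the compactification: Hausdorffness, edges and rays as arcs -/

namespace SimpleGraph

open Filter Topology

namespace Freudenthal

universe u

variable {V : Type u} {G : SimpleGraph V}

theorem exists_eq_smul_single [DecidableEq V] (ξ : G.realization) :
    ∃ u v : V, (u = v ∨ G.Adj u v) ∧ ∃ s t : ℝ, 0 ≤ s ∧ 0 ≤ t ∧ s + t = 1 ∧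
      ∀ w, ξ.1 w = (if w = u then s else 0) + if w = v then t else 0 := by
  classical
  obtain ⟨ξ, u, v, huv, s, t, hs, ht, hst, rfl⟩ := ξ
  refine ⟨u, v, huv, s, t, hs, ht, hst, fun w => ?_⟩
  simp [Pi.single_apply]

theorem eq_or_adj_of_pos (ξ : G.realization) {v w : V} (hv : 0 < ξ.1 v) (hw : 0 < ξ.1 w) :
    v = w ∨ G.Adj v w := by
  classical
  obtain ⟨a, b, hab, s, t, hs, ht, hst, h⟩ := exists_eq_smul_single ξ
  have key : ∀ x, 0 < ξ.1 x → x = a ∨ x = b := by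
    intro x hx
    by_contra hcon
    rw [not_or] at hcon
    rw [h, if_neg hcon.1, if_neg hcon.2] at hx
    simp at hx
  rcases key v hv with rfl | rfl <;> rcases key w hw with rfl | rfl
  · exact .inl rfl
  · exact hab
  · exact hab.imp Eq.symm Adj.symm
  · exact .inl rfl

theorem sum_eq_one (ξ : G.realization) {S : Finset V} (hS : ∀ v, 0 < ξ.1 v → v ∈ S) :
    ∑ v ∈ S, ξ.1 v = 1 := by
  classical
  obtain ⟨a, b, hab, s, t, hs, ht, hst, h⟩ := exists_eq_smul_single ξ
  have ha : (if a ∈ S then s else 0) = s := by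
    split_ifs with haS
    · rfl
    · have h1 : ξ.1 a ≤ 0 := not_lt.1 fun h => haS (hS a h)
      rw [h, if_pos rfl] at h1
      split_ifs at h1 <;> linarith
  have hb : (if b ∈ S then t else 0) = t := by
    split_ifs with hbS
    · rfl
    · have h1 : ξ.1 b ≤ 0 := not_lt.1 fun h => hbS (hS b h)
      rw [h, if_pos rfl] at h1
      split_ifs at h1 <;> linarith
  simp only [h, Finset.sum_add_distrib, Finset.sum_ite_eq']
  rw [ha, hb, hst]

theorem continuous_coord (v : V) : Continuous fun ξ : G.realization => ξ.1 v :=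
  (continuous_apply v).comp continuous_subtype_val

theorem isOpen_iff {U : Set (Freudenthal G)} :
    IsOpen U ↔ IsOpen {x : G.realization | point x ∈ U} ∧
      ∀ ω : G.end, ofEnd ω ∈ U → ∃ S : Finset V, ∃ ε : ℝ, 0 < ε ∧ endNhd S ε ω ⊆ U :=
  Iff.rfl

theorem continuous_point : Continuous (point : G.realization → Freudenthal G) :=
  ⟨fun _ hU => (isOpen_iff.1 hU).1⟩

theorem isOpen_image_point {U : Set G.realization} (hU : IsOpen U) :
    IsOpen (point '' U : Set (Freudenthal G)) := by
  refine isOpen_iff.2 ⟨?_, ?_⟩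
  · convert hU using 1
    ext x
    simp
  · rintro ω ⟨x, -, hx⟩
    cases hx

theorem isOpen_endNhd (S : Finset V) {ε : ℝ} (hε : 0 < ε) (ω : G.end) :
    IsOpen (endNhd S ε ω) := by
  refine isOpen_iff.2 ⟨?_, fun ω' hω' => ⟨S, ε, hε, fun p hp => ?_⟩⟩
  · have h1 : {x : G.realization | point x ∈ endNhd S ε ω} =
        (⋃ v ∈ (endComponent S ω : Set V), {x : G.realization | 0 < x.1 v}) ∩
          {x : G.realization | ∑ v ∈ S, x.1 v < ε} := by
      ext x
      simp [endNhd]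
    rw [h1]
    exact (isOpen_biUnion fun v _ => isOpen_lt continuous_const (continuous_coord v)).inter
      (isOpen_lt (continuous_finsetSum _ fun v _ => continuous_coord v) continuous_const)
  · have h1 : endComponent S ω' = endComponent S ω := hω'
    cases p with
    | point x =>
      obtain ⟨⟨v, hv, hx⟩, hs⟩ := hp
      exact ⟨⟨v, h1 ▸ hv, hx⟩, hs⟩
    | ofEnd ω'' =>
      have h2 : endComponent S ω'' = endComponent S ω' := hp
      exact h2.trans h1

theorem exists_separation_point_end (ξ : G.realization) (ω : G.end) :
    ∃ U W : Set (Freudenthal G), IsOpen U ∧ IsOpen W ∧ point ξ ∈ U ∧ ofEnd ω ∈ W ∧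
      Disjoint U W := by
  classical
  obtain ⟨a, b, -, s, t, -, -, -, h⟩ := exists_eq_smul_single ξ
  refine ⟨point '' {x : G.realization | 1 / 2 < ∑ v ∈ {a, b}, x.1 v}, endNhd {a, b} (1 / 2) ω,
    isOpen_image_point
      (isOpen_lt continuous_const (continuous_finsetSum _ fun v _ => continuous_coord v)),
    isOpen_endNhd _ (by norm_num) ω, ⟨ξ, ?_, rfl⟩, rfl, ?_⟩
  · have h1 : ∑ v ∈ {a, b}, ξ.1 v = 1 := by
      refine sum_eq_one ξ fun v hv => ?_
      by_contra hcon
      rw [Finset.mem_insert, Finset.mem_singleton, not_or] at hcon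
      rw [h, if_neg hcon.1, if_neg hcon.2] at hv
      simp at hv
    rw [Set.mem_ofPred_eq, h1]
    norm_num
  · rw [Set.disjoint_left]
    rintro _ ⟨x, hx, rfl⟩ ⟨-, hx'⟩
    exact lt_asymm hx hx'

/-- Needed so that a continuous injection of the compact circle is an embedding. -/
instance : T2Space (Freudenthal G) where
  t2 := by
    rintro (x | ω) (y | ω') hne
    · have hxy : x ≠ y := fun h => hne (h ▸ rfl)
      obtain ⟨U, W, hU, hW, hx, hy, hUW⟩ := t2_separation hxy
      refine ⟨point '' U, point '' W, isOpen_image_point hU, isOpen_image_point hW, ⟨x, hx, rfl⟩,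
        ⟨y, hy, rfl⟩, ?_⟩
      rw [Set.disjoint_left]
      rintro _ ⟨z, hz, rfl⟩ ⟨z', hz', h⟩
      cases h
      exact Set.disjoint_left.1 hUW hz hz'
    · exact exists_separation_point_end x ω'
    · obtain ⟨U, W, hU, hW, hy, hω, hUW⟩ := exists_separation_point_end y ω
      exact ⟨W, U, hW, hU, hω, hy, hUW.symm⟩
    · have h1 : ∃ S : Finset V, endComponent S ω ≠ endComponent S ω' := by
        by_contra! hcon
        exact hne (congrArg ofEnd (Subtype.ext (funext fun S => hcon S.unop)))
      obtain ⟨S, hS⟩ := h1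
      refine ⟨endNhd S 1 ω, endNhd S 1 ω', isOpen_endNhd S one_pos ω, isOpen_endNhd S one_pos ω',
        rfl, rfl, ?_⟩
      rw [Set.disjoint_left]
      rintro (x | ω'') hp hp'
      · obtain ⟨⟨v, hv, hxv⟩, -⟩ := hp
        obtain ⟨⟨w, hw, hxw⟩, -⟩ := hp'
        have hw' : w ∈ endComponent S ω := by
          rcases eq_or_adj_of_pos x hxv hxw with rfl | hadj
          · exact hv
          · exact ComponentCompl.mem_of_adj v w hv (ComponentCompl.notMem_of_mem hw) hadj
        exact Set.disjoint_left.1 (ComponentCompl.pairwise_disjoint hS) hw' hw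
      · have h2 : endComponent S ω'' = endComponent S ω := hp
        have h3 : endComponent S ω'' = endComponent S ω' := hp'
        exact hS (h2.symm.trans h3)

/-- The points of the 1-complex with support in `E`. -/
def On (G : SimpleGraph V) (E : Set V) : Set (Freudenthal G) :=
  {p | ∃ ξ : G.realization, point ξ = p ∧ ∀ v, 0 < ξ.1 v → v ∈ E}

theorem point_mem_on {ξ : G.realization} {E : Set V} :
    point ξ ∈ On G E ↔ ∀ v, 0 < ξ.1 v → v ∈ E := by
  simp [On]

theorem ofEnd_notMem_on (ω : G.end) (E : Set V) : ofEnd ω ∉ On G E := by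
  simp [On]

/-- This reduces intersections of edges and rays to intersections of vertex sets. -/
theorem on_inter {E F : Set V} {p : Freudenthal G} (hE : p ∈ On G E) (hF : p ∈ On G F) :
    p ∈ On G (E ∩ F) := by
  obtain ⟨ξ, rfl, h⟩ := hE
  exact ⟨ξ, rfl, fun v hv => ⟨h v hv, point_mem_on.1 hF v hv⟩⟩

theorem on_mono {E F : Set V} (h : E ⊆ F) : On G E ⊆ On G F := by
  rintro _ ⟨ξ, rfl, h'⟩
  exact ⟨ξ, rfl, fun v hv => h (h' v hv)⟩

theorem notMem_on_empty (p : Freudenthal G) : p ∉ On G ∅ := by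
  rintro ⟨ξ, -, h⟩
  have := sum_eq_one ξ (S := ∅) fun v hv => absurd (h v hv) (Set.notMem_empty v)
  simp at this

theorem eq_of_coord_eq {x y : V} (hxy : x ≠ y) {ξ η : G.realization}
    (hξ : ∀ v, 0 < ξ.1 v → v ∈ ({x, y} : Set V)) (hη : ∀ v, 0 < η.1 v → v ∈ ({x, y} : Set V))
    (h : ξ.1 y = η.1 y) : ξ = η := by
  classical
  have h1 := sum_eq_one ξ (S := {x, y}) fun v hv => by simpa using hξ v hv
  have h2 := sum_eq_one η (S := {x, y}) fun v hv => by simpa using hη v hv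
  rw [Finset.sum_pair hxy] at h1 h2
  refine Subtype.ext (funext fun v => ?_)
  by_cases hvy : v = y
  · rw [hvy, h]
  by_cases hvx : v = x
  · rw [hvx]; linarith
  · have h3 : ¬ 0 < ξ.1 v := fun h => by simpa [hvx, hvy] using hξ v h
    have h4 : ¬ 0 < η.1 v := fun h => by simpa [hvx, hvy] using hη v h
    exact (le_antisymm (not_lt.1 h3) (realization_nonneg ξ v)).trans
      (le_antisymm (not_lt.1 h4) (realization_nonneg η v)).symm

theorem eq_vertex_of_mem_on {x : V} {p : Freudenthal G} (hp : p ∈ On G {x}) : p = vertex x := by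
  classical
  obtain ⟨ξ, rfl, h⟩ := hp
  have h1 := sum_eq_one ξ (S := {x}) fun v hv => by simpa using h v hv
  rw [Finset.sum_singleton] at h1
  refine congrArg point (Subtype.ext (funext fun v => ?_))
  by_cases hv : v = x
  · subst hv
    simp [realizationVertex, h1]
  · have h3 : ¬ 0 < ξ.1 v := fun h' => hv (h v h')
    rw [le_antisymm (not_lt.1 h3) (realization_nonneg ξ v)]
    simp [realizationVertex, hv]

theorem vertex_mem_on {x : V} {E : Set V} (hx : x ∈ E) : vertex x ∈ On G E := by
  classical
  refine ⟨_, rfl, fun v hv => ?_⟩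
  by_cases h : v = x
  · exact h ▸ hx
  · simp [realizationVertex, h] at hv

/-- An arc from `a` to `b` whose set of points is `S`. -/
def IsArc {X : Type*} [TopologicalSpace X] (a b : X) (S : Set X) : Prop :=
  ∃ γ : _root_.Path a b, Function.Injective γ ∧ Set.range γ = S

section ray

variable {a : ℕ → V}

/-- The point at distance `u` from the first vertex on the ray `a`. -/
noncomputable def rayCoord (a : ℕ → V) (u : ℝ) : V → ℝ :=
  Function.extend a (fun j => max 0 (1 - |u - j|)) 0

theorem rayCoord_apply (ha : Function.Injective a) (u : ℝ) (j : ℕ) :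
    rayCoord a u (a j) = max 0 (1 - |u - j|) :=
  ha.extend_apply _ _ _

theorem rayCoord_pos (ha : Function.Injective a) {u : ℝ} {v : V} (hv : 0 < rayCoord a u v) :
    ∃ j : ℕ, a j = v ∧ |u - j| < 1 := by
  by_cases h : ∃ j, a j = v
  · obtain ⟨j, rfl⟩ := h
    rw [rayCoord_apply ha, lt_max_iff] at hv
    exact ⟨j, rfl, by rcases hv with h | h <;> linarith⟩
  · rw [rayCoord, Function.extend_apply' _ _ _ h] at hv
    exact absurd hv (lt_irrefl _)

theorem rayCoord_mem (ha : Function.Injective a) (hadj : ∀ i, G.Adj (a i) (a (i + 1))) {u : ℝ}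
    (hu : 0 ≤ u) : rayCoord a u ∈ G.realization := by
  classical
  set i := ⌊u⌋₊ with hi
  have h1 : (i : ℝ) ≤ u := Nat.floor_le hu
  have h2 : u < i + 1 := Nat.lt_floor_add_one u
  refine ⟨a i, a (i + 1), .inr (hadj i), 1 - (u - i), u - i, by linarith, by linarith, by ring, ?_⟩
  funext v
  simp only [Pi.add_apply, Pi.smul_apply, Pi.single_apply, smul_eq_mul, mul_ite, mul_one, mul_zero]
  by_cases h : ∃ j, a j = v
  · obtain ⟨j, rfl⟩ := h
    rw [rayCoord_apply ha]
    simp only [ha.eq_iff]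
    rcases lt_trichotomy j i with hj | hj | hj
    · have h3 : (j : ℝ) + 1 ≤ i := by exact_mod_cast hj
      rw [if_neg (by omega), if_neg (by omega), abs_of_nonneg (by linarith),
        max_eq_left (by linarith), add_zero]
    · subst hj
      rw [if_pos rfl, if_neg (by omega), abs_of_nonneg (by linarith),
        max_eq_right (by linarith), add_zero]
    · rw [if_neg (by omega)]
      rcases Nat.lt_or_ge (i + 1) j with hj' | hj'
      · have h3 : (i : ℝ) + 1 + 1 ≤ j := by exact_mod_cast hj'
        rw [if_neg (by omega), abs_of_nonpos (by linarith), max_eq_left (by linarith), add_zero]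
      · obtain rfl : j = i + 1 := by omega
        rw [if_pos rfl]
        push_cast
        rw [abs_of_nonpos (by linarith), max_eq_right (by linarith)]
        ring
  · rw [rayCoord, Function.extend_apply' _ _ _ h, if_neg fun h' => h ⟨_, h'.symm⟩,
      if_neg fun h' => h ⟨_, h'.symm⟩]
    simp

theorem rayCoord_continuous (ha : Function.Injective a) : Continuous (rayCoord a) := by
  refine continuous_pi fun v => ?_
  by_cases h : ∃ j, a j = v
  · obtain ⟨j, rfl⟩ := h
    simp only [rayCoord_apply ha]
    fun_prop
  · simp only [rayCoord, Function.extend_apply' _ _ _ h]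
    exact continuous_const

theorem rayCoord_injOn (ha : Function.Injective a) : Set.InjOn (rayCoord a) (Set.Ici 0) := by
  have key : ∀ u v : ℝ, 0 ≤ u → u < v → rayCoord a u ≠ rayCoord a v := by
    intro u v hu huv h
    have h1 : ((⌊u⌋₊ : ℕ) : ℝ) ≤ u := Nat.floor_le hu
    have h2 : u < ⌊u⌋₊ + 1 := Nat.lt_floor_add_one u
    have h3 := congrFun h (a ⌊u⌋₊)
    rw [rayCoord_apply ha, rayCoord_apply ha, abs_of_nonneg (by linarith),
      abs_of_nonneg (by linarith), max_eq_right (by linarith)] at h3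
    rcases max_choice 0 (1 - (v - ⌊u⌋₊)) with h4 | h4 <;> rw [h4] at h3 <;> linarith
  intro u hu v hv h
  rcases lt_trichotomy u v with h1 | h1 | h1
  · exact absurd h (key u v hu h1)
  · exact h1
  · exact absurd h.symm (key v u hv h1)

theorem rayCoord_support (ha : Function.Injective a) {u : ℝ} {i : ℕ} (h1 : i ≤ u)
    (h2 : u ≤ i + 1) {v : V} (hv : 0 < rayCoord a u v) : v ∈ ({a i, a (i + 1)} : Set V) := by
  obtain ⟨j, rfl, hj⟩ := rayCoord_pos ha hv
  rw [abs_lt] at hj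
  have h3 : (j : ℝ) < (i + 2 : ℕ) := by push_cast; linarith
  have h4 : (i : ℝ) < (j + 1 : ℕ) := by push_cast; linarith
  have h5 : j < i + 2 := by exact_mod_cast h3
  have h6 : i < j + 1 := by exact_mod_cast h4
  rcases Nat.lt_or_ge i j with h | h
  · obtain rfl : j = i + 1 := by omega
    simp
  · obtain rfl : j = i := by omega
    simp

variable (ha : Function.Injective a) (hadj : ∀ i, G.Adj (a i) (a (i + 1)))

include ha hadj

/-- A ray together with its end is an arc. -/
theorem isArc_ray {ω : G.end} (hω : ∀ S : Finset V, ∀ᶠ i in atTop, a i ∈ endComponent S ω) :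
    IsArc (vertex (a 0)) (ofEnd ω) ((⋃ i, On G {a i, a (i + 1)}) ∪ {ofEnd ω}) := by
  classical
  have hu : ∀ t : unitInterval, 0 ≤ t.1 / (1 - t.1) := fun t =>
    div_nonneg t.2.1 (by linarith [t.2.2])
  let f : unitInterval → G.realization := fun t =>
    ⟨rayCoord a (t.1 / (1 - t.1)), rayCoord_mem ha hadj (hu t)⟩
  -- The map `t / (1 - t)` takes `[0, 1)` onto `[0, ∞)`; its junk value at 1 is overridden by the
  -- end.
  let g : unitInterval → Freudenthal G := fun t => if t = 1 then ofEnd ω else point (f t)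
  have hlt : ∀ t : unitInterval, t ≠ 1 → t.1 < 1 := fun t ht =>
    lt_of_le_of_ne t.2.2 fun h => ht (Subtype.ext h)
  have hcont : Continuous g := by
    refine continuous_iff_continuousAt.2 fun t => ?_
    by_cases ht : t = 1
    · subst ht
      have hg1 : g 1 = ofEnd ω := if_pos rfl
      rw [ContinuousAt, hg1, tendsto_nhds]
      intro U hU hωU
      obtain ⟨S, ε, hε, hS⟩ := (isOpen_iff.1 hU).2 ω hωU
      obtain ⟨N, hN⟩ := eventually_atTop.1 (hω S)
      have hN0 : (0 : ℝ) ≤ N := Nat.cast_nonneg N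
      -- This bound gives `t / (1 - t) ≥ N + 1`, so only vertices of index above `N` carry weight.
      have hev : ∀ᶠ t : unitInterval in 𝓝 1, 1 - 1 / ((N : ℝ) + 2) < t.1 := by
        refine (isOpen_lt continuous_const continuous_subtype_val).mem_nhds ?_
        have : (0 : ℝ) < 1 / ((N : ℝ) + 2) := by positivity
        change 1 - 1 / ((N : ℝ) + 2) < 1
        linarith
      filter_upwards [hev] with t ht
      by_cases ht1 : t = 1
      · change g t ∈ U
        rw [ht1, hg1]; exact hωU
      refine hS ?_
      have hgt : g t = point (f t) := if_neg ht1
      rw [hgt]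
      have ht1' := hlt t ht1
      have huN : (N : ℝ) + 1 ≤ t.1 / (1 - t.1) := by
        rw [le_div_iff₀ (by linarith)]
        have h3 : 1 - t.1 < 1 / ((N : ℝ) + 2) := by linarith
        rw [lt_div_iff₀ (by linarith)] at h3
        linarith
      set u := t.1 / (1 - t.1) with hu_def
      have hmem : ∀ v, 0 < rayCoord a u v → v ∈ endComponent S ω := by
        intro v hv
        obtain ⟨j, rfl, hj⟩ := rayCoord_pos ha hv
        rw [abs_lt] at hj
        have : (N : ℝ) < j := by linarith
        exact hN j (by exact_mod_cast this.le)
      refine ⟨?_, ?_⟩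
      · have h1 : ((⌊u⌋₊ : ℕ) : ℝ) ≤ u := Nat.floor_le (hu t)
        have h2 : u < ⌊u⌋₊ + 1 := Nat.lt_floor_add_one u
        have h3 : 0 < rayCoord a u (a ⌊u⌋₊) := by
          rw [rayCoord_apply ha, abs_of_nonneg (by linarith), max_eq_right (by linarith)]
          linarith
        exact ⟨_, hmem _ h3, h3⟩
      · have h4 : ∑ v ∈ S, (f t).1 v = 0 := by
          refine Finset.sum_eq_zero fun v hv => ?_
          have h5 : ¬ 0 < rayCoord a u v := fun h =>
            ComponentCompl.notMem_of_mem (hmem v h) (Finset.mem_coe.2 hv)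
          exact le_antisymm (not_lt.1 h5) (realization_nonneg (f t) v)
        rw [h4]
        exact hε
    · have h1 : ContinuousAt (fun t => point (f t)) t := by
        refine continuous_point.continuousAt.comp ?_
        rw [Topology.IsInducing.subtypeVal.continuousAt_iff]
        refine (rayCoord_continuous ha).continuousAt.comp ?_
        refine continuous_subtype_val.continuousAt.div
          (continuous_const.sub continuous_subtype_val).continuousAt ?_
        have := hlt t ht
        linarith
      refine h1.congr ?_
      filter_upwards [isOpen_ne.mem_nhds ht] with s hs
      exact (if_neg hs).symm
  have hu_inj : ∀ s t : unitInterval, s ≠ 1 → t ≠ 1 → s.1 / (1 - s.1) = t.1 / (1 - t.1) →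
      s = t := by
    intro s t hs ht h
    have h1 := hlt s hs
    have h2 := hlt t ht
    rw [div_eq_div_iff (by linarith) (by linarith)] at h
    exact Subtype.ext (by linarith)
  have hinj : Function.Injective g := by
    intro s t hst
    by_cases hs : s = 1 <;> by_cases ht : t = 1
    · rw [hs, ht]
    · simp only [g, if_pos hs, if_neg ht] at hst
      cases hst
    · simp only [g, if_neg hs, if_pos ht] at hst
      cases hst
    · simp only [g, if_neg hs, if_neg ht] at hst
      have h1 : f s = f t := by injection hst
      exact hu_inj s t hs ht (rayCoord_injOn ha (hu s) (hu t) (congrArg Subtype.val h1))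
  have hg0 : g 0 = vertex (a 0) := by
    have h0 : g 0 = point (f 0) := if_neg (by simp)
    rw [h0]
    refine eq_vertex_of_mem_on ⟨_, rfl, fun v hv => ?_⟩
    obtain ⟨j, rfl, hj⟩ := rayCoord_pos ha hv
    simp only [Set.Icc.coe_zero, zero_div, zero_sub, abs_neg, Nat.abs_cast] at hj
    have : j < 1 := by exact_mod_cast hj
    obtain rfl : j = 0 := by omega
    rfl
  refine ⟨⟨⟨g, hcont⟩, hg0, if_pos rfl⟩, hinj, ?_⟩
  change Set.range g = _
  ext p
  constructor
  · rintro ⟨t, rfl⟩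
    by_cases ht : t = 1
    · exact .inr (if_pos ht)
    · left
      have hgt : g t = point (f t) := if_neg ht
      rw [hgt]
      exact Set.mem_iUnion.2 ⟨⌊t.1 / (1 - t.1)⌋₊, point_mem_on.2 fun v hv =>
        rayCoord_support ha (Nat.floor_le (hu t)) (Nat.lt_floor_add_one _).le hv⟩
  · rintro (hp | rfl)
    · obtain ⟨i, ξ, rfl, hξ⟩ := Set.mem_iUnion.1 hp
      have hs0 : 0 ≤ ξ.1 (a (i + 1)) := realization_nonneg _ _
      have hne : a i ≠ a (i + 1) := (hadj i).ne
      have hs1 : ξ.1 (a (i + 1)) ≤ 1 := by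
        have h1 := sum_eq_one ξ (S := {a i, a (i + 1)}) fun v hv => by simpa using hξ v hv
        rw [Finset.sum_pair hne] at h1
        linarith [realization_nonneg ξ (a i)]
      -- The point lies at distance `u` along the ray; its parameter is `u / (1 + u)`.
      set u : ℝ := i + ξ.1 (a (i + 1)) with hu_def
      have hu0 : 0 ≤ u := by positivity
      refine ⟨⟨u / (1 + u), by positivity, by rw [div_le_one (by positivity)]; linarith⟩, ?_⟩
      have hu' : u / (1 + u) / (1 - u / (1 + u)) = u := by
        have : 1 + u ≠ 0 := by positivity
        field_simp
        ring
      have h1 : u / (1 + u) ≠ 1 := by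
        rw [Ne, div_eq_one_iff_eq (by positivity)]
        linarith
      rw [show g _ = point (f _) from if_neg fun h => h1 (congrArg Subtype.val h)]
      refine congrArg point (eq_of_coord_eq hne (fun v hv => ?_) hξ ?_)
      · simp only [f, hu'] at hv
        exact rayCoord_support ha (by linarith) (by linarith) hv
      · simp only [f, hu']
        rw [rayCoord_apply ha, hu_def]
        push_cast
        rw [abs_of_nonpos (by linarith), max_eq_right (by linarith)]
        ring
    · exact ⟨1, if_pos rfl⟩

end ray

/-- An edge is an arc. -/
theorem isArc_edge {x y : V} (hxy : G.Adj x y) :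
    IsArc (vertex x : Freudenthal G) (vertex y) (On G {x, y}) := by
  classical
  have hmem : ∀ t : unitInterval,
      (1 - t.1) • (Pi.single x 1 : V → ℝ) + t.1 • Pi.single y 1 ∈ G.realization := by
    intro t
    refine ⟨x, y, .inr hxy, 1 - t.1, t.1, by linarith [t.2.2], t.2.1, by ring, ?_⟩
    congr!
  let f : unitInterval → G.realization := fun t => ⟨_, hmem t⟩
  have hf : ∀ t v, (f t).1 v = (if v = x then 1 - t.1 else 0) + if v = y then t.1 else 0 := by
    intro t v
    simp [f, Pi.single_apply]
  have hfy : ∀ t, (f t).1 y = t.1 := by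
    intro t
    rw [hf, if_neg hxy.ne', if_pos rfl, zero_add]
  have hfs : ∀ t v, 0 < (f t).1 v → v ∈ ({x, y} : Set V) := by
    intro t v hv
    by_contra hcon
    rw [Set.mem_insert_iff, Set.mem_singleton_iff, not_or] at hcon
    rw [hf, if_neg hcon.1, if_neg hcon.2] at hv
    simp at hv
  have hcont : Continuous fun t => (point (f t) : Freudenthal G) := by
    refine continuous_point.comp (Continuous.subtype_mk ?_ _)
    fun_prop
  refine ⟨⟨⟨fun t => point (f t), hcont⟩, ?_, ?_⟩, ?_, ?_⟩
  · refine eq_vertex_of_mem_on (point_mem_on.2 fun v hv => ?_)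
    by_contra hcon
    have hne : v ≠ x := hcon
    rw [hf, if_neg hne] at hv
    simp at hv
  · refine eq_vertex_of_mem_on (point_mem_on.2 fun v hv => ?_)
    by_contra hcon
    have hne : v ≠ y := hcon
    rw [hf, if_neg hne] at hv
    simp at hv
  · intro s t hst
    have h1 : f s = f t := by injection hst
    exact Subtype.ext (by rw [← hfy s, ← hfy t, h1])
  · change Set.range (fun t => (point (f t) : Freudenthal G)) = _
    ext p
    constructor
    · rintro ⟨t, rfl⟩
      exact point_mem_on.2 (hfs t)
    · rintro ⟨ξ, rfl, hξ⟩
      have hs1 : ξ.1 y ≤ 1 := by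
        have h1 := sum_eq_one ξ (S := {x, y}) fun v hv => by simpa using hξ v hv
        rw [Finset.sum_pair hxy.ne] at h1
        linarith [realization_nonneg ξ x]
      refine ⟨⟨ξ.1 y, realization_nonneg _ _, hs1⟩, congrArg point ?_⟩
      exact eq_of_coord_eq hxy.ne (hfs _) hξ (hfy _)

end Freudenthal

end SimpleGraph

/-! ### Concatenating arcs along a cycle into a circle -/

namespace SimpleGraph

namespace Freudenthal

theorem IsArc.symm {X : Type*} [TopologicalSpace X] {a b : X} {S : Set X} (h : IsArc a b S) :
    IsArc b a S := by
  obtain ⟨γ, hγ, rfl⟩ := h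
  exact ⟨γ.symm, hγ.comp unitInterval.symm_bijective.injective, γ.symm_range⟩

theorem IsArc.left_mem {X : Type*} [TopologicalSpace X] {a b : X} {S : Set X} (h : IsArc a b S) :
    a ∈ S := by
  obtain ⟨γ, hγ, rfl⟩ := h
  exact ⟨0, γ.source⟩

theorem IsArc.right_mem {X : Type*} [TopologicalSpace X] {a b : X} {S : Set X} (h : IsArc a b S) :
    b ∈ S :=
  h.symm.left_mem

theorem IsArc.trans {X : Type*} [TopologicalSpace X] {a b c : X} {S T : Set X} (h : IsArc a b S)
    (h' : IsArc b c T) (hST : ∀ x ∈ S, x ∈ T → x = b) : IsArc a c (S ∪ T) := by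
  obtain ⟨γ, hγ, rfl⟩ := h
  obtain ⟨γ', hγ', rfl⟩ := h'
  have key : ∀ s t : unitInterval, (s : ℝ) ≤ 1 / 2 → ¬ (t : ℝ) ≤ 1 / 2 →
      (γ.trans γ') s ≠ (γ.trans γ') t := by
    intro s t hs ht hst
    rw [Path.trans_apply, Path.trans_apply, dif_pos hs, dif_neg ht] at hst
    have h1 := hST _ ⟨_, rfl⟩ ⟨_, hst.symm⟩
    have h2 := hγ' ((hst.symm.trans h1).trans γ'.source.symm)
    have h3 := congrArg Subtype.val h2
    simp only [Set.Icc.coe_zero] at h3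
    exact ht (by linarith)
  refine ⟨γ.trans γ', fun s t hst => ?_, Path.trans_range γ γ'⟩
  by_cases hs : (s : ℝ) ≤ 1 / 2 <;> by_cases ht : (t : ℝ) ≤ 1 / 2
  · rw [Path.trans_apply, Path.trans_apply, dif_pos hs, dif_pos ht] at hst
    have h3 := congrArg Subtype.val (hγ hst)
    exact Subtype.ext (by simp only at h3; linarith)
  · exact absurd hst (key s t hs ht)
  · exact absurd hst.symm (key t s ht hs)
  · rw [Path.trans_apply, Path.trans_apply, dif_neg hs, dif_neg ht] at hst
    have h3 := congrArg Subtype.val (hγ' hst)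
    exact Subtype.ext (by simp only at h3; linarith)

/-- The loop descends to the compact additive circle; being continuous and injective into a
Hausdorff space, the induced map is an embedding. -/
theorem isCircle_of_loop {V : Type*} {G : SimpleGraph V} {a : Freudenthal G} (δ : _root_.Path a a)
    (hδ : ∀ s t, s ≠ 1 → t ≠ 1 → δ s = δ t → s = t) : IsCircle (Set.range δ) := by
  have : Fact ((0 : ℝ) < 1) := ⟨one_pos⟩
  let g : AddCircle (1 : ℝ) → Freudenthal G := AddCircle.liftIco 1 0 δ.extend
  have hval : ∀ s : unitInterval, s ≠ 1 → g (s : ℝ) = δ s := by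
    intro s hs
    have h1 : (s : ℝ) < 1 := lt_of_le_of_ne s.2.2 fun h => hs (Subtype.ext h)
    change AddCircle.liftIco 1 0 δ.extend (s : ℝ) = δ s
    rw [AddCircle.liftIco_zero_coe_apply ⟨s.2.1, h1⟩, Path.extend_apply _ s.2]
  have hrep : ∀ x : AddCircle (1 : ℝ), ∃ s : unitInterval, s ≠ 1 ∧
      ((s : ℝ) : AddCircle (1 : ℝ)) = x := by
    intro x
    have h1 := (AddCircle.equivIco (1 : ℝ) 0 x).2
    have h2 := h1.2.trans_eq (zero_add 1)
    refine ⟨⟨_, h1.1, h2.le⟩, fun h => h2.ne (congrArg Subtype.val h), ?_⟩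
    exact (AddCircle.equivIco (1 : ℝ) 0).symm_apply_apply x
  have hcont : Continuous g :=
    AddCircle.liftIco_zero_continuous (by simp) δ.continuous_extend.continuousOn
  have hinj : Function.Injective g := by
    intro x y hxy
    obtain ⟨s, hs, rfl⟩ := hrep x
    obtain ⟨t, ht, rfl⟩ := hrep y
    rw [hval s hs, hval t ht] at hxy
    rw [hδ s t hs ht hxy]
  have hrange : Set.range g = Set.range δ := by
    ext p
    constructor
    · rintro ⟨x, rfl⟩
      obtain ⟨s, hs, rfl⟩ := hrep x
      exact ⟨s, (hval s hs).symm⟩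
    · rintro ⟨s, rfl⟩
      by_cases hs : s = 1
      · refine ⟨((0 : unitInterval) : ℝ), ?_⟩
        rw [hval 0 (by simp), hs, δ.source, δ.target]
      · exact ⟨_, hval s hs⟩
  let e : Circle ≃ₜ AddCircle (1 : ℝ) := (AddCircle.homeomorphCircle one_ne_zero).symm
  have hemb : Topology.IsEmbedding g := (hcont.isClosedEmbedding hinj).isEmbedding
  exact ⟨g ∘ e, hemb.comp e.isEmbedding, by rw [e.surjective.range_comp, hrange]⟩

theorem IsArc.isCircle {V : Type*} {G : SimpleGraph V} {a b : Freudenthal G}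
    {S T : Set (Freudenthal G)} (h : IsArc a b S) (h' : IsArc b a T)
    (hST : ∀ x ∈ S, x ∈ T → x = a ∨ x = b) : IsCircle (S ∪ T) := by
  obtain ⟨γ, hγ, rfl⟩ := h
  obtain ⟨γ', hγ', rfl⟩ := h'
  rw [← Path.trans_range]
  have key : ∀ s t : unitInterval, (s : ℝ) ≤ 1 / 2 → ¬ (t : ℝ) ≤ 1 / 2 → t ≠ 1 →
      (γ.trans γ') s ≠ (γ.trans γ') t := by
    intro s t hs ht ht1 hst
    rw [Path.trans_apply, Path.trans_apply, dif_pos hs, dif_neg ht] at hst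
    rcases hST _ ⟨_, rfl⟩ ⟨_, hst.symm⟩ with h1 | h1
    · have h2 := hγ' ((hst.symm.trans h1).trans γ'.target.symm)
      have h3 := congrArg Subtype.val h2
      simp only [Set.Icc.coe_one] at h3
      exact ht1 (Subtype.ext (by simp only [Set.Icc.coe_one]; linarith))
    · have h2 := hγ' ((hst.symm.trans h1).trans γ'.source.symm)
      have h3 := congrArg Subtype.val h2
      simp only [Set.Icc.coe_zero] at h3
      exact ht (by linarith)
  refine isCircle_of_loop _ fun s t hs1 ht1 hst => ?_
  by_cases hs : (s : ℝ) ≤ 1 / 2 <;> by_cases ht : (t : ℝ) ≤ 1 / 2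
  · rw [Path.trans_apply, Path.trans_apply, dif_pos hs, dif_pos ht] at hst
    have h3 := congrArg Subtype.val (hγ hst)
    exact Subtype.ext (by simp only at h3; linarith)
  · exact absurd hst (key s t hs ht ht1)
  · exact absurd hst.symm (key t s ht hs hs1)
  · rw [Path.trans_apply, Path.trans_apply, dif_neg hs, dif_neg ht] at hst
    have h3 := congrArg Subtype.val (hγ' hst)
    exact Subtype.ext (by simp only at h3; linarith)

section cycle

variable {V W : Type*} {G : SimpleGraph W} {R : V → V → Prop} {P : V → Freudenthal G}
  {Seg : V → V → Set (Freudenthal G)}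

-- Segments may depend on the direction of a step. Hence `hInt` only compares steps with different
-- starts and different ends that are not reverses of each other, as on a directed cycle.
variable (hSeg : ∀ p q, R p q → IsArc (P p) (P q) (Seg p q))
  (hInt : ∀ p q p' q', R p q → R p' q' → p ≠ p' → q ≠ q' → ¬ (p = q' ∧ q = p') →
    ∀ x ∈ Seg p q, x ∈ Seg p' q' → (p = q' ∧ x = P p) ∨ (q = p' ∧ x = P q))

include hSeg hInt

/-- The restrictions `p ≠ b` and `q ≠ a` make `hInt` applicable when a further step is attached.
Entering and leaving segments are recorded separately because they may carry different vertices. -/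
theorem exists_isArc {a b : V} {M : Multiset V} (h : SpanPath R a b M) (hM : M.Nodup)
    (hab : a ≠ b) : ∃ S, IsArc (P a) (P b) S ∧
      (∀ x ∈ S, ∃ p ∈ M, ∃ q ∈ M, R p q ∧ p ≠ b ∧ q ≠ a ∧ x ∈ Seg p q) ∧
      (∀ q ∈ M, q ≠ a → ∃ p ∈ M, R p q ∧ Seg p q ⊆ S) ∧
      (∀ p ∈ M, p ≠ b → ∃ q ∈ M, R p q ∧ Seg p q ⊆ S) := by
  induction h with
  | single a => exact absurd rfl hab
  | @cons a c b M h h' ih =>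
    obtain ⟨haM, hM'⟩ := Multiset.nodup_cons.1 hM
    have hcM := h'.left_mem
    have hbM := h'.right_mem
    have hac : a ≠ c := fun h => haM (h ▸ hcM)
    by_cases hcb : c = b
    · subst hcb
      have hMc : M = {c} := by
        rcases h'.uncons with ⟨-, h1⟩ | ⟨e, M', -, h2, rfl⟩
        · exact h1
        · exact absurd h2.right_mem (Multiset.nodup_cons.1 hM').1
      subst hMc
      refine ⟨Seg a c, hSeg _ _ h, fun x hx => ⟨a, by simp, c, by simp, h, hac, hac.symm, hx⟩,
        fun q hq hqa => ⟨a, by simp, ?_⟩, fun p hp hpc => ⟨c, by simp, ?_⟩⟩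
      · rw [Multiset.mem_cons, Multiset.mem_singleton] at hq
        rw [hq.resolve_left hqa]
        exact ⟨h, subset_rfl⟩
      · rw [Multiset.mem_cons, Multiset.mem_singleton] at hp
        rw [hp.resolve_right hpc]
        exact ⟨h, subset_rfl⟩
    · obtain ⟨S, hS, hS1, hS2, hS3⟩ := ih hM' hcb
      refine ⟨Seg a c ∪ S, (hSeg _ _ h).trans hS fun x hx hxS => ?_, ?_, ?_, ?_⟩
      · obtain ⟨p, hp, q, hq, hpq, hpb, hqc, hxpq⟩ := hS1 x hxS
        rcases hInt a c p q h hpq (fun h => haM (h ▸ hp)) hqc.symm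
          (fun h => haM (h.1 ▸ hq)) x hx hxpq with ⟨h1, -⟩ | ⟨-, h1⟩
        · exact absurd (h1 ▸ hq) haM
        · exact h1
      · rintro x (hx | hx)
        · exact ⟨a, by simp, c, by simp [hcM], h, hab, hac.symm, hx⟩
        · obtain ⟨p, hp, q, hq, hpq, hpb, hqc, hxpq⟩ := hS1 x hx
          exact ⟨p, by simp [hp], q, by simp [hq], hpq, hpb, fun h => haM (h ▸ hq), hxpq⟩
      · intro q hq hqa
        by_cases hqc : q = c
        · subst hqc
          exact ⟨a, by simp, h, Set.subset_union_left⟩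
        · obtain ⟨p, hp, hpq, hsub⟩ := hS2 q ((Multiset.mem_cons.1 hq).resolve_left hqa) hqc
          exact ⟨p, by simp [hp], hpq, hsub.trans Set.subset_union_right⟩
      · intro p hp hpb
        rcases Multiset.mem_cons.1 hp with rfl | hp
        · exact ⟨c, by simp [hcM], h, Set.subset_union_left⟩
        · obtain ⟨q, hq, hpq, hsub⟩ := hS3 p hp hpb
          exact ⟨q, by simp [hq], hpq, hsub.trans Set.subset_union_right⟩

/-- Replacing the steps of a cycle by arcs yields a circle. -/
theorem exists_isCircle {a b : V} {M : Multiset V} (h : SpanPath R a b M) (hba : R b a)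
    (hM : M.Nodup) (hcard : 3 ≤ M.card) : ∃ C : Set (Freudenthal G), IsCircle C ∧
      (∀ q ∈ M, ∃ p ∈ M, R p q ∧ Seg p q ⊆ C) ∧ (∀ p ∈ M, ∃ q ∈ M, R p q ∧ Seg p q ⊆ C) := by
  rcases h.uncons with ⟨-, rfl⟩ | ⟨c, M', hac, h', rfl⟩
  · simp at hcard
  obtain ⟨haM, hM'⟩ := Multiset.nodup_cons.1 hM
  have hcM := h'.left_mem
  have hbM := h'.right_mem
  have hca : c ≠ a := fun h => haM (h ▸ hcM)
  have hba' : b ≠ a := fun h => haM (h ▸ hbM)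
  have hcb : c ≠ b := by
    rintro rfl
    rcases h'.uncons with ⟨-, rfl⟩ | ⟨e, M', -, h2, rfl⟩
    · simp at hcard
    · exact (Multiset.nodup_cons.1 hM').1 h2.right_mem
  obtain ⟨S, hS, hS1, hS2, hS3⟩ := exists_isArc hSeg hInt h' hM' hcb
  have hT : IsArc (P b) (P c) (Seg b a ∪ Seg a c) := by
    refine (hSeg _ _ hba).trans (hSeg _ _ hac) fun x hx hx' => ?_
    rcases hInt b a a c hba hac hba' hca.symm (fun h => hcb h.1.symm) x hx hx' with
      ⟨h1, -⟩ | ⟨-, h1⟩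
    · exact absurd h1.symm hcb
    · exact h1
  refine ⟨S ∪ (Seg b a ∪ Seg a c), hS.isCircle hT ?_, fun q hq => ?_, fun p hp => ?_⟩
  · intro x hxS hx
    obtain ⟨p, hp, q, hq, hpq, hpb, hqc, hxpq⟩ := hS1 x hxS
    have hpa : p ≠ a := fun h => haM (h ▸ hp)
    have hqa : q ≠ a := fun h => haM (h ▸ hq)
    rcases hx with hx | hx
    · rcases hInt p q b a hpq hba hpb hqa (fun h => hpa h.1) x hxpq hx with ⟨h1, -⟩ | ⟨h1, h2⟩
      · exact absurd h1 hpa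
      · exact .inr (h1 ▸ h2)
    · rcases hInt p q a c hpq hac hpa hqc (fun h => hqa h.2) x hxpq hx with ⟨h1, h2⟩ | ⟨h1, -⟩
      · exact .inl (h1 ▸ h2)
      · exact absurd h1 hqa
  · rcases Multiset.mem_cons.1 hq with rfl | hq
    · exact ⟨b, by simp [hbM], hba, fun x hx => .inr (.inl hx)⟩
    · by_cases hqc : q = c
      · subst hqc
        exact ⟨a, by simp, hac, fun x hx => .inr (.inr hx)⟩
      · obtain ⟨p, hp, hpq, hsub⟩ := hS2 q hq hqc
        exact ⟨p, by simp [hp], hpq, hsub.trans Set.subset_union_left⟩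
  · rcases Multiset.mem_cons.1 hp with rfl | hp
    · exact ⟨c, by simp [hcM], hac, fun x hx => .inr (.inr hx)⟩
    · by_cases hpb : p = b
      · subst hpb
        exact ⟨a, by simp, hba, fun x hx => .inr (.inl hx)⟩
      · obtain ⟨q, hq, hpq, hsub⟩ := hS3 p hp hpb
        exact ⟨q, by simp [hq], hpq, hsub.trans Set.subset_union_left⟩

end cycle

end Freudenthal

end SimpleGraph

/-! ### Assembling the Hamilton circle -/

namespace SimpleGraph

open Filter Freudenthal

universe u

/-- The sequence `a` preceded by `p`. -/
def consSeq {V : Type*} (p : V) (a : ℕ → V) : ℕ → V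
  | 0 => p
  | i + 1 => a i

/-- The points of the 1-complex on the ray which starts in `p` and continues along `a`. -/
def rayPoints {V : Type u} (G : SimpleGraph V) (p : V) (a : ℕ → V) : Set (Freudenthal G) :=
  ⋃ i, On G {consSeq p a i, consSeq p a (i + 1)}

variable {V : Type u} {G : SimpleGraph V}

theorem isArc_rayPoints {p : V} {a : ℕ → V} (ha : Function.Injective a)
    (hadj : ∀ i, G.Adj (a i) (a (i + 1))) (hp : ∀ i, a i ≠ p) (hpa : G.Adj p (a 0)) {ω : G.end}
    (hω : ∀ S : Finset V, ∀ᶠ i in atTop, a i ∈ endComponent S ω) :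
    IsArc (vertex p) (ofEnd ω) (G.rayPoints p a ∪ {ofEnd ω}) := by
  refine isArc_ray (a := consSeq p a) ?_ ?_ fun S => ?_
  · rintro (_ | i) (_ | j) h
    · rfl
    · exact absurd h.symm (hp j)
    · exact absurd h (hp i)
    · rw [ha h]
  · rintro (_ | i)
    · exact hpa
    · exact hadj i
  · obtain ⟨N, hN⟩ := eventually_atTop.1 (hω S)
    refine eventually_atTop.2 ⟨N + 1, fun i hi => ?_⟩
    cases i with
    | zero => omega
    | succ i => exact hN i (by omega)

theorem vertex_mem_rayPoints (p : V) (a : ℕ → V) (i : ℕ) : vertex (a i) ∈ G.rayPoints p a :=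
  Set.mem_iUnion.2 ⟨i, vertex_mem_on (Set.mem_insert_of_mem _ rfl)⟩

theorem rayPoints_subset {p : V} {a : ℕ → V} {E : Set V} (hp : p ∈ E) (ha : ∀ i, a i ∈ E) :
    G.rayPoints p a ⊆ On G E := by
  have h1 : ∀ i, consSeq p a i ∈ E := by
    rintro (_ | i)
    · exact hp
    · exact ha i
  exact Set.iUnion_subset fun i => on_mono
    (Set.insert_subset (h1 i) (Set.singleton_subset_iff.2 (h1 _)))

theorem IsLayered.exists_isHamiltonCircle {d key : V → ℕ} {n : ℕ} (hL : G.IsLayered d n)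
    (hconn : G.IsVertexConnected 2) {v₀ : V} (h0 : d v₀ = 0) (hfin : ∀ k, {x | d x = k}.Finite)
    (hkey : Function.Injective key) (hmono : ∀ x y, d x < d y → key x < key y) :
    ∃ C : Set (Freudenthal G), IsHamiltonCircle C := by
  classical
  obtain ⟨M, ⟨⟨a, b, hab, hba⟩, hMd, hM3⟩, hM⟩ := hL.exists_core_cycle (key := key) hconn hfin h0
  have h1 : ∀ τ, ∃ (e : Freudenthal G) (α β : ℕ → V), G.IsRep d key n τ →
      ∃ ω, e = ofEnd ω ∧ G.TailRays d n τ ω α β := by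
    intro τ
    by_cases hτ : G.IsRep d key n τ
    · obtain ⟨ω, α, β, h⟩ := hL.exists_tailRays hconn h0 hfin hkey hmono hτ
      exact ⟨ofEnd ω, α, β, fun _ => ⟨ω, rfl, h⟩⟩
    · exact ⟨vertex v₀, fun _ => v₀, fun _ => v₀, fun h => absurd h hτ⟩
  choose e α β hrays using h1
  let R : V → V → Prop := fun p q => G.Adj p q ∧ p ∈ core G d key n ∧ q ∈ core G d key n
  let P : V → Freudenthal G := fun v => if d v ≤ n then vertex v else e v
  -- A representative stands for the end of its tail: the step into it runs along `α` to the end,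
  -- the step out of it returns along `β`.
  let Seg : V → V → Set (Freudenthal G) := fun p q =>
    if n < d q then G.rayPoints p (α q) ∪ {e q}
    else if n < d p then G.rayPoints q (β p) ∪ {e p}
    else On G {p, q}
  have hrep : ∀ {q}, q ∈ core G d key n → n < d q → G.IsRep d key n q := fun hq hn =>
    hq.resolve_left (not_le.2 hn)
  -- Representatives are pairwise non-adjacent, so no step joins two of them and the cases of `Seg`
  -- do not overlap.
  have hlow : ∀ {p q}, R p q → n < d q → d p = n := by
    rintro p q ⟨hpq, hp, hq⟩ hn
    have h2 := (hrep hq hn).1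
    rcases hp with hp | hp
    · have := hL.level.lip hpq.symm
      omega
    · exact absurd hpq (hp.not_adj (hrep hq hn))
  have hlow' : ∀ {p q}, R p q → n < d p → d q = n := fun h hn =>
    hlow ⟨h.1.symm, h.2.2, h.2.1⟩ hn
  have hαtail : ∀ {τ}, G.IsRep d key n τ → ∀ i, α τ i ∈ G.tail d n τ := fun hτ i => by
    obtain ⟨ω, -, h⟩ := hrays _ hτ
    exact (h.mem_tail _).2 (.inl ⟨i, rfl⟩)
  have hβtail : ∀ {τ}, G.IsRep d key n τ → ∀ i, β τ i ∈ G.tail d n τ := fun hτ i => by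
    obtain ⟨ω, -, h⟩ := hrays _ hτ
    exact (h.mem_tail _).2 (.inr ⟨i, rfl⟩)
  have hne : ∀ {p τ z}, d p = n → z ∈ G.tail d n τ → z ≠ p := by
    rintro p τ z hp hz rfl
    exact hz.1.ne' hp
  have hSeg : ∀ p q, R p q → IsArc (P p) (P q) (Seg p q) := by
    intro p q hpq
    by_cases hq : n < d q
    · have hp := hlow hpq hq
      obtain ⟨ω, hω, h⟩ := hrays q (hrep hpq.2.2 hq)
      simp only [P, Seg, if_pos hp.le, if_neg (not_le.2 hq), if_pos hq, hω]
      exact isArc_rayPoints h.inj_left h.adj_left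
        (fun i => hne hp (hαtail (hrep hpq.2.2 hq) i)) (h.start_left p hp hpq.1) h.end_left
    by_cases hp : n < d p
    · have hq' := hlow' hpq hp
      obtain ⟨ω, hω, h⟩ := hrays p (hrep hpq.2.1 hp)
      simp only [P, Seg, if_pos hq'.le, if_neg (not_le.2 hp), if_neg hq, if_pos hp, hω]
      exact (isArc_rayPoints h.inj_right h.adj_right
        (fun i => hne hq' (hβtail (hrep hpq.2.1 hp) i)) (h.start_right q hq' hpq.1.symm)
        h.end_right).symm
    · simp only [P, Seg, if_pos (not_lt.1 hp), if_pos (not_lt.1 hq), if_neg hp, if_neg hq]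
      exact isArc_edge hpq.1
  -- The set of vertices that can support a point of the segment other than an end.
  let E : V → V → Set V := fun p q => {v | (d v ≤ n ∧ (v = p ∨ v = q)) ∨
    (n < d q ∧ ∃ i, α q i = v) ∨ (n < d p ∧ ∃ i, β p i = v)}
  have hcarrier : ∀ p q, R p q → ∀ x ∈ Seg p q, x ∈ On G (E p q) ∨
      ∃ τ, n < d τ ∧ (τ = p ∨ τ = q) ∧ x = e τ := by
    intro p q hpq x hx
    by_cases hq : n < d q
    · simp only [Seg, if_pos hq] at hx
      rcases hx with hx | hx
      · exact .inl (rayPoints_subset (.inl ⟨(hlow hpq hq).le, .inl rfl⟩)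
          (fun i => .inr (.inl ⟨hq, i, rfl⟩)) hx)
      · exact .inr ⟨q, hq, .inr rfl, hx⟩
    by_cases hp : n < d p
    · simp only [Seg, if_pos hp, if_neg hq] at hx
      rcases hx with hx | hx
      · exact .inl (rayPoints_subset (.inl ⟨(hlow' hpq hp).le, .inr rfl⟩)
          (fun i => .inr (.inr ⟨hp, i, rfl⟩)) hx)
      · exact .inr ⟨p, hp, .inl rfl, hx⟩
    · simp only [Seg, if_neg hp, if_neg hq] at hx
      refine .inl (on_mono ?_ hx)
      rintro v (rfl | rfl)
      · exact .inl ⟨not_lt.1 hp, .inl rfl⟩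
      · exact .inl ⟨not_lt.1 hq, .inr rfl⟩
  have hEtail : ∀ {p q v}, R p q → v ∈ E p q → n < d v →
      (n < d q ∧ G.IsRep d key n q ∧ v ∈ G.tail d n q ∧ ∃ i, α q i = v) ∨
      (n < d p ∧ G.IsRep d key n p ∧ v ∈ G.tail d n p ∧ ∃ i, β p i = v) := by
    rintro p q v hpq (⟨h1, -⟩ | ⟨h1, i, rfl⟩ | ⟨h1, i, rfl⟩) hv
    · exact absurd hv (not_lt.2 h1)
    · exact .inl ⟨h1, hrep hpq.2.2 h1, hαtail (hrep hpq.2.2 h1) i, i, rfl⟩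
    · exact .inr ⟨h1, hrep hpq.2.1 h1, hβtail (hrep hpq.2.1 h1) i, i, rfl⟩
  have hEint : ∀ p q p' q', R p q → R p' q' → p ≠ p' → q ≠ q' → ∀ v ∈ E p q, v ∈ E p' q' →
      d v ≤ n ∧ ((v = p ∧ p = q') ∨ (v = q ∧ q = p')) := by
    intro p q p' q' hpq hpq' hp hq v hv hv'
    by_cases hvn : d v ≤ n
    · refine ⟨hvn, ?_⟩
      have low : ∀ {p q}, R p q → v ∈ E p q → v = p ∨ v = q := by
        rintro p q hpq (⟨-, h⟩ | ⟨h1, i, rfl⟩ | ⟨h1, i, rfl⟩)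
        · exact h
        · exact absurd (hαtail (hrep hpq.2.2 h1) i).1 (not_lt.2 hvn)
        · exact absurd (hβtail (hrep hpq.2.1 h1) i).1 (not_lt.2 hvn)
      rcases low hpq hv with h1 | h1 <;> rcases low hpq' hv' with h2 | h2
      · exact absurd (h1.symm.trans h2) hp
      · exact .inl ⟨h1, h1.symm.trans h2⟩
      · exact .inr ⟨h1, h1.symm.trans h2⟩
      · exact absurd (h1.symm.trans h2) hq
    · have hvn' := not_le.1 hvn
      exfalso
      have hdisj : ∀ {τ}, G.IsRep d key n τ → (∃ i, α τ i = v) → (∃ i, β τ i = v) → False := by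
        rintro τ hτ ⟨i, hi⟩ ⟨j, hj⟩
        obtain ⟨ω, -, h⟩ := hrays τ hτ
        exact h.disj i j (hi.trans hj.symm)
      rcases hEtail hpq hv hvn' with ⟨-, h1, h2, h3⟩ | ⟨-, h1, h2, h3⟩ <;>
        rcases hEtail hpq' hv' hvn' with ⟨-, h4, h5, h6⟩ | ⟨-, h4, h5, h6⟩ <;>
        have h7 := hL.tail_unique h1 h4 h2 h5
      · exact hq h7
      · subst h7; exact hdisj h1 h3 h6
      · subst h7; exact hdisj h1 h6 h3
      · exact hp h7
  have hPe : ∀ {τ}, n < d τ → P τ = e τ := fun h => if_neg (not_le.2 h)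
  have hPv : ∀ {v}, d v ≤ n → P v = vertex v := fun h => if_pos h
  have hInt : ∀ p q p' q', R p q → R p' q' → p ≠ p' → q ≠ q' → ¬ (p = q' ∧ q = p') →
      ∀ x ∈ Seg p q, x ∈ Seg p' q' → (p = q' ∧ x = P p) ∨ (q = p' ∧ x = P q) := by
    intro p q p' q' hpq hpq' hp hq hn x hx hx'
    have hmem : ∀ {p q τ}, R p q → n < d τ → (τ = p ∨ τ = q) → G.IsRep d key n τ := by
      rintro p q τ h1 h2 (rfl | rfl)
      · exact hrep h1.2.1 h2
      · exact hrep h1.2.2 h2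
    -- A common point of the 1-complex is supported on common vertices, leaving only a shared
    -- endpoint. A common end has a unique representative, which must then be the shared vertex of
    -- the two steps.
    rcases hcarrier p q hpq x hx with h1 | ⟨τ, hτn, hτ, hxτ⟩ <;>
      rcases hcarrier p' q' hpq' x hx' with h2 | ⟨τ', hτn', hτ', h3⟩
    · have h3 := on_inter h1 h2
      have h4 := hEint p q p' q' hpq hpq' hp hq
      by_cases hpq1 : p = q'
      · left
        have h5 : ∀ v ∈ E p q ∩ E p' q', v = p ∧ d p ≤ n := by
          rintro v ⟨hv, hv'⟩
          obtain ⟨h6, ⟨rfl, -⟩ | ⟨-, h7⟩⟩ := h4 v hv hv'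
          · exact ⟨rfl, h6⟩
          · exact absurd ⟨hpq1, h7⟩ hn
        have h6 : (E p q ∩ E p' q').Nonempty := by
          rw [Set.nonempty_iff_ne_empty]
          intro h
          rw [h] at h3
          exact notMem_on_empty x h3
        obtain ⟨v, hv⟩ := h6
        refine ⟨hpq1, ?_⟩
        rw [hPv (h5 v hv).2]
        exact eq_vertex_of_mem_on (on_mono (fun v hv => (h5 v hv).1) h3)
      · right
        have h5 : ∀ v ∈ E p q ∩ E p' q', v = q ∧ d q ≤ n ∧ q = p' := by
          rintro v ⟨hv, hv'⟩
          obtain ⟨h6, ⟨-, h7⟩ | ⟨rfl, h7⟩⟩ := h4 v hv hv'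
          · exact absurd h7 hpq1
          · exact ⟨rfl, h6, h7⟩
        have h6 : (E p q ∩ E p' q').Nonempty := by
          rw [Set.nonempty_iff_ne_empty]
          intro h
          rw [h] at h3
          exact notMem_on_empty x h3
        obtain ⟨v, hv⟩ := h6
        refine ⟨(h5 v hv).2.2, ?_⟩
        rw [hPv (h5 v hv).2.1]
        exact eq_vertex_of_mem_on (on_mono (fun v hv => (h5 v hv).1) h3)
    · obtain ⟨ω, hω, -⟩ := hrays τ' (hmem hpq' hτn' hτ')
      rw [h3, hω] at h1
      exact absurd h1 (ofEnd_notMem_on _ _)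
    · obtain ⟨ω, hω, -⟩ := hrays τ (hmem hpq hτn hτ)
      rw [hxτ, hω] at h2
      exact absurd h2 (ofEnd_notMem_on _ _)
    · have hr := hmem hpq hτn hτ
      have hr' := hmem hpq' hτn' hτ'
      obtain ⟨ω, hω, h⟩ := hrays τ hr
      obtain ⟨ω', hω', h'⟩ := hrays τ' hr'
      rw [hxτ, hω, hω'] at h3
      injection h3 with h3
      subst h3
      obtain rfl := hL.end_unique hfin hr hr' h h'
      rcases hτ with rfl | rfl <;> rcases hτ' with rfl | rfl
      · exact absurd rfl hp
      · exact .inl ⟨rfl, hxτ.trans (hPe hτn).symm⟩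
      · exact .inr ⟨rfl, hxτ.trans (hPe hτn).symm⟩
      · exact absurd rfl hq
  have hpath : SpanPath R a b M := by
    refine (SpanPath.forall_or_split R hab).elim (fun h => h.mono fun _ _ h => h.2) ?_
    rintro ⟨p, q, M₁, M₂, h1, hpq, hn, h2, rfl⟩
    exact absurd ⟨hpq, (hM p).1 (by simp [h1.right_mem]), (hM q).1 (by simp [h2.left_mem])⟩ hn
  obtain ⟨C, hC, hin, hout⟩ := exists_isCircle hSeg hInt hpath
    ⟨hba, (hM b).1 hab.right_mem, (hM a).1 hab.left_mem⟩ hMd hM3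
  refine ⟨C, hC, fun v => ?_⟩
  by_cases hv : d v ≤ n
  · obtain ⟨p, hp, hpv, hsub⟩ := hin v ((hM v).2 (.inl hv))
    have := (hSeg p v hpv).right_mem
    rw [hPv hv] at this
    exact hsub this
  · obtain ⟨τ, hτ, hvτ⟩ := hL.exists_tail hkey (not_le.1 hv)
    have hτn : n < d τ := by rw [hτ.1]; omega
    obtain ⟨ω, -, h⟩ := hrays τ hτ
    -- Vertices on `α` are covered by the step entering `τ`, those on `β` by the step leaving it.
    rcases (h.mem_tail v).1 hvτ with ⟨i, rfl⟩ | ⟨i, rfl⟩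
    · obtain ⟨p, hp, hpv, hsub⟩ := hin τ ((hM τ).2 (.inr hτ))
      refine hsub ?_
      simp only [Seg, if_pos hτn]
      exact .inl (vertex_mem_rayPoints p (α τ) i)
    · obtain ⟨q, hq, hqv, hsub⟩ := hout τ ((hM τ).2 (.inr hτ))
      refine hsub ?_
      have hqn := hlow' hqv hτn
      simp only [Seg, if_pos hτn, if_neg hqn.not_gt]
      exact .inl (vertex_mem_rayPoints q (β τ) i)

end SimpleGraph

theorem mainTheorem6 {V : Type*} (G : SimpleGraph V) [G.LocallyFinite]
    (hconn : G.IsVertexConnected 2)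
    (hclaw : G.IsInducedFree SimpleGraph.claw)
    (hbull : G.BullHornsHaveCommonNeighbor) :
    ∃ C : Set (SimpleGraph.Freudenthal G), SimpleGraph.IsHamiltonCircle C := by
  have hne : Nonempty V := by
    by_contra h
    rw [not_nonempty_iff] at h
    exact absurd hconn.1 (by simp [ENat.card_eq_zero_iff_empty V |>.2 h])
  obtain ⟨v₀⟩ := hne
  obtain ⟨d, hd, hd0⟩ := SimpleGraph.exists_isLevel hconn.preconnected (Set.singleton_nonempty v₀)
  have h0 : d v₀ = 0 := (hd0 v₀).2 rfl
  have hfin : ∀ k, {x | d x = k}.Finite := hd.finite_level <| by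
    simp only [hd0]
    exact Set.finite_singleton v₀
  -- In a finite graph no vertex reaches level `n`, so the core is the whole graph and no ends
  -- occur.
  obtain ⟨n, hn, hchild⟩ := hd.exists_forall_child hclaw hbull hfin
  obtain ⟨key, hkey, hmono⟩ := SimpleGraph.exists_key hfin
  exact SimpleGraph.IsLayered.exists_isHamiltonCircle (key := key) ⟨hd, hn, hchild, hclaw, hbull⟩
    hconn h0 hfin hkey hmono
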